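/- Let $M$ be a compact connected (Hausdorff) radiant affine $n$-manifold, that is, a manifold with an atlas of charts to $\mathbb R^n$ whose transition maps are locally in $GL(n,\mathbb R)$, and suppose that the boundary of $M$ is empty or totally geodesic and tangent to the radiant vector field (in charts, the boundary lies in hyperplanes through the origin). The radiant vector field $\sum_i x_i\,\partial/\partial x_i$ of $\mathbb R^n$ induces a vector field on $M$, whose flow is the radial flow. A total cross-section is a closed, properly embedded smooth hypersurface $\Sigma\subset M$ that is transverse to the radial flow and meets every flow line; radial projection of the affine charts to $\mathbb{RP}^{n-1}$ induces a real projective structure on $\Sigma$. Generalized affine suspensions are defined as follows. Let $\Sigma'$ be a compact connected real projective $(n-1)$-manifold with empty or totally geodesic boundary, and let $\phi$ be a projective automorphism of $\Sigma'$. Let $\mathrm{dev}:\tilde\Sigma'\to S^{n-1}$ be a developing map on the universal cover, viewed as a map to unit vectors of $\mathbb R^n$. Let $h':\pi_1(\Sigma')\to GL(n,\mathbb R)$ be a homomorphism lifting the holonomy, with $|\det h'(\phi_*\gamma)|=|\det h'(\gamma)|$ for all $\gamma$. Let $\tilde\phi$ be a lift of $\phi$ to $\tilde\Sigma'$, and let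 $\rho'\in GL(n,\mathbb R)$ induce the projective transformation $\rho$ with $\mathrm{dev}\circ\tilde\phi=\rho\circ\mathrm{dev}$. Give $\tilde\Sigma'\times\mathbb R$ the affine structure of the immersion $(x,t)\mapsto e^t\,\mathrm{dev}(x)$. Let $\gamma\in\pi_1(\Sigma')$ act by $(x,t)\mapsto(\gamma x,\,t+\log\|h'(\gamma)\mathrm{dev}(x)\|)$, and let $a(x,t)=(\tilde\phi x,\,t+\log\|\rho'\mathrm{dev}(x)\|)$. Suppose that $\rho'$ is such that $a$ moves some smooth section of the line bundle $(\tilde\Sigma'\times\mathbb R)/\pi_1(\Sigma')\to\Sigma'$ strictly radially outwards. The quotient of $\tilde\Sigma'\times\mathbb R$ by the group generated by $\pi_1(\Sigma')$ and $a$ is a generalized affine suspension over $\Sigma'$ using $\phi$. Then: (1) $M$ admits a total cross-section to the radial flow if and only if $M$ is affinely diffeomorphic to a generalized affine suspension over some compact connected real projective $(n-1)$-manifold with empty or totally geodesic boundary. (2) For every connected total cross-section $\Sigma$ of $M$ there is such a manifold $\Sigma'$ for which $M$ is affinely diffeomorphic to a generalized affine suspension over $\Sigma'$ and $\Sigma$,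 with its induced real projective structure, is projectively diffeomorphic to $\Sigma'$. (3) Conversely, whenever $M$ is affinely diffeomorphic to a generalized affine suspension over such a $\Sigma'$, there is a total cross-section $\Sigma$ of $M$ which, with its induced real projective structure, is projectively diffeomorphic to $\Sigma'$. -/

import Mathlib

open Set Filter Topology
open scoped LinearAlgebra.Projectivization ContDiff

universe u

namespace RadiantAffine

/-- The vector space `ℝⁿ` with its Euclidean norm. -/
abbrev Vec (n : ℕ) : Type := EuclideanSpace ℝ (Fin n)

/-- The general linear group `GL(n, ℝ)`, acting on `ℝⁿ` and on `ℙ(ℝⁿ) = ℝPⁿ⁻¹`; on the latter it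
acts through `PGL(n, ℝ)`. -/
abbrev GLn (n : ℕ) : Type := Vec n ≃ₗ[ℝ] Vec n

/-- Real projective `(n-1)`-space with the quotient topology from `ℝⁿ ∖ {0}`. -/
abbrev RP (n : ℕ) : Type := ℙ ℝ (Vec n)

noncomputable instance instTopologicalSpaceRP (n : ℕ) : TopologicalSpace (RP n) :=
  TopologicalSpace.coinduced
    (fun v : {v : Vec n // v ≠ 0} => Projectivization.mk ℝ v.1 v.2) inferInstance

/-! ### Geometric structures on manifolds with boundary -/

/-- An atlas on `M` modelled on `(X, G)`, with boundary modelled on the boundaries of the members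
of `𝓗` (the whole space `X` and "closed half-spaces" of `X`).  A chart is a pair `(U, f)`: `U ⊆ M`
is open and `f` restricts to a homeomorphism of `U` onto a relatively open subset of a member of
`𝓗` (the values of `f` outside `U` are irrelevant).  The transition maps are locally given by
elements of `G`. -/
structure GeometricAtlas (G X : Type*) [Group G] [MulAction G X] [TopologicalSpace X]
    (𝓗 : Set (Set X)) (M : Type*) [TopologicalSpace M] where
  charts : Set (Set M × (M → X))
  covers : ∀ p : M, ∃ c ∈ charts, p ∈ c.1
  isOpen_source : ∀ c ∈ charts, IsOpen c.1
  isEmbedding : ∀ c ∈ charts, IsEmbedding (c.1.domRestrict c.2)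
  image_eq : ∀ c ∈ charts, ∃ H ∈ 𝓗, ∃ O : Set X, IsOpen O ∧ c.2 '' c.1 = O ∩ H
  compatible : ∀ c ∈ charts, ∀ c' ∈ charts, ∀ p ∈ c.1 ∩ c'.1,
    ∃ g : G, ∀ᶠ x in 𝓝 p, c'.2 x = g • c.2 x

/-- `ℝⁿ` and the closed half-spaces of `ℝⁿ` bounded by hyperplanes through the origin. -/
def linearModels (n : ℕ) : Set (Set (Vec n)) :=
  {H | H = univ ∨ ∃ l : Vec n →ₗ[ℝ] ℝ, l ≠ 0 ∧ H = {v | 0 ≤ l v}}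

/-- A radiant affine structure of dimension `n`: an `(ℝⁿ, GL(n, ℝ))`-structure.  The boundary is
empty or totally geodesic and tangent to the radiant vector field: it is locally given by
hyperplanes through the origin. -/
abbrev RadiantAtlas (n : ℕ) (M : Type*) [TopologicalSpace M] :=
  GeometricAtlas (GLn n) (Vec n) (linearModels n) M

/-- `ℝPⁿ⁻¹` and the closed half-spaces `{β / α ≥ 0}` of the affine patches `{α ≠ 0}`. -/
def projectiveModels (n : ℕ) : Set (Set (RP n)) :=
  {H | H = univ ∨ ∃ α β : Vec n →ₗ[ℝ] ℝ, LinearIndependent ℝ ![α, β] ∧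
    H = {x | α x.rep ≠ 0 ∧ 0 ≤ β x.rep / α x.rep}}

/-- A real projective structure of dimension `n - 1`, with empty or totally geodesic boundary. -/
abbrev ProjectiveAtlas (n : ℕ) (N : Type*) [TopologicalSpace N] :=
  GeometricAtlas (GLn n) (RP n) (projectiveModels n) N

/-- `f : N → N` is projective: in charts it is locally given by elements of `PGL(n, ℝ)`. -/
def IsProjectiveSelfMap {n : ℕ} {N : Type*} [TopologicalSpace N] (B : ProjectiveAtlas n N)
    (f : N → N) : Prop :=
  ∀ p : N, ∀ c ∈ B.charts, p ∈ c.1 → ∀ c' ∈ B.charts, f p ∈ c'.1 →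
    ∃ g : GLn n, ∀ᶠ x in 𝓝 p, c'.2 (f x) = g • c.2 x

/-! ### The radial flow and its total cross-sections -/

section CrossSection

variable {n : ℕ} {M : Type*} [TopologicalSpace M] (A : RadiantAtlas n M)

/-- `γ : ℝ → M` is a flow line of the radial flow, i.e. an integral curve of the radiant vector
field, which in every chart is `v ↦ v` (that is, `∑ xᵢ ∂/∂xᵢ`).  The radial flow of a compact
manifold whose boundary is tangent to it is complete. -/
def IsRadialFlowLine (γ : ℝ → M) : Prop :=
  Continuous γ ∧ ∀ t : ℝ, ∀ c ∈ A.charts, γ t ∈ c.1 →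
    HasDerivAt (fun s => c.2 (γ s)) (c.2 (γ t)) t

/-- `S ⊆ M` is a total cross-section to the radial flow: it is closed, it is a smooth embedded
hypersurface transverse to the radiant vector field (near each of its points it is, in a chart, the
zero set of a smooth function whose derivative in the radiant direction does not vanish; at points
of `∂M`, to which the radiant field is tangent, this says that `S` is properly embedded with
`∂S = S ∩ ∂M`), and it meets every flow line. -/
structure IsTotalCrossSection (S : Set M) : Prop where
  isClosed : IsClosed S
  transverse : ∀ p ∈ S, ∃ c ∈ A.charts, p ∈ c.1 ∧ ∃ g : Vec n → ℝ, ContDiff ℝ ∞ g ∧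
    fderiv ℝ g (c.2 p) (c.2 p) ≠ 0 ∧ ∀ᶠ x in 𝓝 p, (x ∈ S ↔ g (c.2 x) = 0)
  meets : ∀ γ : ℝ → M, IsRadialFlowLine A γ → ∃ t : ℝ, γ t ∈ S

/-- `S ⊆ M`, with the real projective structure induced from the affine charts by radial
projection (its charts are `x ↦ [f x] ∈ ℝPⁿ⁻¹` for affine charts `f` of `M`), is projectively
diffeomorphic to `N`. -/
def CrossSectionEquiv (S : Set M) {N : Type*} [TopologicalSpace N]
    (B : ProjectiveAtlas n N) : Prop :=
  ∃ F : S ≃ₜ N, ∀ p : S, ∀ c ∈ A.charts, (p : M) ∈ c.1 → ∀ c' ∈ B.charts, F p ∈ c'.1 →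
    ∃ g : GLn n, ∀ᶠ x : S in 𝓝 p, ∃ h : c.2 (x : M) ≠ 0,
      c'.2 (F x) = g • Projectivization.mk ℝ (c.2 (x : M)) h

end CrossSection

/-! ### Generalized affine suspensions -/

/-- The group of deck transformations of `q : E → N`. -/
def deckGroup {E N : Type*} [TopologicalSpace E] [TopologicalSpace N] (q : E → N) :
    Subgroup (E ≃ₜ E) where
  carrier := {γ | ∀ x, q (γ x) = q x}
  mul_mem' := by
    intro a b ha hb x
    exact (ha (b x)).trans (hb x)
  one_mem' := fun _ => rfl
  inv_mem' := by
    intro a ha x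
    have h := ha (a⁻¹ x)
    have e : a (a⁻¹ x) = x := a.apply_symm_apply x
    rw [e] at h
    exact h.symm

/-- The choices made in forming a generalized affine suspension over the real projective
`(n-1)`-manifold `N`. -/
structure SuspensionData {n : ℕ} {N : Type*} [TopologicalSpace N] (B : ProjectiveAtlas n N)
    (E : Type*) [TopologicalSpace E] [SimplyConnectedSpace E] where
  /-- The universal covering `q : E → N`. -/
  q : E → N
  isCoveringMap : IsCoveringMap q
  surjective : Function.Surjective q
  /-- A developing map into the unit sphere of `ℝⁿ`, the double cover of `ℝPⁿ⁻¹`. -/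
  dev : C(E, Metric.sphere (0 : Vec n) 1)
  dev_chart : ∀ x : E, ∀ c ∈ B.charts, q x ∈ c.1 → ∃ g : GLn n,
    ∀ᶠ y in 𝓝 x, ∃ h : (dev y : Vec n) ≠ 0,
      c.2 (q y) = g • Projectivization.mk ℝ (dev y : Vec n) h
  /-- A lift to `GL(n, ℝ)` of the holonomy homomorphism of `N`. -/
  hol : deckGroup q →* GLn n
  dev_hol : ∀ (γ : deckGroup q) (x : E),
    (dev ((γ : E ≃ₜ E) x) : Vec n) = ‖hol γ (dev x)‖⁻¹ • hol γ (dev x)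
  /-- The projective automorphism `φ` of `N`. -/
  φ : N ≃ₜ N
  φ_projective : IsProjectiveSelfMap B φ
  /-- A lift of `φ` to the universal cover. -/
  φLift : E ≃ₜ E
  q_φLift : ∀ x, q (φLift x) = φ (q x)
  /-- A linear map inducing the projective transformation `ρ` with `dev ∘ φLift = ρ ∘ dev`. -/
  ρ : GLn n
  dev_φLift : ∀ x : E, (dev (φLift x) : Vec n) = ‖ρ (dev x)‖⁻¹ • ρ (dev x)
  /-- The homomorphism `γ ↦ |det (hol γ)| ^ (1 / n)` to the positive reals, by which `hol` differs
  from the lift of the holonomy to `SL±(n, ℝ)`, is invariant under the automorphism of the deck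
  group induced by `φ`. -/
  det_invariant : ∀ γ γ' : deckGroup q,
    (∀ x, (γ' : E ≃ₜ E) (φLift x) = φLift ((γ : E ≃ₜ E) x)) →
      |LinearMap.det (hol γ' : Vec n →ₗ[ℝ] Vec n)| = |LinearMap.det (hol γ : Vec n →ₗ[ℝ] Vec n)|
  /-- A smooth section of the trivial line bundle `(E × ℝ) / π₁(N) → N`, written as the graph of an
  equivariant function on `E`, ... -/
  sec : E → ℝ
  sec_smooth : ∀ x : E, ∃ g : Vec n → ℝ, ContDiff ℝ ∞ g ∧ ∀ᶠ y in 𝓝 x, sec y = g (dev y)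
  sec_equivariant : ∀ (γ : deckGroup q) (x : E),
    sec ((γ : E ≃ₜ E) x) = sec x + Real.log ‖hol γ (dev x)‖
  /-- ... which the automorphism `(x, t) ↦ (φLift x, t + log ‖ρ (dev x)‖)` moves strictly
  radially outwards. -/
  sec_outward : ∀ x : E, sec (φLift x) < sec x + Real.log ‖ρ (dev x)‖

namespace SuspensionData

variable {n : ℕ} {N : Type*} [TopologicalSpace N] {B : ProjectiveAtlas n N}
  {E : Type*} [TopologicalSpace E] [SimplyConnectedSpace E]

/-- The immersion `(x, t) ↦ eᵗ dev(x)` of `E × ℝ` into `ℝⁿ`, which gives `E × ℝ` its radiant affine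
structure. -/
noncomputable def affineDev (D : SuspensionData B E) (z : E × ℝ) : Vec n :=
  Real.exp z.2 • (D.dev z.1 : Vec n)

/-- The generators of the group acting on `E × ℝ`: the deck transformations `γ` act by
`(x, t) ↦ (γ x, t + log ‖hol γ (dev x)‖)`, and the automorphism `φ` by
`(x, t) ↦ (φLift x, t + log ‖ρ (dev x)‖)`. -/
inductive Step (D : SuspensionData B E) : E × ℝ → E × ℝ → Prop
  | deck (γ : deckGroup D.q) (x : E) (t : ℝ) :
      Step D (x, t) ((γ : E ≃ₜ E) x, t + Real.log ‖D.hol γ (D.dev x)‖)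
  | auto (x : E) (t : ℝ) : Step D (x, t) (D.φLift x, t + Real.log ‖D.ρ (D.dev x)‖)

/-- The generalized affine suspension: the quotient of `E × ℝ` by the group generated by the maps
above, with the quotient topology. -/
def Space (D : SuspensionData B E) : Type _ := Quot D.Step

instance (D : SuspensionData B E) : TopologicalSpace D.Space :=
  inferInstanceAs (TopologicalSpace (Quot D.Step))

/-- The projection of `E × ℝ` to the suspension. -/
def proj (D : SuspensionData B E) (z : E × ℝ) : D.Space := Quot.mk D.Step z

/-- A homeomorphism `F` from the suspension to `M` is an affine diffeomorphism.  The affine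
structure of the suspension is the one for which the projection from `E × ℝ` (with the structure
given by `affineDev`) is locally an affine isomorphism, so this says that `F ∘ proj` is locally
affine in the charts of `M`. -/
def IsAffineDiffeo (D : SuspensionData B E) {M : Type*} [TopologicalSpace M]
    (A : RadiantAtlas n M) (F : D.Space ≃ₜ M) : Prop :=
  ∀ z : E × ℝ, ∀ c ∈ A.charts, F (D.proj z) ∈ c.1 →
    ∃ α : Vec n ≃ᵃ[ℝ] Vec n, ∀ᶠ w in 𝓝 z, c.2 (F (D.proj w)) = α (D.affineDev w)

end SuspensionData

/-- `M` is affinely diffeomorphic to a generalized affine suspension over `N`. -/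
def IsSuspensionOver {n : ℕ} {M N : Type u} [TopologicalSpace M] [TopologicalSpace N]
    (A : RadiantAtlas n M) (B : ProjectiveAtlas n N) : Prop :=
  ∃ (E : Type u) (_ : TopologicalSpace E) (_ : SimplyConnectedSpace E)
    (D : SuspensionData B E) (F : D.Space ≃ₜ M), D.IsAffineDiffeo A F

end RadiantAffine

namespace RadiantAffine

/-! ### Linear models and charts -/

section Models

variable {n : ℕ}

/-! The proof passes between a cross-section and a suspension through the map `(x, t) ↦ Ψ (t - sec
x) (q x)`, where `Ψ` is the radial flow and `q` is the universal covering of the cross-section. The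
flow is complete (`exists_isRadialFlow`): the models at the boundary are cones, so `v ↦ eᵗ v`
preserves them for short times, and compactness gives a common short time which is then iterated.

From a cross-section to a suspension. By compactness every orbit returns to `S`, so there is a first
return homeomorphism with continuous return time `r` (`IsFlowSection.exists_return`). As `M` is
connected, each component of `S` already meets every orbit (`IsFlowSection.component_meets`), so `S`
may be taken connected. Its universal covering `E` is developed into `ℝⁿ` by a map `D` that vanishes
nowhere, because the radiant field has no zeros. Put `dev = D / ‖D‖` and `sec = log ‖D‖`, so that
`S` is itself the section. Deck transformations change `D` by linear maps, which give `hol`. The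
return map `R` of the reversed flow lifts to `φLift` with `exp (r ∘ q) • D ∘ φLift = ρ ∘ D`, and
positivity of `r` says exactly that the section moves outwards. Here `hol γ'` is conjugate to `hol
γ` by `ρ`, so the determinants agree (`exists_suspensionData`,
`IsTotalCrossSection.isSuspensionOver`).

From a suspension to a cross-section. There are two obstacles. First, an affine diffeomorphism need
not respect the radiant fields; the two fields differ by a parallel field, and composing flows of
both by `∓ log 2` translates that field away (`IsAffineDiffeo.exists_isLinearDiffeo`). Secondly, the
image of the section must be embedded. The determinant condition forces `hol γ' ∘ ρ = ρ ∘ hol γ`,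
which a priori holds only up to a positive scalar (`IsAffineDiffeo.hol_conj`). Hence the distance by
which the section is moved descends to the compact base and has a positive minimum
(`IsAffineDiffeo.exists_height_gap`). Sheets of the section cannot accumulate on one another, its
image is a copy of the base, and the height over it is a defining function with radial derivative
one. -/

lemma smul_mem_linearModel {H : Set (Vec n)} (hH : H ∈ linearModels n) {v : Vec n} (hv : v ∈ H)
    {r : ℝ} (hr : 0 ≤ r) : r • v ∈ H := by
  rcases hH with rfl | ⟨l, -, rfl⟩
  · trivial
  · simpa using mul_nonneg hr hv

/-- A point of the bounding hyperplane can be pushed into the open half-space without leaving `O`.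
This is why germs at boundary points still determine affine maps. -/
lemma interior_inter_linearModel_nonempty {H : Set (Vec n)} (hH : H ∈ linearModels n)
    {O : Set (Vec n)} (hO : IsOpen O) {v : Vec n} (hv : v ∈ O ∩ H) :
    (interior (O ∩ H)).Nonempty := by
  rcases hH with rfl | ⟨l, hl, rfl⟩
  · exact ⟨v, by simpa [hO.interior_eq] using hv⟩
  · obtain ⟨w, hw⟩ : ∃ w, 0 < l w := by
      obtain ⟨w, hw⟩ : ∃ w, l w ≠ 0 := by
        by_contra! h
        exact hl (LinearMap.ext h)
      rcases hw.lt_or_gt with h | h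
      · exact ⟨-w, by simpa using h⟩
      · exact ⟨w, h⟩
    have hc : Tendsto (fun t : ℝ => v + t • w) (𝓝[>] 0) (𝓝 v) := by
      have : Continuous fun t : ℝ => v + t • w := by fun_prop
      simpa using (this.tendsto 0).mono_left nhdsWithin_le_nhds
    obtain ⟨t, htO, ht⟩ :=
      ((hc.eventually (hO.mem_nhds hv.1)).and self_mem_nhdsWithin).exists
    refine ⟨v + t • w, mem_interior.2 ⟨O ∩ {x | 0 < l x}, ?_, ?_, ?_⟩⟩
    · exact fun x hx => ⟨hx.1, (show 0 < l x from hx.2).le⟩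
    · exact hO.inter (isOpen_lt continuous_const l.continuous_of_finiteDimensional)
    · refine ⟨htO, ?_⟩
      have h1 : 0 ≤ l v := hv.2
      have h2 : 0 < t * l w := mul_pos ht hw
      simp only [mem_ofPred_eq, map_add, map_smul, smul_eq_mul]
      linarith

/-- On the line from `p ∈ U` to any `v` there is a second point of `U`, and two points of a line
determine an affine map on it. -/
lemma affineMap_eq_of_eqOn_isOpen {U : Set (Vec n)} (hU : IsOpen U) (hne : U.Nonempty)
    {f g : Vec n →ᵃ[ℝ] Vec n} (h : EqOn f g U) : f = g := by
  apply AffineMap.ext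
  obtain ⟨p, hp⟩ := hne
  intro v
  have hc : Tendsto (fun t : ℝ => AffineMap.lineMap p v t) (𝓝[≠] 0) (𝓝 p) := by
    have : Continuous fun t : ℝ => (AffineMap.lineMap p v t : Vec n) :=
      AffineMap.lineMap_continuous
    simpa using (this.tendsto 0).mono_left nhdsWithin_le_nhds
  obtain ⟨t, htU, ht⟩ := ((hc.eventually (hU.mem_nhds hp)).and self_mem_nhdsWithin).exists
  have h1 := h htU
  have h0 := h hp
  rw [AffineMap.apply_lineMap, AffineMap.apply_lineMap, h0, AffineMap.lineMap_apply_module,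
    AffineMap.lineMap_apply_module] at h1
  exact smul_right_injective _ (show t ≠ 0 from ht) (add_left_cancel h1)

end Models

namespace GeometricAtlas

variable {G X : Type*} [Group G] [MulAction G X] [TopologicalSpace X] {𝓗 : Set (Set X)}
  {M : Type*} [TopologicalSpace M] (A : GeometricAtlas G X 𝓗 M) {c c' : Set M × (M → X)} {p : M}

include A

lemma injOn (hc : c ∈ A.charts) : InjOn c.2 c.1 :=
  injOn_iff_injective.2 (A.isEmbedding c hc).injective

lemma continuousOn (hc : c ∈ A.charts) : ContinuousOn c.2 c.1 :=
  continuousOn_iff_continuous_domRestrict.2 (A.isEmbedding c hc).continuous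

lemma source_mem_nhds (hc : c ∈ A.charts) (hp : p ∈ c.1) : c.1 ∈ 𝓝 p :=
  (A.isOpen_source c hc).mem_nhds hp

lemma continuousAt (hc : c ∈ A.charts) (hp : p ∈ c.1) : ContinuousAt c.2 p :=
  (A.continuousOn hc).continuousAt (A.source_mem_nhds hc hp)

lemma exists_nhds_preimage_subset (hc : c ∈ A.charts) (hp : p ∈ c.1) {U : Set M} (hU : U ∈ 𝓝 p) :
    ∃ V ∈ 𝓝 (c.2 p), c.1 ∩ c.2 ⁻¹' V ⊆ U := by
  have h1 : Subtype.val ⁻¹' U ∈ 𝓝 (⟨p, hp⟩ : c.1) := continuousAt_subtype_val hU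
  rw [(A.isEmbedding c hc).isInducing.nhds_eq_comap] at h1
  obtain ⟨V, hV, hVU⟩ := h1
  exact ⟨V, hV, fun x hx => hVU (a := ⟨x, hx.1⟩) hx.2⟩

lemma exists_image_eq (hc : c ∈ A.charts) {U : Set M} (hU : IsOpen U) (hUc : U ⊆ c.1) :
    ∃ H ∈ 𝓗, ∃ O : Set X, IsOpen O ∧ c.2 '' U = O ∩ H := by
  obtain ⟨H, hH, O, hO, he⟩ := A.image_eq c hc
  obtain ⟨O', hO', h'⟩ := (A.isEmbedding c hc).isInducing.isOpen_iff.1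
    (hU.preimage (continuous_subtype_val (p := (· ∈ c.1))))
  refine ⟨H, hH, O' ∩ O, hO'.inter hO, ?_⟩
  rw [inter_assoc, ← he]
  ext v
  constructor
  · rintro ⟨x, hx, rfl⟩
    have : (⟨x, hUc hx⟩ : c.1) ∈ domRestrict c.1 c.2 ⁻¹' O' := by rw [h']; exact hx
    exact ⟨this, x, hUc hx, rfl⟩
  · rintro ⟨hv, x, hx, rfl⟩
    have : (⟨x, hx⟩ : c.1) ∈ Subtype.val ⁻¹' U := by rw [← h']; exact hv
    exact ⟨x, this, rfl⟩

lemma chart_inverse [Nonempty M] (hc : c ∈ A.charts) :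
    ∃ j : X → M, (∀ x ∈ c.1, j (c.2 x) = x) ∧ (∀ v ∈ c.2 '' c.1, j v ∈ c.1 ∧ c.2 (j v) = v) ∧
      ContinuousOn j (c.2 '' c.1) := by
  have hl : ∀ x ∈ c.1, Function.invFunOn c.2 c.1 (c.2 x) = x :=
    fun x hx => (A.injOn hc).leftInvOn_invFunOn hx
  refine ⟨Function.invFunOn c.2 c.1, hl, fun v hv =>
    ⟨Function.invFunOn_mem hv, Function.invFunOn_eq hv⟩, ?_⟩
  rintro v ⟨p, hp, rfl⟩ U hU
  rw [hl p hp] at hU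
  obtain ⟨V, hV, hVU⟩ := A.exists_nhds_preimage_subset hc hp hU
  refine mem_map.2 ?_
  filter_upwards [mem_nhdsWithin_of_mem_nhds hV, self_mem_nhdsWithin] with w hw hwi
  exact hVU ⟨Function.invFunOn_mem hwi, by
    rw [mem_preimage, Function.invFunOn_eq hwi]; exact hw⟩

end GeometricAtlas

/-! ### Rigidity of germs of linear and affine maps in charts. -/

section Germs

variable {n : ℕ} {M : Type*} [TopologicalSpace M] (A : RadiantAtlas n M)
  {c c' : Set M × (M → Vec n)} {p : M}

include A

/-- Two affine maps which agree along the chart near `p` are equal. -/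
lemma affineMap_eq_of_eventually (hc : c ∈ A.charts) (hp : p ∈ c.1) {f g : Vec n →ᵃ[ℝ] Vec n}
    (h : ∀ᶠ x in 𝓝 p, f (c.2 x) = g (c.2 x)) : f = g := by
  obtain ⟨U, hUs, hU, hpU⟩ := mem_nhds_iff.1 (h.and (A.source_mem_nhds hc hp))
  obtain ⟨H, hH, O, hO, he⟩ := A.exists_image_eq hc hU (fun x hx => (hUs hx).2)
  have hne := interior_inter_linearModel_nonempty hH hO (he ▸ mem_image_of_mem c.2 hpU)
  refine affineMap_eq_of_eqOn_isOpen isOpen_interior hne fun v hv => ?_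
  obtain ⟨x, hx, rfl⟩ := he.symm ▸ interior_subset hv
  exact (hUs hx).1

lemma linearEquiv_eq_of_eventually (hc : c ∈ A.charts) (hp : p ∈ c.1) {f g : GLn n}
    (h : ∀ᶠ x in 𝓝 p, f (c.2 x) = g (c.2 x)) : f = g := by
  have := affineMap_eq_of_eventually A hc hp (f := f.toLinearMap.toAffineMap)
    (g := g.toLinearMap.toAffineMap) h
  ext1 x
  exact congrArg (fun k : Vec n →ᵃ[ℝ] Vec n => k x) this

lemma exists_transition (hc : c ∈ A.charts) (hc' : c' ∈ A.charts) (hp : p ∈ c.1) (hp' : p ∈ c'.1) :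
    ∃ g : GLn n, ∀ᶠ x in 𝓝 p, c'.2 x = g (c.2 x) :=
  A.compatible c hc c' hc' p ⟨hp, hp'⟩

end Germs

/-! ### Smooth implicit functions -/

section Implicit

variable {n : ℕ}

/-- A bump function cuts the germ off. This is needed because the definitions of cross-section and
of suspension ask for functions smooth on all of `ℝⁿ`. -/
lemma exists_contDiff_eventuallyEq {f : Vec n → ℝ} {d : Vec n}
    (h : ∀ᶠ x in 𝓝 d, ContDiffAt ℝ ∞ f x) :
    ∃ g : Vec n → ℝ, ContDiff ℝ ∞ g ∧ g =ᶠ[𝓝 d] f := by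
  obtain ⟨r, hr, hball⟩ := Metric.eventually_nhds_iff_ball.1 h
  let b : ContDiffBump d := ⟨r / 3, r / 2, by positivity, by linarith⟩
  refine ⟨fun x => b x * f x, contDiff_iff_contDiffAt.2 fun x => ?_, ?_⟩
  · by_cases hx : x ∈ Metric.ball d r
    · exact b.contDiff.contDiffAt.mul (hball x hx)
    · have : (fun x => b x * f x) =ᶠ[𝓝 x] fun _ => 0 := by
        have hx' : x ∈ (Metric.closedBall d (r / 2))ᶜ := by
          simp only [Metric.mem_ball, mem_compl_iff, Metric.mem_closedBall, not_lt, not_le] at hx ⊢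
          linarith
        filter_upwards [Metric.isClosed_closedBall.isOpen_compl.mem_nhds hx'] with y hy
        rw [b.zero_of_le_dist, zero_mul]
        simp only [mem_compl_iff, Metric.mem_closedBall, not_le] at hy
        exact hy.le
      exact contDiffAt_const.congr_of_eventuallyEq this
  · filter_upwards [b.eventuallyEq_one] with x hx
    rw [hx, Pi.one_apply, one_mul]

/-- Being `ContDiffAt ℝ ∞` at a point does not spread to a neighbourhood, since each finite order
has its own. The implicit function theorem is therefore applied again at nearby points of the graph
of `σ`; local uniqueness identifies the new solutions with `σ`, which is then smooth near `d`. -/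
lemma exists_contDiff_implicit {K : Vec n × ℝ → ℝ} (hK : ContDiff ℝ ∞ K) {d : Vec n} {s : ℝ}
    (h0 : K (d, s) = 0) (h1 : fderiv ℝ K (d, s) (0, 1) ≠ 0) :
    ∃ σ : Vec n → ℝ, ContDiff ℝ ∞ σ ∧ σ d = s ∧
      ∀ᶠ z in 𝓝 (d, s), K z = 0 ↔ z.2 = σ z.1 := by
  have key : ∀ z : Vec n × ℝ, K z = 0 → fderiv ℝ K z (0, 1) ≠ 0 →
      ∃ σ : Vec n → ℝ, ContDiffAt ℝ ∞ σ z.1 ∧ σ z.1 = z.2 ∧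
        ∀ᶠ w in 𝓝 z, K w = 0 ↔ w.2 = σ w.1 := by
    intro z hz hz1
    have hinv : (fderiv ℝ K z ∘L .inr ℝ (Vec n) ℝ).IsInvertible := by
      refine ⟨ContinuousLinearEquiv.unitsEquivAut ℝ (Units.mk0 _ hz1), ?_⟩
      ext
      simp
    have hKz := hK.contDiffAt (x := z)
    refine ⟨hKz.implicitFunction (by simp) hinv, hKz.contDiffAt_implicitFunction (by simp) hinv,
      hKz.implicitFunction_apply_self (by simp) hinv, ?_⟩
    filter_upwards [hKz.eventually_apply_eq_iff_implicitFunction (by simp) hinv] with w hw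
    rw [← hz, hw, eq_comm]
  obtain ⟨σ, hσ, hσd, hiff⟩ := key (d, s) h0 h1
  have hopen : IsOpen {z | fderiv ℝ K z (0, 1) ≠ 0} :=
    isOpen_ne_fun ((hK.continuous_fderiv (by simp)).clm_apply continuous_const) continuous_const
  -- A finite order of differentiability does hold on a neighbourhood, which already gives
  -- continuity there; the uniqueness argument below needs only that.
  have hc0 : ∀ᶠ x in 𝓝 d, ContinuousAt σ x := by
    have := (hσ.of_le (m := 1) (by exact_mod_cast le_top)).eventually (by simp)
    exact this.mono fun x hx => hx.continuousAt
  have ht : Tendsto (fun x => (x, σ x)) (𝓝 d) (𝓝 (d, s)) := by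
    have := (continuousAt_id (x := d)).prodMk hσ.continuousAt
    rw [ContinuousAt] at this
    simpa [hσd] using this
  have hsm : ∀ᶠ x in 𝓝 d, ContDiffAt ℝ ∞ σ x := by
    filter_upwards [hc0, ht.eventually (hopen.mem_nhds h1), ht.eventually hiff.eventually_nhds]
      with x hx hx1 hx2
    have hKx : K (x, σ x) = 0 := (hx2.self_of_nhds).2 rfl
    obtain ⟨σ', hσ', -, hiff'⟩ := key (x, σ x) hKx hx1
    have ht' : Tendsto (fun y => (y, σ y)) (𝓝 x) (𝓝 (x, σ x)) := continuousAt_id.prodMk hx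
    refine hσ'.congr_of_eventuallyEq ?_
    filter_upwards [ht'.eventually hiff', ht'.eventually hx2] with y hy hy2
    exact hy.1 (hy2.2 rfl)
  obtain ⟨σ', hσ', he⟩ := exists_contDiff_eventuallyEq hsm
  refine ⟨σ', hσ', by rw [he.self_of_nhds]; exact hσd, ?_⟩
  filter_upwards [hiff, (continuous_fst.tendsto (d, s)).eventually he] with z hz hz'
  rw [hz, hz']

/-- A smooth function with nonvanishing radial derivative is, near a ray through `w`, solved by a
smooth time function. -/
lemma exists_contDiff_radial_time {K : Vec n → ℝ} (hK : ContDiff ℝ ∞ K) (d : Vec n) (s : ℝ)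
    (h0 : K (Real.exp s • d) = 0)
    (h1 : fderiv ℝ K (Real.exp s • d) (Real.exp s • d) ≠ 0) :
    ∃ σ : Vec n → ℝ, ContDiff ℝ ∞ σ ∧ σ d = s ∧
      ∀ᶠ z : Vec n × ℝ in 𝓝 (d, s), K (Real.exp z.2 • z.1) = 0 ↔ z.2 = σ z.1 := by
  have hE : ContDiff ℝ ∞ fun z : Vec n × ℝ => Real.exp z.2 • z.1 := by fun_prop
  refine exists_contDiff_implicit (K := fun z => K (Real.exp z.2 • z.1)) (hK.comp hE) h0 ?_
  have hd : HasDerivAt (fun r : ℝ => K (Real.exp r • d))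
      (fderiv ℝ K (Real.exp s • d) (Real.exp s • d)) s := by
    have h2 : HasDerivAt (fun r : ℝ => Real.exp r • d) (Real.exp s • d) s :=
      (Real.hasDerivAt_exp s).smul_const d
    exact ((hK.differentiable (by simp)) _).hasFDerivAt.comp_hasDerivAt s h2
  have hd' : HasDerivAt (fun r : ℝ => K (Real.exp r • d))
      (fderiv ℝ (fun z : Vec n × ℝ => K (Real.exp z.2 • z.1)) (d, s) (0, 1)) s := by
    have h2 : HasDerivAt (fun r : ℝ => (d, r)) ((0 : Vec n), (1 : ℝ)) s :=
      (hasDerivAt_const s d).prodMk (hasDerivAt_id s)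
    exact ((((hK.comp hE).differentiable (by simp)) (d, s)).hasFDerivAt).comp_hasDerivAt s h2
  rw [hd'.unique hd]
  exact h1

end Implicit

end RadiantAffine

namespace RadiantAffine

/-! ### Extending a local one-parameter family to a flow -/

section Extend

variable {X : Type*}

lemma iterate_local_family {ε : ℝ} {ψ : ℝ → X → X} (h0 : ∀ x, ψ 0 x = x)
    (hadd : ∀ s t, |s| ≤ ε → |t| ≤ ε → |s + t| ≤ ε → ∀ x, ψ (s + t) x = ψ s (ψ t x))
    {t : ℝ} {N : ℕ} (ht : N * |t| ≤ ε) (x : X) : (ψ t)^[N] x = ψ (N * t) x := by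
  induction N with
  | zero => simp [h0]
  | succ k ih =>
    push_cast at ht ⊢
    have h1 : k * |t| ≤ ε := by nlinarith [abs_nonneg t]
    have h2 : |t| ≤ ε := by
      have : 0 ≤ (k : ℝ) * |t| := by positivity
      linarith
    rw [Function.iterate_succ_apply', ih h1, show ((k : ℝ) + 1) * t = t + k * t by ring,
      hadd _ _ h2]
    · rwa [abs_mul, Nat.abs_cast]
    · rw [show t + k * t = ((k : ℝ) + 1) * t by ring, abs_mul,
        abs_of_nonneg (by positivity : (0 : ℝ) ≤ (k : ℝ) + 1)]
      exact ht

/-- Refining a subdivision does not change the iterate, so any two admissible subdivisions agree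
through their common refinement. -/
lemma iterate_local_family_div {ε : ℝ} {ψ : ℝ → X → X} (h0 : ∀ x, ψ 0 x = x)
    (hadd : ∀ s t, |s| ≤ ε → |t| ≤ ε → |s + t| ≤ ε → ∀ x, ψ (s + t) x = ψ s (ψ t x))
    {t : ℝ} {N K : ℕ} (hN : 0 < N) (hK : 0 < K) (ht : |t| ≤ N * ε) :
    (ψ (t / (N * K : ℕ)))^[N * K] = (ψ (t / N))^[N] := by
  have hN' : (0 : ℝ) < N := by exact_mod_cast hN
  have hK' : (0 : ℝ) < K := by exact_mod_cast hK
  rw [mul_comm N K, Function.iterate_mul]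
  congr 1
  funext x
  have e : (K : ℝ) * (t / (K * N : ℕ)) = t / N := by push_cast; field_simp
  rw [iterate_local_family h0 hadd, e]
  have : (K : ℝ) * |t / (K * N : ℕ)| = |t| / N := by
    rw [abs_div, Nat.abs_cast]; push_cast; field_simp
  rw [this, div_le_iff₀ hN']
  linarith

/-- Time `t` is reached by `N` equal steps. Since every admissible `N` yields the same map,
continuity near `t₀` and the group law for `s, t` can each be checked with a single `N` that serves
all the times involved. -/
lemma exists_flow_of_local_family [TopologicalSpace X] {ε : ℝ} (hε : 0 < ε) {ψ : ℝ → X → X}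
    (hc : ContinuousOn (Function.uncurry ψ) (Icc (-ε) ε ×ˢ univ)) (h0 : ∀ x, ψ 0 x = x)
    (hadd : ∀ s t, |s| ≤ ε → |t| ≤ ε → |s + t| ≤ ε → ∀ x, ψ (s + t) x = ψ s (ψ t x)) :
    ∃ Ψ : Flow ℝ X, ∀ t, |t| ≤ ε → ∀ x, Ψ t x = ψ t x := by
  -- The summand `1` keeps the number of steps positive when `t = 0`.
  set Ψ : ℝ → X → X := fun t => (ψ (t / (⌈|t| / ε⌉₊ + 1 : ℕ)))^[⌈|t| / ε⌉₊ + 1] with hΨ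
  have hbound : ∀ t : ℝ, |t| ≤ (⌈|t| / ε⌉₊ + 1 : ℕ) * ε := by
    intro t
    rw [← div_le_iff₀ hε]
    push_cast
    linarith [Nat.le_ceil (|t| / ε)]
  have hany : ∀ (t : ℝ) (N : ℕ), 0 < N → |t| ≤ N * ε → Ψ t = (ψ (t / N))^[N] := by
    intro t N hN ht
    rw [← iterate_local_family_div h0 hadd hN (Nat.succ_pos ⌈|t| / ε⌉₊) ht, mul_comm N]
    exact (iterate_local_family_div h0 hadd (Nat.succ_pos ⌈|t| / ε⌉₊) hN (hbound t)).symm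
  refine ⟨⟨Ψ, ?_, ?_, ?_⟩, ?_⟩
  · rw [continuous_iff_continuousAt]
    rintro ⟨t₀, x₀⟩
    -- The margin `1` makes this `N` admissible for all times near `t₀`.
    set N := ⌈(|t₀| + 1) / ε⌉₊ + 1 with hN
    have hNpos : (0 : ℝ) < N := by positivity
    have hNb : |t₀| + 1 ≤ N * ε := by
      rw [← div_le_iff₀ hε, hN]
      push_cast
      linarith [Nat.le_ceil ((|t₀| + 1) / ε)]
    have hiter : ∀ k : ℕ, ContinuousOn (fun z : ℝ × X => (ψ (z.1 / N))^[k] z.2)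
        ({t | |t| ≤ N * ε} ×ˢ univ) := by
      intro k
      induction k with
      | zero => exact continuousOn_snd
      | succ k ih =>
        simp only [Function.iterate_succ_apply']
        have h1 : ContinuousOn (fun z : ℝ × X => (z.1 / N, (ψ (z.1 / N))^[k] z.2))
            ({t | |t| ≤ N * ε} ×ˢ univ) :=
          (continuousOn_fst.div_const _).prodMk ih
        refine hc.comp h1 fun z hz => ⟨?_, trivial⟩
        have : |z.1| ≤ N * ε := hz.1
        change z.1 / N ∈ Icc (-ε) ε
        rw [mem_Icc, ← abs_le, abs_div, Nat.abs_cast, div_le_iff₀ hNpos]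
        linarith
    have hnh : ({t : ℝ | |t| ≤ N * ε} ×ˢ (univ : Set X)) ∈ 𝓝 (t₀, x₀) := by
      refine prod_mem_nhds ?_ univ_mem
      have : ∀ᶠ t in 𝓝 t₀, |t| < |t₀| + 1 :=
        continuous_abs.continuousAt.eventually_lt continuousAt_const (by linarith)
      filter_upwards [this] with t ht
      exact ht.le.trans hNb
    refine ((hiter N).continuousAt hnh).congr ?_
    filter_upwards [hnh] with z hz
    exact (congrFun (hany z.1 N (Nat.succ_pos _) hz.1) z.2).symm
  · intro s t x
    set N := ⌈(|s| + |t|) / ε⌉₊ + 1 with hN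
    have hNpos : (0 : ℝ) < N := by positivity
    have hNb : |s| + |t| ≤ N * ε := by
      rw [← div_le_iff₀ hε, hN]
      push_cast
      linarith [Nat.le_ceil ((|s| + |t|) / ε)]
    have hs : |s| ≤ N * ε := by linarith [abs_nonneg t]
    have ht : |t| ≤ N * ε := by linarith [abs_nonneg s]
    have hst : |s + t| ≤ N * ε := (abs_add_le s t).trans hNb
    have hdiv : ∀ r : ℝ, |r| ≤ N * ε → |r / N| ≤ ε := by
      intro r hr
      rw [abs_div, Nat.abs_cast, div_le_iff₀ hNpos]
      linarith
    have e1 : ψ ((s + t) / N) = ψ (s / N) ∘ ψ (t / N) := by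
      funext y
      rw [add_div]
      exact hadd _ _ (hdiv _ hs) (hdiv _ ht) (by rw [← add_div]; exact hdiv _ hst) y
    have e2 : ψ ((s + t) / N) = ψ (t / N) ∘ ψ (s / N) := by
      funext y
      rw [add_comm, add_div]
      exact hadd _ _ (hdiv _ ht) (hdiv _ hs)
        (by rw [← add_div, add_comm t s]; exact hdiv _ hst) y
    -- Both products of the short steps equal the step of length `(s + t) / N`, so they commute and
    -- the `N`-th iterate of the product splits.
    have hcomm : Function.Commute (ψ (s / N)) (ψ (t / N)) := fun y =>
      congrFun (e1.symm.trans e2) y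
    rw [hany _ N (Nat.succ_pos _) hst, hany _ N (Nat.succ_pos _) hs,
      hany _ N (Nat.succ_pos _) ht, e1, hcomm.comp_iterate]
    rfl
  · intro x
    have := hany 0 1 one_pos (by simpa using hε.le)
    rw [this]
    simpa using h0 x
  · intro t ht x
    have := hany t 1 one_pos (by simpa using ht)
    change Ψ t x = _
    rw [this]
    simp

end Extend

/-! ### The radial flow -/

section RadialFlow

variable {n : ℕ} {M : Type*} [TopologicalSpace M] (A : RadiantAtlas n M)
  {c c' : Set M × (M → Vec n)} {p : M}

/-- `γ` is, on `J`, locally of the form `s ↦ eˢ v` in the charts. -/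
def FlowOn (γ : ℝ → M) (J : Set ℝ) : Prop :=
  ∀ t ∈ J, ∃ c ∈ A.charts, γ t ∈ c.1 ∧
    ∀ᶠ s in 𝓝[J] t, γ s ∈ c.1 ∧ c.2 (γ s) = Real.exp (s - t) • c.2 (γ t)

variable {A}

lemma FlowOn.continuousOn {γ : ℝ → M} {J : Set ℝ} (h : FlowOn A γ J) : ContinuousOn γ J := by
  intro t ht U hU
  obtain ⟨c, hc, htc, hev⟩ := h t ht
  obtain ⟨V, hV, hVU⟩ := A.exists_nhds_preimage_subset hc htc hU
  have hlim : Tendsto (fun s : ℝ => Real.exp (s - t) • c.2 (γ t)) (𝓝[J] t) (𝓝 (c.2 (γ t))) := by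
    have : Continuous fun s : ℝ => Real.exp (s - t) • c.2 (γ t) := by fun_prop
    simpa using (this.tendsto t).mono_left nhdsWithin_le_nhds
  refine mem_map.2 ?_
  filter_upwards [hev, hlim.eventually hV] with s hs hsV
  exact hVU ⟨hs.1, by rw [mem_preimage, hs.2]; exact hsV⟩

lemma FlowOn.chart {γ : ℝ → M} {J : Set ℝ} (h : FlowOn A γ J) {t : ℝ} (ht : t ∈ J)
    (hc : c ∈ A.charts) (htc : γ t ∈ c.1) :
    ∀ᶠ s in 𝓝[J] t, γ s ∈ c.1 ∧ c.2 (γ s) = Real.exp (s - t) • c.2 (γ t) := by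
  obtain ⟨c', hc', htc', hev⟩ := h t ht
  obtain ⟨g, hg⟩ := exists_transition A hc' hc htc' htc
  have hcont := h.continuousOn t ht
  filter_upwards [hev, hcont.eventually hg, hcont.eventually (A.source_mem_nhds hc htc)]
    with s hs hgs hsc
  refine ⟨hsc, ?_⟩
  rw [hgs, hs.2, map_smul, hg.self_of_nhds]

lemma FlowOn.mono {γ : ℝ → M} {J J' : Set ℝ} (h : FlowOn A γ J) (hJ : J' ⊆ J) :
    FlowOn A γ J' := by
  intro t ht
  obtain ⟨c, hc, htc, hev⟩ := h t (hJ ht)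
  exact ⟨c, hc, htc, hev.filter_mono (nhdsWithin_mono t hJ)⟩

lemma FlowOn.comp_add {γ : ℝ → M} {J : Set ℝ} (h : FlowOn A γ J) (a : ℝ) :
    FlowOn A (fun s => γ (s + a)) ((fun s => s + a) ⁻¹' J) := by
  intro t ht
  obtain ⟨c, hc, htc, hev⟩ := h (t + a) ht
  refine ⟨c, hc, htc, ?_⟩
  have hlim : Tendsto (fun s : ℝ => s + a) (𝓝[(fun s => s + a) ⁻¹' J] t) (𝓝[J] (t + a)) :=
    (continuous_id.add continuous_const).continuousWithinAt.tendsto_nhdsWithin fun s hs => hs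
  filter_upwards [hlim.eventually hev] with s hs
  refine ⟨hs.1, ?_⟩
  rw [hs.2]
  congr 2
  ring

/-- The set of agreement is closed because `M` is Hausdorff. It is open because in a chart both
curves are `s ↦ exp (s - t) • v` with the same `v`. -/
lemma FlowOn.eqOn [T2Space M] {γ η : ℝ → M} {J : Set ℝ} (hJ : IsPreconnected J)
    (hγ : FlowOn A γ J) (hη : FlowOn A η J) {t₀ : ℝ} (ht₀ : t₀ ∈ J) (he : γ t₀ = η t₀) :
    EqOn γ η J := by
  have : PreconnectedSpace J := Subtype.preconnectedSpace hJ
  let S : Set J := {t | γ t = η t}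
  have hcl : IsClosed S :=
    isClosed_eq (continuousOn_iff_continuous_domRestrict.1 hγ.continuousOn)
      (continuousOn_iff_continuous_domRestrict.1 hη.continuousOn)
  have hop : IsOpen S := by
    rw [isOpen_iff_mem_nhds]
    rintro ⟨t, ht⟩ hts
    have hts' : γ t = η t := hts
    obtain ⟨c, hc, htc⟩ := A.covers (γ t)
    have h1 := (hγ.chart ht hc htc).and (hη.chart ht hc (hts' ▸ htc))
    rw [nhdsWithin_eq_map_subtype_coe ht, eventually_map] at h1
    filter_upwards [h1] with s hs
    refine A.injOn hc hs.1.1 hs.2.1 ?_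
    rw [hs.1.2, hs.2.2, hts']
  have huniv : S = univ := IsClopen.eq_univ ⟨hcl, hop⟩ ⟨⟨t₀, ht₀⟩, he⟩
  intro t ht
  have : (⟨t, ht⟩ : J) ∈ S := huniv ▸ mem_univ _
  exact this

/-- Uniqueness for the equation `f' = f`: the function `exp (-r) • f r` has derivative zero. -/
lemma eqOn_of_locally_exp {f : ℝ → Vec n} {J : Set ℝ} (hJo : IsOpen J) (hJ : IsPreconnected J)
    (hf : ∀ t ∈ J, HasDerivAt f (f t) t) {s t : ℝ} (hs : s ∈ J) (ht : t ∈ J) :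
    f s = Real.exp (s - t) • f t := by
  have hd : ∀ r ∈ J, HasDerivAt (fun r => Real.exp (-r) • f r) 0 r := by
    intro r hr
    have h1 : HasDerivAt (fun r : ℝ => Real.exp (-r)) (-Real.exp (-r)) r := by
      simpa using (hasDerivAt_neg r).exp
    refine (h1.smul (hf r hr)).congr_deriv ?_
    simp
  have hconst := hJo.is_const_of_deriv_eq_zero (f := fun r => Real.exp (-r) • f r) hJ
    (fun r hr => (hd r hr).differentiableAt.differentiableWithinAt)
    (fun r hr => (hd r hr).deriv) hs ht
  have := congrArg (fun v => Real.exp s • v) hconst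
  simp only [smul_smul, ← Real.exp_add] at this
  simpa [sub_eq_add_neg] using this

lemma hasDerivAt_exp_sub_smul (t : ℝ) (v : Vec n) :
    HasDerivAt (fun s => Real.exp (s - t) • v) v t := by
  have h1 : HasDerivAt (fun s : ℝ => Real.exp (s - t)) 1 t := by
    simpa using ((hasDerivAt_id t).sub_const t).exp
  simpa using h1.smul_const v

lemma IsRadialFlowLine.flowOn {γ : ℝ → M} (h : IsRadialFlowLine A γ) : FlowOn A γ univ := by
  intro t _
  obtain ⟨c, hc, htc⟩ := A.covers (γ t)
  refine ⟨c, hc, htc, ?_⟩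
  rw [nhdsWithin_univ]
  obtain ⟨δ, hδ, hball⟩ := Metric.mem_nhds_iff.1
    (h.1.continuousAt.preimage_mem_nhds (A.source_mem_nhds hc htc))
  filter_upwards [Metric.ball_mem_nhds t hδ] with s hs
  exact ⟨hball hs, eqOn_of_locally_exp (f := fun s => c.2 (γ s)) Metric.isOpen_ball
    (convex_ball t δ).isPreconnected
    (fun r hr => h.2 r c hc (hball hr)) hs (Metric.mem_ball_self hδ)⟩

lemma FlowOn.hasDerivAt {γ : ℝ → M} {J : Set ℝ} (h : FlowOn A γ J) {t : ℝ} (ht : J ∈ 𝓝 t)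
    (hc : c ∈ A.charts) (htc : γ t ∈ c.1) :
    HasDerivAt (fun s => c.2 (γ s)) (c.2 (γ t)) t := by
  refine (hasDerivAt_exp_sub_smul t _).congr_of_eventuallyEq ?_
  have := h.chart (mem_of_mem_nhds ht) hc htc
  rw [nhdsWithin_eq_nhds.2 ht] at this
  exact this.mono fun s hs => hs.2

lemma FlowOn.isRadialFlowLine {γ : ℝ → M} (h : FlowOn A γ univ) : IsRadialFlowLine A γ :=
  ⟨continuousOn_univ.1 h.continuousOn, fun _ _ hc htc => h.hasDerivAt univ_mem hc htc⟩

variable (A) in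
-- In one chart the flow is `v ↦ eᵗ v`, brought back by the inverse of the chart. For short times
-- the scaled vectors remain in the image of the chart, because `O` is open and the model is a cone.
lemma exists_local_radial_flow (p : M) :
    ∃ ε > 0, ∃ U : Set M, IsOpen U ∧ p ∈ U ∧ ∃ ψ : ℝ → M → M,
      ContinuousOn (Function.uncurry ψ) (Icc (-ε) ε ×ˢ U) ∧
      ∀ x ∈ U, ψ 0 x = x ∧ FlowOn A (fun t => ψ t x) (Icc (-ε) ε) := by
  have : Nonempty M := ⟨p⟩
  obtain ⟨c, hc, hpc⟩ := A.covers p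
  obtain ⟨H, hH, O, hO, he⟩ := A.image_eq c hc
  obtain ⟨j, hj, hj', hjc⟩ := A.chart_inverse hc
  have hpO : c.2 p ∈ O := (he ▸ mem_image_of_mem c.2 hpc).1
  have hcont : Continuous fun z : ℝ × Vec n => Real.exp z.1 • z.2 := by fun_prop
  have hmem : (fun z : ℝ × Vec n => Real.exp z.1 • z.2) ⁻¹' O ∈ 𝓝 ((0 : ℝ), c.2 p) :=
    hcont.continuousAt.preimage_mem_nhds (hO.mem_nhds (by simpa using hpO))
  rw [nhds_prod_eq, mem_prod_iff] at hmem
  obtain ⟨I, hI, W, hW, hIW⟩ := hmem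
  obtain ⟨δ, hδ, hball⟩ := Metric.mem_nhds_iff.1 hI
  have hIcc : Icc (-(δ / 2)) (δ / 2) ⊆ I := fun t ht => hball (by
    rw [Metric.mem_ball, Real.dist_eq, sub_zero, abs_lt]
    constructor <;> linarith [ht.1, ht.2])
  obtain ⟨U, hUs, hU, hpU⟩ := mem_nhds_iff.1
    (inter_mem (A.source_mem_nhds hc hpc) ((A.continuousAt hc hpc).preimage_mem_nhds hW))
  have himg : ∀ t ∈ Icc (-(δ / 2)) (δ / 2), ∀ x ∈ U, Real.exp t • c.2 x ∈ c.2 '' c.1 := by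
    intro t ht x hx
    rw [he]
    exact ⟨hIW (mk_mem_prod (hIcc ht) (hUs hx).2), smul_mem_linearModel hH
      (he ▸ mem_image_of_mem c.2 (hUs hx).1).2 (Real.exp_pos t).le⟩
  refine ⟨δ / 2, by positivity, U, hU, hpU, fun t x => j (Real.exp t • c.2 x), ?_, fun x hx =>
    ⟨by simpa using hj x (hUs hx).1, fun t ht => ⟨c, hc, (hj' _ (himg t ht x hx)).1, ?_⟩⟩⟩
  · refine hjc.comp (t := c.2 '' c.1) ?_ fun z hz => himg z.1 hz.1 z.2 hz.2
    refine ContinuousOn.smul (Real.continuous_exp.comp_continuousOn continuousOn_fst) ?_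
    exact ((A.continuousOn hc).mono fun x hx => (hUs hx).1).comp continuousOn_snd fun z hz => hz.2
  · filter_upwards [self_mem_nhdsWithin] with s hs
    refine ⟨(hj' _ (himg s hs x hx)).1, ?_⟩
    rw [(hj' _ (himg s hs x hx)).2, (hj' _ (himg t ht x hx)).2, smul_smul, ← Real.exp_add]
    congr 2
    ring

/-- `Ψ` is the radial flow. -/
def IsRadialFlow (A : RadiantAtlas n M) (Ψ : Flow ℝ M) : Prop :=
  ∀ x, FlowOn A (fun t => Ψ t x) univ

/-- A finite subcover gives a common time. Each point uses a local flow chosen arbitrarily among the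
finitely many; uniqueness of flow lines replaces the choice at nearby points by the choice at `x`,
which restores continuity. -/
lemma exists_uniform_local_radial_flow [T2Space M] [CompactSpace M] (A : RadiantAtlas n M) :
    ∃ ε > 0, ∃ ψ : ℝ → M → M,
      ContinuousOn (Function.uncurry ψ) (Icc (-ε) ε ×ˢ univ) ∧
      ∀ x, ψ 0 x = x ∧ FlowOn A (fun t => ψ t x) (Icc (-ε) ε) := by
  choose e he U hU hpU ψ hψc hψ using exists_local_radial_flow A
  obtain ⟨F, hF⟩ := CompactSpace.elim_nhds_subcover U fun p => (hU p).mem_nhds (hpU p)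
  obtain ⟨ε, hε, hεF⟩ : ∃ ε > 0, ∀ p ∈ F, ε ≤ e p := by
    rcases F.eq_empty_or_nonempty with h | h
    · exact ⟨1, one_pos, by simp [h]⟩
    · exact ⟨F.inf' h e, (Finset.lt_inf'_iff h).2 fun p _ => he p, fun p hp => Finset.inf'_le _ hp⟩
  have hex : ∀ x : M, ∃ p ∈ F, x ∈ U p := fun x => by simpa using hF.ge (mem_univ x)
  choose i hiF hiU using hex
  have hIcc : ∀ p ∈ F, Icc (-ε) ε ⊆ Icc (-e p) (e p) := fun p hp =>
    Icc_subset_Icc (neg_le_neg (hεF p hp)) (hεF p hp)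
  have hflow : ∀ x, FlowOn A (fun t => ψ (i x) t x) (Icc (-ε) ε) := fun x =>
    (hψ (i x) x (hiU x)).2.mono (hIcc _ (hiF x))
  refine ⟨ε, hε, fun t x => ψ (i x) t x, ?_, fun x => ⟨(hψ (i x) x (hiU x)).1, hflow x⟩⟩
  rintro ⟨t, x⟩ ⟨ht, -⟩
  have h1 : ContinuousWithinAt (Function.uncurry (ψ (i x))) (Icc (-ε) ε ×ˢ U (i x)) (t, x) :=
    ((hψc (i x)).mono (prod_mono (hIcc _ (hiF x)) subset_rfl)) (t, x) ⟨ht, hiU x⟩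
  have h2 : 𝓝[Icc (-ε) ε ×ˢ univ] (t, x) = 𝓝[Icc (-ε) ε ×ˢ U (i x)] (t, x) := by
    rw [nhdsWithin_prod_eq, nhdsWithin_prod_eq, nhdsWithin_univ,
      (hU (i x)).nhdsWithin_eq (hiU x)]
  rw [ContinuousWithinAt, h2]
  refine ContinuousWithinAt.congr h1 (fun z hz => ?_) ?_
  · exact (hflow z.2).eqOn (convex_Icc _ _).isPreconnected
      ((hψ (i x) z.2 hz.2).2.mono (hIcc _ (hiF x))) (t₀ := 0) ⟨by linarith, hε.le⟩
      (((hψ _ z.2 (hiU _)).1).trans ((hψ (i x) z.2 hz.2).1).symm) hz.1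
  · rfl

/-- The radial flow of a compact radiant affine manifold is complete. -/
theorem exists_isRadialFlow [T2Space M] [CompactSpace M] (A : RadiantAtlas n M) :
    ∃ Ψ : Flow ℝ M, IsRadialFlow A Ψ := by
  obtain ⟨ε, hε, ψ, hψc, hψ⟩ := exists_uniform_local_radial_flow A
  obtain ⟨Ψ, hΨ⟩ := exists_flow_of_local_family hε hψc (fun x => (hψ x).1) (by
    intro s t hs ht hst x
    -- `r ↦ ψ (r + t) x` and `r ↦ ψ r (ψ t x)` are flow lines with the same value at `0`. They are
    -- compared on this interval, which contains both `0` and `s`.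
    have hJ : IsPreconnected (Icc (-ε) ε ∩ (fun r => r + t) ⁻¹' Icc (-ε) ε) := by
      refine (Convex.inter (convex_Icc _ _) ?_).isPreconnected
      rw [preimage_add_const_Icc]
      exact convex_Icc _ _
    have h1 : FlowOn A (fun r => ψ (r + t) x) (Icc (-ε) ε ∩ (fun r => r + t) ⁻¹' Icc (-ε) ε) :=
      ((hψ x).2.comp_add t).mono inter_subset_right
    have h2 : FlowOn A (fun r => ψ r (ψ t x)) (Icc (-ε) ε ∩ (fun r => r + t) ⁻¹' Icc (-ε) ε) :=
      (hψ (ψ t x)).2.mono inter_subset_left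
    refine h1.eqOn hJ h2 (t₀ := 0) ⟨⟨by linarith, hε.le⟩, ?_⟩ ?_ ⟨abs_le.1 hs, abs_le.1 hst⟩
    · simpa using abs_le.1 ht
    · simpa using (hψ (ψ t x)).1.symm)
  refine ⟨Ψ, fun x t _ => ?_⟩
  have hnh : Icc (-ε) ε ∈ 𝓝 (0 : ℝ) := Icc_mem_nhds (by linarith) hε
  obtain ⟨c, hc, htc, hev⟩ := (hψ (Ψ t x)).2 0 (mem_of_mem_nhds hnh)
  simp only [(hψ (Ψ t x)).1] at htc hev
  rw [nhdsWithin_eq_nhds.2 hnh] at hev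
  refine ⟨c, hc, htc, ?_⟩
  rw [nhdsWithin_univ]
  have hlim : Tendsto (fun s : ℝ => s - t) (𝓝 t) (𝓝 0) := by
    simpa using (continuous_id.sub continuous_const).tendsto (f := fun s : ℝ => s - t) t
  filter_upwards [hlim.eventually hev, hlim.eventually hnh] with s hs hsε
  have e : Ψ s x = ψ (s - t) (Ψ t x) := by
    rw [← hΨ _ (abs_le.2 hsε), ← Ψ.map_add]
    congr 1
    ring
  rw [e]
  simpa using hs

namespace IsRadialFlow

variable {Ψ : Flow ℝ M} (hΨ : IsRadialFlow A Ψ)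

include hΨ

lemma eq_of_isRadialFlowLine [T2Space M] {γ : ℝ → M} (hγ : IsRadialFlowLine A γ) (t : ℝ) :
    γ t = Ψ t (γ 0) :=
  hγ.flowOn.eqOn isPreconnected_univ (hΨ (γ 0)) (mem_univ 0) (by simp) (mem_univ t)

/-- A product neighbourhood of `(0, p)` keeps whole orbit segments in the chart, not only their end
points, so the equation `f' = f` can be integrated along them. -/
lemma eventually_chart_eq (hc : c ∈ A.charts) (hp : p ∈ c.1) :
    ∀ᶠ z : ℝ × M in 𝓝 (0, p), Ψ z.1 z.2 ∈ c.1 ∧ z.2 ∈ c.1 ∧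
      c.2 (Ψ z.1 z.2) = Real.exp z.1 • c.2 z.2 := by
  have hcont : Continuous fun z : ℝ × M => Ψ z.1 z.2 := Ψ.continuous continuous_fst continuous_snd
  have hmem : (fun z : ℝ × M => Ψ z.1 z.2) ⁻¹' c.1 ∈ 𝓝 ((0 : ℝ), p) :=
    hcont.continuousAt.preimage_mem_nhds (by simpa using A.source_mem_nhds hc hp)
  rw [nhds_prod_eq, mem_prod_iff] at hmem
  obtain ⟨I, hI, W, hW, hIW⟩ := hmem
  obtain ⟨δ, hδ, hball⟩ := Metric.mem_nhds_iff.1 hI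
  filter_upwards [prod_mem_nhds (Metric.ball_mem_nhds 0 hδ)
    (inter_mem hW (A.source_mem_nhds hc hp))] with z hz
  have hin : ∀ r ∈ Metric.ball (0 : ℝ) δ, Ψ r z.2 ∈ c.1 := fun r hr =>
    hIW (mk_mem_prod (hball hr) hz.2.1)
  refine ⟨hin _ hz.1, hz.2.2, ?_⟩
  have := eqOn_of_locally_exp (f := fun s => c.2 (Ψ s z.2)) Metric.isOpen_ball
    (convex_ball 0 δ).isPreconnected
    (fun r hr => (hΨ z.2).hasDerivAt univ_mem hc (hin r hr)) hz.1 (Metric.mem_ball_self hδ)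
  simpa using this

end IsRadialFlow

/-- A vector field which is parallel, that is, locally constant in the charts: `V c p` is its value
at `p` in the chart `c`. -/
structure IsParallelField (A : RadiantAtlas n M) (V : Set M × (M → Vec n) → M → Vec n) :
    Prop where
  eventually_eq : ∀ c ∈ A.charts, ∀ p ∈ c.1, ∀ᶠ x in 𝓝 p, V c x = V c p
  map_eq : ∀ c ∈ A.charts, ∀ c' ∈ A.charts, ∀ p ∈ c.1, p ∈ c'.1 → ∀ g : GLn n,
    (∀ᶠ x in 𝓝 p, c'.2 x = g (c.2 x)) → V c' p = g (V c p)

variable (A) in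
lemma isParallelField_zero : IsParallelField A 0 :=
  ⟨fun _ _ _ _ => Eventually.of_forall fun _ => rfl, fun _ _ _ _ _ _ _ g _ => (map_zero g).symm⟩

namespace IsRadialFlow

variable {Ψ : Flow ℝ M} (hΨ : IsRadialFlow A Ψ)

include hΨ

/-- The times at which the assertion holds form an open and closed set. Between nearby times the
flow in a fixed chart is multiplication by a scalar and the field is constant, while a change of
chart only composes `g` with a transition map. The field is carried by `g` rather than by `exp t •
g`, as the transport is parallel and not the derivative of the flow. -/
lemma exists_germ_aux {V : Set M × (M → Vec n) → M → Vec n} (hV : IsParallelField A V)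
    (hc : c ∈ A.charts) (hp : p ∈ c.1) (t : ℝ) :
    ∃ c' ∈ A.charts, Ψ t p ∈ c'.1 ∧ ∃ g : GLn n,
      (∀ᶠ x in 𝓝 p, c'.2 (Ψ t x) = g (Real.exp t • c.2 x)) ∧ V c' (Ψ t p) = g (V c p) := by
  let Good : Set ℝ := {t | ∃ c' ∈ A.charts, Ψ t p ∈ c'.1 ∧ ∃ g : GLn n,
      (∀ᶠ x in 𝓝 p, c'.2 (Ψ t x) = g (Real.exp t • c.2 x)) ∧ V c' (Ψ t p) = g (V c p)}
  -- At a good time every chart at `Ψ s p` will do, so nearby times can be compared in one chart.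
  have hall : ∀ s ∈ Good, ∀ c' ∈ A.charts, Ψ s p ∈ c'.1 → ∃ g : GLn n,
      (∀ᶠ x in 𝓝 p, c'.2 (Ψ s x) = g (Real.exp s • c.2 x)) ∧ V c' (Ψ s p) = g (V c p) := by
    rintro s ⟨c₁, hc₁, hs₁, g, hg, hVg⟩ c' hc' hs'
    obtain ⟨h, hh⟩ := exists_transition A hc₁ hc' hs₁ hs'
    refine ⟨g.trans h, ?_, ?_⟩
    · filter_upwards [hg, (Ψ.continuous_toFun s).continuousAt.eventually hh] with x hx hhx
      exact hhx.trans (congrArg h hx)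
    · rw [hV.map_eq c₁ hc₁ c' hc' _ hs₁ hs' h hh, hVg]
      rfl
  have hloc : ∀ s₀ : ℝ, ∀ᶠ s in 𝓝 s₀, s ∈ Good ↔ s₀ ∈ Good := by
    intro s₀
    obtain ⟨c₀, hc₀, hs₀⟩ := A.covers (Ψ s₀ p)
    have hcs : Continuous fun s => Ψ s p := Ψ.continuous continuous_id continuous_const
    have hlim : Tendsto (fun s : ℝ => (s - s₀, Ψ s₀ p)) (𝓝 s₀) (𝓝 (0, Ψ s₀ p)) := by
      have : Continuous fun s : ℝ => (s - s₀, Ψ s₀ p) := by fun_prop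
      simpa using this.tendsto s₀
    filter_upwards [hcs.continuousAt.eventually (A.source_mem_nhds hc₀ hs₀),
      hlim.eventually (hΨ.eventually_chart_eq hc₀ hs₀).eventually_nhds,
      hcs.continuousAt.eventually (hV.eventually_eq c₀ hc₀ _ hs₀)] with s hsc hs hsV
    have hrel : ∀ᶠ x in 𝓝 p, c₀.2 (Ψ s x) = Real.exp (s - s₀) • c₀.2 (Ψ s₀ x) := by
      have hl : Tendsto (fun x => (s - s₀, Ψ s₀ x)) (𝓝 p) (𝓝 (s - s₀, Ψ s₀ p)) :=
        (continuous_const.prodMk (Ψ.continuous_toFun s₀)).tendsto p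
      filter_upwards [hl.eventually hs] with x hx
      rw [← hx.2.2, ← Ψ.map_add, sub_add_cancel]
    constructor
    · intro hg
      obtain ⟨g, hg, hVg⟩ := hall s hg c₀ hc₀ hsc
      refine ⟨c₀, hc₀, hs₀, g, ?_, hsV ▸ hVg⟩
      filter_upwards [hrel, hg] with x hx hgx
      rw [hx] at hgx
      have := congrArg (fun v => Real.exp (s₀ - s) • v) hgx
      simp only [smul_smul, ← map_smul, ← Real.exp_add] at this
      simpa using this
    · intro hg
      obtain ⟨g, hg, hVg⟩ := hall s₀ hg c₀ hc₀ hs₀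
      refine ⟨c₀, hc₀, hsc, g, ?_, hsV.trans hVg⟩
      filter_upwards [hrel, hg] with x hx hgx
      rw [hx, hgx, ← map_smul, smul_smul, ← Real.exp_add, sub_add_cancel]
  have hop : IsOpen Good := isOpen_iff_mem_nhds.2 fun s₀ hs₀ => by
    filter_upwards [hloc s₀] with s hs using hs.2 hs₀
  have hcl : IsOpen Goodᶜ := isOpen_iff_mem_nhds.2 fun s₀ hs₀ => by
    filter_upwards [hloc s₀] with s hs using fun h => hs₀ (hs.1 h)
  have h0 : (0 : ℝ) ∈ Good := by
    refine ⟨c, hc, by simpa using hp, LinearEquiv.refl ℝ _, ?_, by simp⟩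
    simp
  have : Good = univ := IsClopen.eq_univ ⟨⟨hcl⟩, hop⟩ ⟨0, h0⟩
  exact (show t ∈ Good from this ▸ mem_univ t)

/-- In charts, the time `t` map of the radial flow is locally a linear map composed with
multiplication by `eᵗ`; the linear maps transport parallel fields. -/
lemma exists_germ {V : Set M × (M → Vec n) → M → Vec n} (hV : IsParallelField A V)
    (hc : c ∈ A.charts) (hp : p ∈ c.1) (t : ℝ) (hc' : c' ∈ A.charts) (hp' : Ψ t p ∈ c'.1) :
    ∃ g : GLn n, (∀ᶠ z : ℝ × M in 𝓝 (t, p), c'.2 (Ψ z.1 z.2) = g (Real.exp z.1 • c.2 z.2)) ∧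
      V c' (Ψ t p) = g (V c p) := by
  obtain ⟨c₁, hc₁, hp₁, g, hg, hVg⟩ := hΨ.exists_germ_aux hV hc hp t
  obtain ⟨h, hh⟩ := exists_transition A hc₁ hc' hp₁ hp'
  refine ⟨g.trans h, ?_, ?_⟩
  · have hlim : Tendsto (fun z : ℝ × M => (z.1 - t, Ψ t z.2)) (𝓝 (t, p)) (𝓝 (0, Ψ t p)) := by
      have : Continuous fun z : ℝ × M => (z.1 - t, Ψ t z.2) :=
        (by fun_prop : Continuous fun z : ℝ × M => z.1 - t).prodMk
          ((Ψ.continuous_toFun t).comp continuous_snd)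
      simpa using this.tendsto (t, p)
    have hc2 : Tendsto (fun z : ℝ × M => Ψ z.1 z.2) (𝓝 (t, p)) (𝓝 (Ψ t p)) :=
      (Ψ.continuous continuous_fst continuous_snd).tendsto (t, p)
    filter_upwards [hlim.eventually (hΨ.eventually_chart_eq hc₁ hp₁), hc2.eventually hh,
      (continuous_snd.tendsto (t, p)).eventually hg] with z hz hhz hgz
    have e := hz.2.2
    rw [← Ψ.map_add, sub_add_cancel, hgz, ← map_smul, smul_smul, ← Real.exp_add,
      sub_add_cancel] at e
    rw [hhz, e]
    rfl
  · rw [hV.map_eq c₁ hc₁ c' hc' _ hp₁ hp' h hh, hVg]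
    rfl

end IsRadialFlow

end RadialFlow

end RadiantAffine

namespace RadiantAffine

/-! ### Lifting homeomorphisms to simply connected covering spaces -/

section Lifting

variable {E N : Type*} [TopologicalSpace E] [TopologicalSpace N]

lemma IsLocalHomeomorph.locallyPathConnectedSpace [LocallyPathConnectedSpace N] {q : E → N}
    (hq : IsLocalHomeomorph q) : LocallyPathConnectedSpace E := by
  choose e he _ using hq
  let _ : ChartedSpace N E :=
    { atlas := univ
      chartAt := e
      mem_chart_source := he
      chart_mem_atlas := fun _ => mem_univ _ }
  exact ChartedSpace.locallyPathConnectedSpace N E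

/-- Lift `f ∘ q` and `f⁻¹ ∘ q` with matching base points. Both composites of the lifts cover the
identity and fix a point, so they are the identity. -/
lemma exists_homeomorph_lift [SimplyConnectedSpace E] [LocallyPathConnectedSpace E] {q : E → N}
    (hq : IsCoveringMap q) (f : N ≃ₜ N) {x x' : E} (h : q x' = f (q x)) :
    ∃ F : E ≃ₜ E, F x = x' ∧ ∀ y, q (F y) = f (q y) := by
  obtain ⟨F, ⟨hF, hFq⟩, -⟩ := hq.existsUnique_continuousMap_lifts
    (⟨fun y => f (q y), f.continuous.comp hq.continuous⟩ : C(E, N)) x x' h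
  obtain ⟨F', ⟨hF', hFq'⟩, -⟩ := hq.existsUnique_continuousMap_lifts
    (⟨fun y => f.symm (q y), f.symm.continuous.comp hq.continuous⟩ : C(E, N)) x' x (by
      simp [h])
  have e1 : ∀ y, q (F y) = f (q y) := fun y => congrFun hFq y
  have e2 : ∀ y, q (F' y) = f.symm (q y) := fun y => congrFun hFq' y
  have h1 : F' ∘ F = id := hq.eq_of_comp_eq (F'.continuous.comp F.continuous) continuous_id
    (by funext y; simp [e1, e2]) x (by simp [hF, hF'])
  have h2 : F ∘ F' = id := hq.eq_of_comp_eq (F.continuous.comp F'.continuous) continuous_id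
    (by funext y; simp [e1, e2]) x' (by simp [hF, hF'])
  exact ⟨⟨⟨F, F', fun y => congrFun h1 y, fun y => congrFun h2 y⟩, F.continuous, F'.continuous⟩,
    hF, e1⟩

lemma exists_deckGroup_apply_eq [SimplyConnectedSpace E] [LocallyPathConnectedSpace E] {q : E → N}
    (hq : IsCoveringMap q) {x x' : E} (h : q x = q x') :
    ∃ γ : deckGroup q, (γ : E ≃ₜ E) x = x' := by
  obtain ⟨F, hF, hFq⟩ := exists_homeomorph_lift hq (Homeomorph.refl N) (x := x) (x' := x') h.symm
  exact ⟨⟨F, hFq⟩, hF⟩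

end Lifting

/-! ### Real projective space -/

section ProjectiveSpace

variable {n : ℕ}

lemma continuous_projectivization_mk :
    Continuous fun v : {v : Vec n // v ≠ 0} => (Projectivization.mk ℝ v.1 v.2 : RP n) :=
  continuous_coinduced_rng

/-- The saturation of an open set is the union of its nonzero scalar multiples. -/
lemma isOpenQuotientMap_projectivization_mk :
    IsOpenQuotientMap fun v : {v : Vec n // v ≠ 0} =>
      (Projectivization.mk ℝ v.1 v.2 : RP n) := by
  refine ⟨fun x => ?_, continuous_projectivization_mk, fun U hU => ?_⟩
  · exact ⟨⟨x.rep, x.rep_nonzero⟩, x.mk_rep⟩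
  · refine isOpen_coinduced.2 ?_
    have : (fun v : {v : Vec n // v ≠ 0} => (Projectivization.mk ℝ v.1 v.2 : RP n)) ⁻¹'
        ((fun v : {v : Vec n // v ≠ 0} => (Projectivization.mk ℝ v.1 v.2 : RP n)) '' U) =
        ⋃ a : ℝˣ, (fun v : {v : Vec n // v ≠ 0} =>
          (⟨a • v.1, (smul_ne_zero_iff_ne a).2 v.2⟩ : {v : Vec n // v ≠ 0})) ⁻¹' U := by
      ext v
      simp only [mem_preimage, mem_image, mem_iUnion]
      constructor
      · rintro ⟨w, hw, he⟩
        obtain ⟨a, ha⟩ := (Projectivization.mk_eq_mk_iff ℝ _ _ w.2 v.2).1 he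
        exact ⟨a, by convert hw⟩
      · rintro ⟨a, ha⟩
        exact ⟨_, ha, (Projectivization.mk_eq_mk_iff ℝ _ _ _ v.2).2 ⟨a, rfl⟩⟩
    rw [this]
    refine isOpen_iUnion fun a => hU.preimage ?_
    have hca : Continuous fun v : {v : Vec n // v ≠ 0} => a • v.1 :=
      continuous_subtype_val.const_smul a
    exact hca.subtype_mk _

lemma isOpen_image_projectivization_mk {U : Set (Vec n)} (hU : IsOpen U) :
    IsOpen {x : RP n | ∃ (v : Vec n) (hv : v ≠ 0), v ∈ U ∧ Projectivization.mk ℝ v hv = x} := by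
  have := isOpenQuotientMap_projectivization_mk (n := n).isOpenMap _
    (hU.preimage continuous_subtype_val)
  convert this using 1
  ext x
  constructor
  · rintro ⟨v, hv, hvU, rfl⟩
    exact ⟨⟨v, hv⟩, hvU, rfl⟩
  · rintro ⟨⟨v, hv⟩, hvU, rfl⟩
    exact ⟨v, hv, hvU, rfl⟩

lemma exists_rep_mk_eq_smul {v : Vec n} (hv : v ≠ 0) :
    ∃ a : ℝ, a ≠ 0 ∧ (Projectivization.mk ℝ v hv : RP n).rep = a • v := by
  obtain ⟨a, ha⟩ := Projectivization.exists_smul_eq_mk_rep ℝ v hv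
  exact ⟨a, a.ne_zero, ha.symm⟩

lemma mk_mem_projectiveHalfSpace {α β : Vec n →ₗ[ℝ] ℝ} {v : Vec n} (hv : v ≠ 0) :
    (Projectivization.mk ℝ v hv : RP n) ∈ {x : RP n | α x.rep ≠ 0 ∧ 0 ≤ β x.rep / α x.rep} ↔
      α v ≠ 0 ∧ 0 ≤ β v / α v := by
  obtain ⟨a, ha, he⟩ := exists_rep_mk_eq_smul hv
  simp only [mem_ofPred_eq, he, map_smul, smul_eq_mul, mul_div_mul_left _ _ ha, ne_eq, mul_eq_zero,
    ha, false_or]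

/-- Every member of `projectiveModels` is, near the class of `v`, the image of a half-space. -/
lemma exists_linear_of_mem_projectiveModels {H : Set (RP n)} (hH : H ∈ projectiveModels n)
    {v : Vec n} (hv : v ≠ 0) (hvH : Projectivization.mk ℝ v hv ∈ H) :
    ∃ α β : Vec n →ₗ[ℝ] ℝ, 0 < α v ∧ 0 ≤ β v ∧
      ∀ (w : Vec n) (hw : w ≠ 0), 0 < α w → (Projectivization.mk ℝ w hw ∈ H ↔ 0 ≤ β w) := by
  rcases hH with rfl | ⟨α, β, -, rfl⟩
  -- Without boundary, `β = 0` imposes no condition, and the inner product with `v` is a form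
  -- positive at `v`.
  · refine ⟨(innerSL ℝ v).toLinearMap, 0, ?_, by simp, by simp⟩
    simpa using pow_pos (norm_pos_iff.2 hv) 2
  · rw [mk_mem_projectiveHalfSpace] at hvH
    rcases hvH.1.lt_or_gt with h | h
    -- Changing both signs leaves the ratio `β / α` alone and makes the denominator positive at `v`.
    · refine ⟨-α, -β, by simpa using h, ?_, fun w hw h' => ?_⟩
      · have := hvH.2
        rw [← neg_div_neg_eq] at this
        simpa using (le_div_iff₀ (by linarith : 0 < -α v)).1 this
      · rw [mk_mem_projectiveHalfSpace]
        rw [LinearMap.neg_apply] at h'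
        rw [← neg_div_neg_eq, le_div_iff₀ h', zero_mul, LinearMap.neg_apply]
        exact and_iff_right (by intro h0; rw [h0] at h'; simp at h')
    · refine ⟨α, β, h, by simpa using (le_div_iff₀ h).1 hvH.2, fun w hw h' => ?_⟩
      rw [mk_mem_projectiveHalfSpace, le_div_iff₀ h', zero_mul]
      exact and_iff_right h'.ne'

/-- Near the class of `v` the image of a chart is the projection of a ball around `v` cut by a
half-space `β ≥ 0`, and this set is convex. Local path connectedness passes on to the universal
covering, where lifts are constructed. -/
lemma ProjectiveAtlas.locallyPathConnectedSpace {N : Type*} [TopologicalSpace N]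
    (B : ProjectiveAtlas n N) : LocallyPathConnectedSpace N := by
  constructor
  intro p
  rw [hasBasis_self]
  intro U₀ hU₀
  have : Nonempty N := ⟨p⟩
  obtain ⟨c, hc, hpc⟩ := B.covers p
  obtain ⟨U, hUs, hU, hpU⟩ := mem_nhds_iff.1 (inter_mem hU₀ (B.source_mem_nhds hc hpc))
  obtain ⟨H, hH, O, hO, he⟩ := B.exists_image_eq hc hU (fun x hx => (hUs hx).2)
  obtain ⟨j, hj, hj', hjc⟩ := B.chart_inverse hc
  obtain ⟨v, hv, hvp⟩ : ∃ (v : Vec n) (hv : v ≠ 0), Projectivization.mk ℝ v hv = c.2 p :=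
    ⟨_, (c.2 p).rep_nonzero, (c.2 p).mk_rep⟩
  have hpO : c.2 p ∈ O ∩ H := he ▸ mem_image_of_mem _ hpU
  obtain ⟨α, β, hα, hβ, hiff⟩ := exists_linear_of_mem_projectiveModels hH hv (hvp ▸ hpO.2)
  have hOn : Subtype.val '' ((fun v : {v : Vec n // v ≠ 0} =>
      (Projectivization.mk ℝ v.1 v.2 : RP n)) ⁻¹' O) ∈ 𝓝 v :=
    ((isOpen_ne.isOpenMap_subtype_val) _ (hO.preimage continuous_projectivization_mk)).mem_nhds
      ⟨⟨v, hv⟩, by rw [mem_preimage, hvp]; exact hpO.1, rfl⟩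
  have hαn : {w | 0 < α w} ∈ 𝓝 v :=
    (isOpen_lt continuous_const α.continuous_of_finiteDimensional).mem_nhds hα
  obtain ⟨r, hr, hball⟩ := Metric.mem_nhds_iff.1 (inter_mem hOn hαn)
  set K : Set (Vec n) := Metric.ball v r ∩ {w | 0 ≤ β w} with hK
  have hKconv : Convex ℝ K := (convex_ball v r).inter (convex_halfSpace_ge β.isLinear 0)
  have hKne : ∀ w ∈ Metric.ball v r, w ≠ 0 := by
    rintro w hw rfl
    have : (0 : ℝ) < α 0 := (hball hw).2
    simp at this
  have hKO : ∀ w (hw : w ∈ Metric.ball v r), Projectivization.mk ℝ w (hKne w hw) ∈ O := by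
    intro w hw
    obtain ⟨⟨w', hw'⟩, hwO, rfl⟩ := (hball hw).1
    exact hwO
  have hKimg : ∀ w (hw : w ∈ K), Projectivization.mk ℝ w (hKne w hw.1) ∈ c.2 '' U := by
    intro w hw
    rw [he]
    exact ⟨hKO w hw.1, (hiff w _ (hball hw.1).2).2 hw.2⟩
  let k : K → N := fun w => j (Projectivization.mk ℝ w.1 (hKne w w.2.1))
  have hkc : Continuous k := by
    have h1 : Continuous fun w : K => (Projectivization.mk ℝ w.1 (hKne w w.2.1) : RP n) :=
      continuous_projectivization_mk.comp (continuous_subtype_val.subtype_mk fun w => hKne w w.2.1)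
    exact hjc.comp_continuous h1 fun w =>
      image_mono (fun x hx => (hUs hx).2) (hKimg w w.2)
  have hKp : PathConnectedSpace K := isPathConnected_iff_pathConnectedSpace.1
    (hKconv.isPathConnected ⟨v, Metric.mem_ball_self hr, hβ⟩)
  refine ⟨range k, ?_, isPathConnected_range hkc, ?_⟩
  · have h1 := (B.continuousAt hc hpc).preimage_mem_nhds
      ((isOpen_image_projectivization_mk (n := n) (U := Metric.ball v r)
        Metric.isOpen_ball).mem_nhds ⟨v, hv, Metric.mem_ball_self hr, hvp⟩)
    filter_upwards [h1, hU.mem_nhds hpU] with x hx hxU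
    obtain ⟨w, hw, hwb, hwx⟩ := hx
    have hxH : Projectivization.mk ℝ w hw ∈ H := by
      rw [hwx]
      exact (he ▸ mem_image_of_mem c.2 hxU : c.2 x ∈ O ∩ H).2
    refine ⟨⟨w, hwb, (hiff w hw (hball hwb).2).1 hxH⟩, ?_⟩
    change j (Projectivization.mk ℝ w _) = x
    rw [hwx, hj x (hUs hxU).2]
  · rintro _ ⟨w, rfl⟩
    obtain ⟨x, hxU, hx⟩ := hKimg w w.2
    change j (Projectivization.mk ℝ w.1 _) ∈ U₀
    rw [← hx, hj x (hUs hxU).2]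
    exact (hUs hxU).1

end ProjectiveSpace

end RadiantAffine

namespace RadiantAffine

/-! ### The suspension and its affine diffeomorphisms -/

/-- The homeomorphism `(x, t) ↦ (h x, t + f x)`. -/
def skewHomeomorph {E : Type*} [TopologicalSpace E] (h : E ≃ₜ E) (f : E → ℝ) (hf : Continuous f) :
    E × ℝ ≃ₜ E × ℝ where
  toFun z := (h z.1, z.2 + f z.1)
  invFun z := (h.symm z.1, z.2 - f (h.symm z.1))
  left_inv z := by simp
  right_inv z := by simp
  continuous_toFun := by fun_prop
  continuous_invFun := by fun_prop

/-- The homeomorphisms of a flow. -/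
def flowHomeomorph {X : Type*} [TopologicalSpace X] (Ψ : Flow ℝ X) (t : ℝ) : X ≃ₜ X where
  toFun := Ψ t
  invFun := Ψ (-t)
  left_inv x := by rw [← Ψ.map_add]; simp
  right_inv x := by rw [← Ψ.map_add]; simp
  continuous_toFun := Ψ.continuous_toFun t
  continuous_invFun := Ψ.continuous_toFun (-t)

/-- Let `v ∈ I` have eigenvalue `μ` and let `w` not be a multiple of `v`. For small `t ≠ 0` the
vector `v + t w` is an eigenvector, which makes `L w - μ w` a multiple of `v + t w`. Two different
`t` give two independent vectors, so `L w = μ w`. -/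
lemma exists_smul_of_forall_mem_isOpen {n : ℕ} {I : Set (Vec n)} (hI : IsOpen I)
    (hne : I.Nonempty) (h0 : (0 : Vec n) ∉ I) {L : Vec n →ₗ[ℝ] Vec n}
    (h : ∀ v ∈ I, ∃ μ : ℝ, L v = μ • v) : ∃ μ : ℝ, ∀ v, L v = μ • v := by
  obtain ⟨v, hv⟩ := hne
  obtain ⟨μ, hμ⟩ := h v hv
  have hv0 : v ≠ 0 := fun e => h0 (e ▸ hv)
  refine ⟨μ, fun w => ?_⟩
  by_contra hw
  have hcol : ∀ b : ℝ, w ≠ b • v := by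
    rintro b rfl
    exact hw (by rw [map_smul, hμ, smul_comm])
  have hc : Tendsto (fun t : ℝ => v + t • w) (𝓝 0) (𝓝 v) := by
    have : Continuous fun t : ℝ => v + t • w := by fun_prop
    simpa using this.tendsto 0
  obtain ⟨δ, hδ, hball⟩ := Metric.mem_nhds_iff.1 (hc.eventually (hI.mem_nhds hv))
  have hform : ∀ t : ℝ, t ∈ Metric.ball (0 : ℝ) δ → t ≠ 0 →
      ∃ ν : ℝ, L w - μ • w = ν • (v + t • w) := by
    intro t ht ht0
    obtain ⟨κ, hκ⟩ := h _ (hball ht)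
    refine ⟨t⁻¹ * (κ - μ), ?_⟩
    have e : t • (L w - μ • w) = (κ - μ) • (v + t • w) := by
      rw [map_add, map_smul, hμ] at hκ
      rw [sub_smul, ← hκ]
      module
    rw [mul_smul, ← e, smul_smul, inv_mul_cancel₀ ht0, one_smul]
  -- Any two distinct nonzero times below `δ` would do.
  obtain ⟨ν₁, h₁⟩ := hform (δ / 2) (by
    rw [Metric.mem_ball, Real.dist_eq, sub_zero, abs_of_pos (by positivity)]; linarith)
    (by positivity)
  obtain ⟨ν₂, h₂⟩ := hform (δ / 3) (by
    rw [Metric.mem_ball, Real.dist_eq, sub_zero, abs_of_pos (by positivity)]; linarith)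
    (by positivity)
  have e : (ν₁ - ν₂) • v = (ν₂ * (δ / 3) - ν₁ * (δ / 2)) • w := by
    have := h₁.symm.trans h₂
    have e1 : (ν₁ - ν₂) • v - (ν₂ * (δ / 3) - ν₁ * (δ / 2)) • w
        = ν₁ • (v + (δ / 2) • w) - ν₂ • (v + (δ / 3) • w) := by module
    rw [this, sub_self, sub_eq_zero] at e1
    exact e1
  by_cases hk : ν₂ * (δ / 3) - ν₁ * (δ / 2) = 0
  · rw [hk, zero_smul, smul_eq_zero, or_iff_left hv0] at e
    have hν : ν₁ = 0 := by
      have : ν₁ * (δ / 6) = 0 := by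
        have e2 : ν₂ = ν₁ := by linarith
        rw [e2] at hk
        linarith
      exact (mul_eq_zero.1 this).resolve_right (by positivity)
    rw [hν, zero_smul, sub_eq_zero] at h₁
    exact hw h₁
  · refine hcol ((ν₂ * (δ / 3) - ν₁ * (δ / 2))⁻¹ * (ν₁ - ν₂)) ?_
    rw [mul_smul, e, smul_smul, inv_mul_cancel₀ hk, one_smul]

namespace SuspensionData

variable {n : ℕ} {N : Type*} [TopologicalSpace N] {B : ProjectiveAtlas n N}
  {E : Type*} [TopologicalSpace E] [SimplyConnectedSpace E] (D : SuspensionData B E)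

lemma norm_dev (x : E) : ‖(D.dev x : Vec n)‖ = 1 := by
  simp

lemma dev_ne_zero (x : E) : (D.dev x : Vec n) ≠ 0 := by
  rw [← norm_ne_zero_iff, D.norm_dev]
  exact one_ne_zero

lemma norm_apply_dev_pos (g : GLn n) (x : E) : 0 < ‖g (D.dev x)‖ :=
  norm_pos_iff.2 ((map_ne_zero_iff g g.injective).2 (D.dev_ne_zero x))

lemma affineDev_ne_zero (z : E × ℝ) : D.affineDev z ≠ 0 :=
  smul_ne_zero (Real.exp_pos _).ne' (D.dev_ne_zero _)

lemma norm_affineDev (z : E × ℝ) : ‖D.affineDev z‖ = Real.exp z.2 := by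
  rw [affineDev, norm_smul, D.norm_dev, mul_one, Real.norm_of_nonneg (Real.exp_pos _).le]

lemma affineDev_eq_of_dev_eq {x y : E} {g : GLn n}
    (h : (D.dev y : Vec n) = ‖g (D.dev x)‖⁻¹ • g (D.dev x)) (t : ℝ) :
    D.affineDev (y, t + Real.log ‖g (D.dev x)‖) = g (D.affineDev (x, t)) := by
  simp only [affineDev, h, map_smul, smul_smul]
  rw [Real.exp_add, Real.exp_log (D.norm_apply_dev_pos g x), mul_assoc,
    mul_inv_cancel₀ (D.norm_apply_dev_pos g x).ne', mul_one]

lemma continuous_log_norm (g : GLn n) : Continuous fun x : E => Real.log ‖g (D.dev x)‖ := by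
  have h1 : Continuous fun x : E => g (D.dev x : Vec n) :=
    g.toLinearMap.continuous_of_finiteDimensional.comp
      (continuous_subtype_val.comp D.dev.continuous)
  exact h1.norm.log fun x => (D.norm_apply_dev_pos g x).ne'

/-- The quotient is taken by the relation of the generators alone. Induction over the equivalence
relation that they generate produces a group element `T` together with its linear holonomy `g`. -/
lemma exists_homeomorph_of_proj_eq {z z' : E × ℝ} (h : D.proj z = D.proj z') :
    ∃ (T : E × ℝ ≃ₜ E × ℝ) (g : GLn n), T z = z' ∧
      ∀ w, D.proj (T w) = D.proj w ∧ D.affineDev (T w) = g (D.affineDev w) := by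
  induction Quot.eqvGen_exact h with
  | rel z z' hs =>
    cases hs with
    | deck γ x t =>
      exact ⟨skewHomeomorph (γ : E ≃ₜ E) _ (D.continuous_log_norm (D.hol γ)), D.hol γ, rfl,
        fun w => ⟨(Quot.sound (Step.deck γ w.1 w.2)).symm,
          D.affineDev_eq_of_dev_eq (D.dev_hol γ w.1) w.2⟩⟩
    | auto x t =>
      exact ⟨skewHomeomorph D.φLift _ (D.continuous_log_norm D.ρ), D.ρ, rfl,
        fun w => ⟨(Quot.sound (Step.auto w.1 w.2)).symm,
          D.affineDev_eq_of_dev_eq (D.dev_φLift w.1) w.2⟩⟩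
  | refl z => exact ⟨Homeomorph.refl _, 1, rfl, fun w => ⟨rfl, rfl⟩⟩
  | symm z z' hzz ih =>
    obtain ⟨T, g, hT, hTw⟩ := ih (Quot.eqvGen_sound hzz)
    refine ⟨T.symm, g⁻¹, by rw [← hT, T.symm_apply_apply], fun w => ⟨?_, ?_⟩⟩
    · rw [← (hTw (T.symm w)).1, T.apply_symm_apply]
    · have := (hTw (T.symm w)).2
      rw [T.apply_symm_apply] at this
      rw [this]
      exact (g.symm_apply_apply _).symm
  | trans z z' z'' h1 h2 ih1 ih2 =>
    obtain ⟨T, g, hT, hTw⟩ := ih1 (Quot.eqvGen_sound h1)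
    obtain ⟨T', g', hT', hTw'⟩ := ih2 (Quot.eqvGen_sound h2)
    refine ⟨T.trans T', g' * g, by simp [hT, hT'], fun w => ⟨?_, ?_⟩⟩
    · exact (hTw' (T w)).1.trans (hTw w).1
    · exact (hTw' (T w)).2.trans (congrArg g' (hTw w).2)

lemma isOpenQuotientMap_proj : IsOpenQuotientMap D.proj := by
  refine ⟨Quot.exists_rep, continuous_quot_mk, fun U hU => ?_⟩
  refine isOpen_coinduced.2 (isOpen_iff_mem_nhds.2 ?_)
  rintro z' ⟨z, hz, he⟩
  obtain ⟨T, g, hT, hTw⟩ := D.exists_homeomorph_of_proj_eq he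
  have h1 : T '' U ∈ 𝓝 z' := (T.isOpenMap U hU).mem_nhds ⟨z, hz, hT⟩
  filter_upwards [h1]
  rintro _ ⟨w, hw, rfl⟩
  exact ⟨w, hw, (hTw w).1.symm⟩

/-- The time `s` map of the radial flow of the suspension. -/
def scaleFun (s : ℝ) : D.Space → D.Space :=
  Quot.map (fun z : E × ℝ => (z.1, z.2 + s)) (by
    rintro _ _ (⟨γ, x, t⟩ | ⟨x, t⟩)
    · rw [show t + Real.log ‖D.hol γ (D.dev x)‖ + s = t + s + Real.log ‖D.hol γ (D.dev x)‖ by ring]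
      exact Step.deck γ x (t + s)
    · rw [show t + Real.log ‖D.ρ (D.dev x)‖ + s = t + s + Real.log ‖D.ρ (D.dev x)‖ by ring]
      exact Step.auto x (t + s))

lemma continuous_scaleFun (s : ℝ) : Continuous (D.scaleFun s) := by
  rw [← D.isOpenQuotientMap_proj.continuous_comp_iff]
  exact D.isOpenQuotientMap_proj.continuous.comp (by fun_prop :
    Continuous fun z : E × ℝ => (z.1, z.2 + s))

/-- The radial flow of the suspension, as homeomorphisms. -/
def scale (s : ℝ) : D.Space ≃ₜ D.Space where
  toFun := D.scaleFun s
  invFun := D.scaleFun (-s)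
  left_inv := by rintro ⟨z⟩; change D.proj _ = D.proj _; simp
  right_inv := by rintro ⟨z⟩; change D.proj _ = D.proj _; simp
  continuous_toFun := D.continuous_scaleFun s
  continuous_invFun := D.continuous_scaleFun (-s)

variable {M : Type*} [TopologicalSpace M] {A : RadiantAtlas n M} {F : D.Space ≃ₜ M}

lemma map_nhds_proj (F : D.Space ≃ₜ M) (z : E × ℝ) :
    map (fun w => F (D.proj w)) (𝓝 z) = 𝓝 (F (D.proj z)) := by
  have := D.isOpenQuotientMap_proj.map_nhds_eq z
  rw [← F.map_nhds_eq, ← this]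
  rfl

/-- A homeomorphism from the suspension which is locally linear. -/
def IsLinearDiffeo (A : RadiantAtlas n M) (F : D.Space ≃ₜ M) : Prop :=
  ∀ z : E × ℝ, ∀ c ∈ A.charts, F (D.proj z) ∈ c.1 →
    ∃ g : GLn n, ∀ᶠ w in 𝓝 z, c.2 (F (D.proj w)) = g (D.affineDev w)

variable {D}

lemma IsLinearDiffeo.isAffineDiffeo (hF : D.IsLinearDiffeo A F) : D.IsAffineDiffeo A F := by
  intro z c hc hz
  obtain ⟨g, hg⟩ := hF z c hc hz
  exact ⟨g.toAffineEquiv, hg⟩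

/-- The open set is found in a chart of `M`, inside the model if the point lies on the boundary, and
is carried back through the affine germ `α`. -/
lemma IsAffineDiffeo.exists_isOpen_subset_image (hF : D.IsAffineDiffeo A F) {z : E × ℝ}
    {U : Set (E × ℝ)} (hU : U ∈ 𝓝 z) :
    ∃ I : Set (Vec n), IsOpen I ∧ I.Nonempty ∧ I ⊆ D.affineDev '' U := by
  obtain ⟨c, hc, hz⟩ := A.covers (F (D.proj z))
  obtain ⟨α, hα⟩ := hF z c hc hz
  have h1 : (fun w => F (D.proj w)) '' (U ∩ {w | c.2 (F (D.proj w)) = α (D.affineDev w)}) ∈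
      𝓝 (F (D.proj z)) := by
    rw [← D.map_nhds_proj F z]
    exact image_mem_map (inter_mem hU hα)
  obtain ⟨V, hVs, hV, hzV⟩ := mem_nhds_iff.1 (inter_mem h1 (A.source_mem_nhds hc hz))
  obtain ⟨H, hH, O, hO, he⟩ := A.exists_image_eq hc hV (fun x hx => (hVs hx).2)
  have hne := interior_inter_linearModel_nonempty hH hO (he ▸ mem_image_of_mem c.2 hzV)
  refine ⟨α ⁻¹' interior (O ∩ H), isOpen_interior.preimage
    α.toAffineMap.continuous_of_finiteDimensional, hne.preimage α.surjective, fun v hv => ?_⟩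
  have hv' : α v ∈ c.2 '' V := he ▸ interior_subset hv
  obtain ⟨x, hx, hxv⟩ := hv'
  obtain ⟨⟨w, ⟨hwU, hw⟩, rfl⟩, -⟩ := hVs hx
  exact ⟨w, hwU, α.injective (by rw [← hxv]; exact hw.symm)⟩

lemma IsAffineDiffeo.affineMap_eq (hF : D.IsAffineDiffeo A F) {z : E × ℝ}
    {f g : Vec n →ᵃ[ℝ] Vec n} (h : ∀ᶠ w in 𝓝 z, f (D.affineDev w) = g (D.affineDev w)) :
    f = g := by
  obtain ⟨I, hI, hne, hs⟩ := hF.exists_isOpen_subset_image h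
  refine affineMap_eq_of_eqOn_isOpen hI hne fun v hv => ?_
  obtain ⟨w, hw, rfl⟩ := hs hv
  exact hw

lemma IsAffineDiffeo.affineEquiv_eq (hF : D.IsAffineDiffeo A F) {z : E × ℝ}
    {f g : Vec n ≃ᵃ[ℝ] Vec n} (h : ∀ᶠ w in 𝓝 z, f (D.affineDev w) = g (D.affineDev w)) :
    f = g :=
  AffineEquiv.toAffineMap_injective (hF.affineMap_eq (f := f.toAffineMap) (g := g.toAffineMap) h)

variable (D A F) in
/-- `α` expresses the chart `c` in terms of `affineDev` near `z`. -/
def IsGermAt (c : Set M × (M → Vec n)) (z : E × ℝ) (α : Vec n ≃ᵃ[ℝ] Vec n) : Prop :=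
  c ∈ A.charts ∧ F (D.proj z) ∈ c.1 ∧ ∀ᶠ w in 𝓝 z, c.2 (F (D.proj w)) = α (D.affineDev w)

lemma IsGermAt.eventually {c : Set M × (M → Vec n)} {z : E × ℝ} {α : Vec n ≃ᵃ[ℝ] Vec n}
    (h : IsGermAt D A F c z α) : ∀ᶠ w in 𝓝 z, IsGermAt D A F c w α := by
  have hcont : Continuous fun w => F (D.proj w) :=
    F.continuous.comp D.isOpenQuotientMap_proj.continuous
  filter_upwards [h.2.2.eventually_nhds,
    hcont.continuousAt.eventually (A.source_mem_nhds h.1 h.2.1)] with w hw hwc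
  exact ⟨h.1, hwc, hw⟩

variable (D A F) in
open Classical in
/-- The parallel field by which the radiant field of `M` differs from that of the suspension. -/
noncomputable def translationField (c : Set M × (M → Vec n)) (p : M) : Vec n :=
  if h : ∃ α : Vec n ≃ᵃ[ℝ] Vec n, ∃ z, F (D.proj z) = p ∧ IsGermAt D A F c z α then h.choose 0
  else 0

/-- Two preimages of a point differ by a group element whose holonomy is linear. It fixes the
origin, so the value `α 0` does not depend on the preimage or on the germ chosen. -/
lemma IsAffineDiffeo.translationField_eq (hF : D.IsAffineDiffeo A F) {c : Set M × (M → Vec n)}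
    {z : E × ℝ} {α : Vec n ≃ᵃ[ℝ] Vec n} (h : IsGermAt D A F c z α) :
    translationField D A F c (F (D.proj z)) = α 0 := by
  have hex : ∃ α : Vec n ≃ᵃ[ℝ] Vec n, ∃ z', F (D.proj z') = F (D.proj z) ∧ IsGermAt D A F c z' α :=
    ⟨α, z, rfl, h⟩
  rw [translationField, dif_pos hex]
  obtain ⟨z', hz', -, -, hα'⟩ := hex.choose_spec
  set α' := hex.choose
  obtain ⟨T, g, hT, hTw⟩ := D.exists_homeomorph_of_proj_eq (F.injective hz')
  have : α' = g.toAffineEquiv.trans α := by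
    refine hF.affineEquiv_eq (z := z') ?_
    have hlim : Tendsto T (𝓝 z') (𝓝 z) := hT ▸ T.continuous.tendsto z'
    filter_upwards [hα', hlim.eventually h.2.2] with w hw hw2
    rw [← hw, ← (hTw w).1, hw2, (hTw w).2]
    rfl
  rw [this]
  simp

lemma IsAffineDiffeo.exists_isGermAt (hF : D.IsAffineDiffeo A F) {c : Set M × (M → Vec n)}
    (hc : c ∈ A.charts) {z : E × ℝ} (hz : F (D.proj z) ∈ c.1) : ∃ α, IsGermAt D A F c z α := by
  obtain ⟨α, hα⟩ := hF z c hc hz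
  exact ⟨α, hc, hz, hα⟩

lemma IsAffineDiffeo.isGermAt_trans (hF : D.IsAffineDiffeo A F) {c c' : Set M × (M → Vec n)}
    {z : E × ℝ} {α α' : Vec n ≃ᵃ[ℝ] Vec n} (h : IsGermAt D A F c z α)
    (h' : IsGermAt D A F c' z α') {g : GLn n}
    (hg : ∀ᶠ x in 𝓝 (F (D.proj z)), c'.2 x = g (c.2 x)) : α' = α.trans g.toAffineEquiv := by
  refine hF.affineEquiv_eq (z := z) ?_
  rw [← D.map_nhds_proj F z, eventually_map] at hg
  filter_upwards [h.2.2, h'.2.2, hg] with w h1 h2 h3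
  rw [← h2, h3, h1]
  rfl

lemma IsAffineDiffeo.isParallelField (hF : D.IsAffineDiffeo A F) :
    IsParallelField A (translationField D A F) := by
  constructor
  · intro c hc p hp
    obtain ⟨z, rfl⟩ := (F.surjective.comp D.isOpenQuotientMap_proj.surjective) p
    obtain ⟨α, hα⟩ := hF.exists_isGermAt hc hp
    change ∀ᶠ x in 𝓝 (F (D.proj z)), _
    rw [← D.map_nhds_proj F z, eventually_map]
    filter_upwards [hα.eventually] with w hw
    rw [hF.translationField_eq hw]
    exact (hF.translationField_eq hα).symm
  · intro c hc c' hc' p hp hp' g hg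
    obtain ⟨z, rfl⟩ := (F.surjective.comp D.isOpenQuotientMap_proj.surjective) p
    obtain ⟨α, hα⟩ := hF.exists_isGermAt hc hp
    obtain ⟨α', hα'⟩ := hF.exists_isGermAt hc' hp'
    have h1 := hF.translationField_eq hα
    have h2 := hF.translationField_eq hα'
    change translationField D A F c' (F (D.proj z)) = g (translationField D A F c (F (D.proj z)))
    rw [h1, h2, hF.isGermAt_trans hα hα' hg]
    rfl

/-- Pulled back to the developed image, the parallel field is a locally constant vector. Only its
constancy along the line `{x} × ℝ` is needed, to compare a point with its image under `scale`. -/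
lemma IsAffineDiffeo.linear_symm_eq (hF : D.IsAffineDiffeo A F) {c c' : Set M × (M → Vec n)}
    {x : E} {s t : ℝ} {α α' : Vec n ≃ᵃ[ℝ] Vec n} (h : IsGermAt D A F c (x, s) α)
    (h' : IsGermAt D A F c' (x, t) α') : α.linear.symm (α 0) = α'.linear.symm (α' 0) := by
  have hsame : ∀ {z : E × ℝ} {c c' : Set M × (M → Vec n)} {α α' : Vec n ≃ᵃ[ℝ] Vec n},
      IsGermAt D A F c z α → IsGermAt D A F c' z α' →
      α.linear.symm (α 0) = α'.linear.symm (α' 0) := by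
    intro z c c' α α' h h'
    obtain ⟨g, hg⟩ := exists_transition A h.1 h'.1 h.2.1 h'.2.1
    rw [hF.isGermAt_trans h h' hg, LinearEquiv.eq_symm_apply]
    change g (α.linear (α.linear.symm (α 0))) = g (α 0)
    rw [LinearEquiv.apply_symm_apply]
  have hex : ∀ r : ℝ, ∃ (c : Set M × (M → Vec n)) (α : Vec n ≃ᵃ[ℝ] Vec n),
      IsGermAt D A F c (x, r) α := by
    intro r
    obtain ⟨c, hc, hz⟩ := A.covers (F (D.proj (x, r)))
    obtain ⟨α, hα⟩ := hF.exists_isGermAt hc hz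
    exact ⟨c, α, hα⟩
  choose k β hβ using hex
  have hloc : IsLocallyConstant fun r : ℝ => (β r).linear.symm (β r 0) := by
    refine IsLocallyConstant.iff_eventually_eq _ |>.2 fun r => ?_
    have hlim : Tendsto (fun r' : ℝ => (x, r')) (𝓝 r) (𝓝 (x, r)) := by
      have : Continuous fun r' : ℝ => (x, r') := by fun_prop
      exact this.tendsto r
    filter_upwards [hlim.eventually (hβ r).eventually] with r' hr'
    exact hsame (hβ r') hr'
  rw [hsame h (hβ s), hsame h' (hβ t)]
  exact hloc.apply_eq_of_preconnectedSpace s t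

/-- An affine diffeomorphism from the suspension can be corrected by an affine automorphism of `M`
so as to preserve the radiant vector fields. -/
theorem IsAffineDiffeo.exists_isLinearDiffeo [T2Space M] [CompactSpace M]
    (hF : D.IsAffineDiffeo A F) : ∃ F' : D.Space ≃ₜ M, D.IsLinearDiffeo A F' := by
  obtain ⟨Ψ, hΨ⟩ := exists_isRadialFlow A
  have hV := hF.isParallelField
  set V := translationField D A F with hVdef
  -- Suppose that `F` reads `v ↦ L v + u` in a chart. Flowing in `M` halves the chart vector `y`,
  -- and flowing in the suspension doubles its distance from `u`; up to linear maps the result is `2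
  -- (y / 2 - u) + u = y - u`. The factor must be `2`: a factor `k` would subtract `(k - 1) u`.
  refine ⟨F.trans ((flowHomeomorph Ψ (-Real.log 2)).trans
    (F.symm.trans ((D.scale (Real.log 2)).trans F))), ?_⟩
  intro z c' hc' hz'
  set p := F (D.proj z) with hp
  set p₁ := Ψ (-Real.log 2) p with hp₁
  obtain ⟨⟨x, t⟩, hz₁⟩ := (F.surjective.comp D.isOpenQuotientMap_proj.surjective) p₁
  replace hz₁ : F (D.proj (x, t)) = p₁ := hz₁
  obtain ⟨c, hc, hpc⟩ := A.covers p
  obtain ⟨c₁, hc₁, hpc₁⟩ := A.covers p₁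
  obtain ⟨g, hg, hgV⟩ := hΨ.exists_germ hV hc hpc (-Real.log 2) hc₁ hpc₁
  obtain ⟨α, hα⟩ := hF.exists_isGermAt hc hpc
  obtain ⟨α₁, hα₁⟩ := hF.exists_isGermAt (z := (x, t)) hc₁ (hz₁ ▸ hpc₁)
  have hz'' : F (D.proj (x, t + Real.log 2)) ∈ c'.1 := by
    have : F (D.scale (Real.log 2) (F.symm p₁)) ∈ c'.1 := hz'
    rwa [← hz₁, F.symm_apply_apply] at this
  obtain ⟨α₂, hα₂⟩ := hF.exists_isGermAt hc' hz''
  -- The translation vector is the same before and after scaling, so that scaling in the suspension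
  -- is scaling about this vector in `M`.
  have hu := hF.linear_symm_eq hα₁ hα₂
  have hV1 := hF.translationField_eq hα
  have hV2 := hF.translationField_eq hα₁
  rw [hz₁] at hV2
  have hexp : Real.exp (-Real.log 2) = 1 / 2 := by
    rw [Real.exp_neg, Real.exp_log two_pos, one_div]
  refine ⟨((α.linear.trans g).trans α₁.linear.symm).trans α₂.linear, ?_⟩
  have hscale : ∀ᶠ y in 𝓝 p₁, c'.2 (F (D.scale (Real.log 2) (F.symm y))) =
      α₂.linear (α₁.linear.symm ((2 : ℝ) • c₁.2 y - V c₁ p₁)) := by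
    rw [← hz₁, ← D.map_nhds_proj F (x, t), eventually_map]
    have hlim : Tendsto (fun w : E × ℝ => (w.1, w.2 + Real.log 2)) (𝓝 (x, t))
        (𝓝 (x, t + Real.log 2)) := by
      have : Continuous fun w : E × ℝ => (w.1, w.2 + Real.log 2) := by fun_prop
      exact this.tendsto (x, t)
    filter_upwards [hα₁.2.2, hlim.eventually hα₂.2.2] with w hw hw2
    rw [F.symm_apply_apply]
    change c'.2 (F (D.proj (w.1, w.2 + Real.log 2))) = _
    rw [hw2, hw, hz₁, hVdef, hV2]
    have e1 : D.affineDev (w.1, w.2 + Real.log 2) = (2 : ℝ) • D.affineDev w := by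
      simp only [affineDev, Real.exp_add, Real.exp_log two_pos, smul_smul, mul_comm]
    have e2 : ∀ (β : Vec n ≃ᵃ[ℝ] Vec n) (v : Vec n), β v = β.linear v + β 0 := by
      intro β v
      simpa using β.map_vadd 0 v
    have e3 : α₂ 0 = α₂.linear (α₁.linear.symm (α₁ 0)) := by
      rw [hu, LinearEquiv.apply_symm_apply]
    rw [e1, e2 α₂, e3, e2 α₁ (D.affineDev w), ← map_add]
    congr 1
    rw [LinearEquiv.eq_symm_apply, map_add, LinearEquiv.apply_symm_apply, map_smul]
    module
  have hpush : Tendsto (fun w => Ψ (-Real.log 2) (F (D.proj w))) (𝓝 z) (𝓝 p₁) := by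
    have : Continuous fun w => Ψ (-Real.log 2) (F (D.proj w)) :=
      (Ψ.continuous_toFun _).comp (F.continuous.comp D.isOpenQuotientMap_proj.continuous)
    exact this.tendsto z
  have hFz : Tendsto (fun w => (-Real.log 2, F (D.proj w))) (𝓝 z) (𝓝 (-Real.log 2, p)) := by
    have : Continuous fun w => (-Real.log 2, F (D.proj w)) :=
      continuous_const.prodMk (F.continuous.comp D.isOpenQuotientMap_proj.continuous)
    exact this.tendsto z
  filter_upwards [hpush.eventually hscale, hFz.eventually hg, hα.2.2] with w h1 h2 h3
  change c'.2 (F (D.scale (Real.log 2) (F.symm (Ψ (-Real.log 2) (F (D.proj w)))))) = _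
  rw [h1]
  change α₂.linear (α₁.linear.symm _) = α₂.linear (α₁.linear.symm (g (α.linear (D.affineDev w))))
  congr 2
  have h2' : c₁.2 (Ψ (-Real.log 2) (F (D.proj w))) =
    g (Real.exp (-Real.log 2) • c.2 (F (D.proj w))) := h2
  have hgV' : V c₁ p₁ = g (V c p) := hgV
  rw [h2', hgV', hexp, ← map_smul, ← map_sub, smul_smul, h3]
  congr 1
  have e2 : α (D.affineDev w) = α.linear (D.affineDev w) + α 0 := by
    simpa using α.map_vadd 0 (D.affineDev w)
  rw [show V c p = α 0 from hV1, e2]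
  module

end SuspensionData

end RadiantAffine

namespace RadiantAffine

/-! ### The base of a suspension as a total cross-section -/

namespace SuspensionData

variable {n : ℕ} {N : Type*} [TopologicalSpace N] {B : ProjectiveAtlas n N}
  {E : Type*} [TopologicalSpace E] [SimplyConnectedSpace E] {D : SuspensionData B E}
  {M : Type*} [TopologicalSpace M] {A : RadiantAtlas n M} {F : D.Space ≃ₜ M}

lemma log_norm_of_dev_eq {x y : E} {a : GLn n}
    (h : (D.dev y : Vec n) = ‖a (D.dev x)‖⁻¹ • a (D.dev x)) (g : GLn n) :
    Real.log ‖g (D.dev y)‖ = Real.log ‖g (a (D.dev x))‖ - Real.log ‖a (D.dev x)‖ := by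
  have h1 := D.norm_apply_dev_pos a x
  have h2 : 0 < ‖g (a (D.dev x))‖ := D.norm_apply_dev_pos (g * a) x
  rw [h, map_smul, norm_smul, norm_inv, norm_norm, Real.log_mul (inv_pos.2 h1).ne' h2.ne',
    Real.log_inv]
  ring

/-- The determinant condition makes the lift of the holonomy equivariant. -/
lemma IsAffineDiffeo.hol_conj (hF : D.IsAffineDiffeo A F) {γ γ' : deckGroup D.q}
    (h : ∀ x, (γ' : E ≃ₜ E) (D.φLift x) = D.φLift ((γ : E ≃ₜ E) x)) (v : Vec n) :
    D.hol γ' (D.ρ v) = D.ρ (D.hol γ v) := by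
  -- `L` measures the failure of `hol γ'` to be the conjugate of `hol γ` by `ρ`. As both sides lift
  -- the same projective map on the image of `dev`, it is a scalar there, and the determinants then
  -- show that the scalar is one.
  set L : GLn n := (D.hol γ' * D.ρ)⁻¹ * (D.ρ * D.hol γ) with hL
  have hLapp : ∀ v, D.hol γ' (D.ρ (L v)) = D.ρ (D.hol γ v) := fun v => by
    have : (D.hol γ' * D.ρ) * L = D.ρ * D.hol γ := by rw [hL, mul_inv_cancel_left]
    exact congrArg (fun g : GLn n => g v) this
  have hdir : ∀ x : E, ∃ μ : ℝ, 0 < μ ∧ L (D.dev x) = μ • (D.dev x : Vec n) := by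
    intro x
    have e1 := D.dev_hol γ' (D.φLift x)
    have e2 := D.dev_φLift ((γ : E ≃ₜ E) x)
    rw [h x] at e1
    have e3 := e1.symm.trans e2
    have hp : ∀ g a : GLn n, ∃ r : ℝ, 0 < r ∧
        ‖g (‖a (D.dev x)‖⁻¹ • a (D.dev x))‖⁻¹ • g (‖a (D.dev x)‖⁻¹ • a (D.dev x)) =
          r • g (a (D.dev x)) := by
      intro g a
      have h1 := D.norm_apply_dev_pos a x
      have h2 : 0 < ‖g (a (D.dev x))‖ := D.norm_apply_dev_pos (g * a) x
      refine ⟨‖g (‖a (D.dev x)‖⁻¹ • a (D.dev x))‖⁻¹ * ‖a (D.dev x)‖⁻¹, ?_, ?_⟩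
      · rw [map_smul, norm_smul, norm_inv, norm_norm]
        exact mul_pos (inv_pos.2 (mul_pos (inv_pos.2 h1) h2)) (inv_pos.2 h1)
      · rw [mul_smul]
        exact congrArg _ (map_smul g _ _)
    obtain ⟨r₁, p1, hr₁⟩ := hp (D.hol γ') D.ρ
    obtain ⟨r₂, p2, hr₂⟩ := hp D.ρ (D.hol γ)
    rw [D.dev_hol γ x, D.dev_φLift x, hr₁, hr₂] at e3
    refine ⟨r₂⁻¹ * r₁, by positivity, ?_⟩
    apply D.ρ.injective
    apply (D.hol γ').injective
    rw [hLapp, map_smul, map_smul, mul_smul, e3, smul_smul, inv_mul_cancel₀ p2.ne', one_smul]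
  obtain ⟨x₀⟩ : Nonempty E := inferInstance
  obtain ⟨I, hI, hne, hIs⟩ := hF.exists_isOpen_subset_image (z := (x₀, 0)) (U := univ) univ_mem
  obtain ⟨μ, hμ⟩ := exists_smul_of_forall_mem_isOpen hI hne (L := L.toLinearMap) (by
      intro h0
      obtain ⟨w, -, hw⟩ := hIs h0
      exact D.affineDev_ne_zero w hw) (by
      intro v hv
      obtain ⟨w, -, rfl⟩ := hIs hv
      obtain ⟨μ, -, hμ⟩ := hdir w.1
      refine ⟨μ, ?_⟩
      change L (D.affineDev w) = _
      rw [affineDev, map_smul, hμ, smul_comm])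
  have hμpos : 0 < μ := by
    obtain ⟨κ, hκ, hκx⟩ := hdir x₀
    have := (hμ (D.dev x₀)).symm.trans hκx
    rwa [smul_left_injective ℝ (D.dev_ne_zero x₀) this]
  -- The scalar will be recovered from its `n`-th power; the existence of a unit vector excludes `n
  -- = 0`.
  have hn : n ≠ 0 := by
    rintro rfl
    exact D.dev_ne_zero x₀ (Subsingleton.elim _ _)
  have hmap : D.ρ.toLinearMap ∘ₗ (D.hol γ).toLinearMap =
      μ • ((D.hol γ').toLinearMap ∘ₗ D.ρ.toLinearMap) := by
    ext1 v
    have e : L v = μ • v := hμ v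
    change D.ρ (D.hol γ v) = μ • (D.hol γ' (D.ρ v))
    rw [← hLapp, e, map_smul, map_smul]
  have hμ1 : μ = 1 := by
    have hdet := congrArg (fun f : Vec n →ₗ[ℝ] Vec n => |LinearMap.det f|) hmap
    simp only [LinearMap.det_smul, LinearMap.det_comp, abs_mul, abs_pow, finrank_euclideanSpace,
      Fintype.card_fin] at hdet
    have e := D.det_invariant γ γ' h
    have p1 : 0 < |LinearMap.det D.ρ.toLinearMap| := abs_pos.2 D.ρ.isUnit_det'.ne_zero
    have p2 : 0 < |LinearMap.det (D.hol γ).toLinearMap| :=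
      abs_pos.2 (D.hol γ).isUnit_det'.ne_zero
    rw [e] at hdet
    have h1 : |μ| ^ n = 1 := by
      have : (|μ| ^ n - 1) * (|LinearMap.det D.ρ.toLinearMap| *
          |LinearMap.det (D.hol γ).toLinearMap|) = 0 := by
        rw [sub_mul, one_mul]
        nth_rewrite 2 [hdet]
        ring
      have := (mul_eq_zero.1 this).resolve_right (mul_pos p1 p2).ne'
      linarith
    rw [abs_of_pos hμpos] at h1
    exact (pow_eq_one_iff_of_nonneg hμpos.le hn).1 h1
  rw [← hLapp v]
  have e : L v = μ • v := hμ v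
  rw [e, hμ1, one_smul]

variable (D) in
/-- The amount by which the section is moved outwards. -/
noncomputable def gap (x : E) : ℝ := D.sec x + Real.log ‖D.ρ (D.dev x)‖ - D.sec (D.φLift x)

lemma gap_pos (x : E) : 0 < D.gap x := by
  have := D.sec_outward x
  rw [gap]
  linarith

lemma continuous_sec : Continuous D.sec := by
  rw [continuous_iff_continuousAt]
  intro x
  obtain ⟨g, hg, he⟩ := D.sec_smooth x
  have h1 : Continuous fun y => g (D.dev y) :=
    hg.continuous.comp (continuous_subtype_val.comp D.dev.continuous)
  exact h1.continuousAt.congr (he.mono fun y hy => hy.symm)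

lemma continuous_gap : Continuous D.gap :=
  (continuous_sec.add (D.continuous_log_norm D.ρ)).sub
    (continuous_sec.comp D.φLift.continuous)

/-- The changes of `sec` and of `log ‖ρ (dev ·)‖` under a deck transformation cancel because `hol γ'
∘ ρ = ρ ∘ hol γ`. Hence the gap is a function on the compact base. -/
lemma IsAffineDiffeo.gap_deck (hF : D.IsAffineDiffeo A F) (γ : deckGroup D.q) (x : E) :
    D.gap ((γ : E ≃ₜ E) x) = D.gap x := by
  let γ' : deckGroup D.q := ⟨(D.φLift.symm.trans (γ : E ≃ₜ E)).trans D.φLift, fun y => by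
    change D.q (D.φLift ((γ : E ≃ₜ E) (D.φLift.symm y))) = D.q y
    rw [D.q_φLift, γ.2, ← D.q_φLift, D.φLift.apply_symm_apply]⟩
  have h : ∀ x, (γ' : E ≃ₜ E) (D.φLift x) = D.φLift ((γ : E ≃ₜ E) x) := fun x => by
    change D.φLift ((γ : E ≃ₜ E) (D.φLift.symm (D.φLift x))) = _
    rw [D.φLift.symm_apply_apply]
  have e1 := D.sec_equivariant γ' (D.φLift x)
  rw [h, log_norm_of_dev_eq (D.dev_φLift x), hF.hol_conj h] at e1
  have e2 := log_norm_of_dev_eq (D.dev_hol γ x) D.ρ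
  have e3 := D.sec_equivariant γ x
  rw [gap, gap, e1, e2, e3]
  ring

lemma locallyPathConnectedSpace (D : SuspensionData B E) : LocallyPathConnectedSpace E :=
  have := ProjectiveAtlas.locallyPathConnectedSpace B
  IsLocalHomeomorph.locallyPathConnectedSpace D.isCoveringMap.isLocalHomeomorph

variable (D) in
/-- The height of a point over the section. -/
def height (z : E × ℝ) : ℝ := z.2 - D.sec z.1

lemma continuous_height : Continuous D.height :=
  continuous_snd.sub (continuous_sec.comp continuous_fst)

/-- A skew product over a homeomorphism moves points by at least the infimum of the step. -/
lemma le_of_zpow_skew {N : Type*} (φ : Equiv.Perm N) {δ : N → ℝ} {δ₀ : ℝ} (hδ : ∀ p, δ₀ ≤ δ p)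
    (P : Equiv.Perm (N × ℝ)) (hP : ∀ z, P z = (φ z.1, z.2 + δ z.1)) (hδ₀ : 0 < δ₀) {k : ℤ}
    {y z : N × ℝ} (h : (P ^ k) y = z) : y = z ∨ δ₀ ≤ |y.2 - z.2| := by
  have hnat : ∀ (m : ℕ) (y : N × ℝ), y.2 + m * δ₀ ≤ ((P ^ m) y).2 := by
    intro m
    induction m with
    | zero => simp
    | succ m ih =>
      intro y
      rw [pow_succ', Equiv.Perm.mul_apply, hP]
      rw [Nat.cast_succ]
      have := ih y
      have := hδ ((P ^ m) y).1
      linarith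
  have hpos : ∀ (m : ℕ) (y : N × ℝ), 0 < m → δ₀ ≤ ((P ^ m) y).2 - y.2 := by
    intro m y hm
    have h1 := hnat m y
    have h2 : (1 : ℝ) ≤ m := by exact_mod_cast hm
    nlinarith
  rcases Int.eq_nat_or_neg k with ⟨m, rfl | rfl⟩
  · rcases m.eq_zero_or_pos with rfl | hm
    · exact Or.inl (by simpa using h)
    · right
      rw [zpow_natCast] at h
      rw [abs_sub_comm, ← h]
      exact (hpos m y hm).trans (le_abs_self _)
  · rcases m.eq_zero_or_pos with rfl | hm
    · exact Or.inl (by simpa using h)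
    · right
      rw [zpow_neg, zpow_natCast, Equiv.Perm.inv_eq_iff_eq] at h
      rw [h]
      exact (hpos m z hm).trans (le_abs_self _)

/-- Points of the suspension whose heights are close are identified only by deck transformations. -/
lemma IsAffineDiffeo.exists_height_gap [CompactSpace N] (hF : D.IsAffineDiffeo A F) :
    ∃ δ₀ > 0, ∀ z z' : E × ℝ, D.proj z = D.proj z' →
      (D.q z.1 = D.q z'.1 ∧ D.height z = D.height z') ∨ δ₀ ≤ |D.height z - D.height z'| := by
  have := D.locallyPathConnectedSpace
  let s : N → E := Function.surjInv D.surjective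
  have hs : ∀ p, D.q (s p) = p := Function.surjInv_eq D.surjective
  have hgap : ∀ x, D.gap (s (D.q x)) = D.gap x := by
    intro x
    obtain ⟨γ, hγ⟩ := exists_deckGroup_apply_eq D.isCoveringMap (hs (D.q x)).symm
    rw [← hγ, hF.gap_deck]
  have hcont : Continuous fun p => D.gap (s p) := by
    rw [(D.isCoveringMap.isQuotientMap D.surjective).continuous_iff]
    exact continuous_gap.congr fun x => (hgap x).symm
  obtain ⟨x₀⟩ : Nonempty E := inferInstance
  obtain ⟨p₀, -, hp₀⟩ := isCompact_univ.exists_isMinOn ⟨D.q x₀, mem_univ _⟩ hcont.continuousOn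
  refine ⟨D.gap (s p₀), gap_pos _, fun z z' h => ?_⟩
  -- In the coordinates (point of the base, height) deck transformations act trivially and the
  -- automorphism acts as `P`. So identified points differ by a power of `P`.
  let P : Equiv.Perm (N × ℝ) :=
    { toFun := fun y => (D.φ y.1, y.2 + D.gap (s y.1))
      invFun := fun y => (D.φ.symm y.1, y.2 - D.gap (s (D.φ.symm y.1)))
      left_inv := fun y => by simp
      right_inv := fun y => by simp }
  have hrel : ∀ z z', Relation.EqvGen D.Step z z' →
      ∃ k : ℤ, (P ^ k) (D.q z.1, D.height z) = (D.q z'.1, D.height z') := by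
    intro z z' h
    induction h with
    | rel z z' h =>
      rcases h with ⟨γ, x, t⟩ | ⟨x, t⟩
      · refine ⟨0, ?_⟩
        simp only [zpow_zero, Equiv.Perm.one_apply, height, D.sec_equivariant, γ.2 x]
        congr 1
        ring
      · refine ⟨1, ?_⟩
        rw [zpow_one]
        change (D.φ (D.q x), D.height (x, t) + D.gap (s (D.q x))) = _
        rw [hgap, D.q_φLift]
        congr 1
        simp only [height, gap]
        ring
    | refl z => exact ⟨0, by simp⟩
    | symm z z' _ ih =>
      obtain ⟨k, hk⟩ := ih
      exact ⟨-k, by rw [zpow_neg, Equiv.Perm.inv_eq_iff_eq, hk]⟩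
    | trans z z' z'' _ _ ih1 ih2 =>
      obtain ⟨k, hk⟩ := ih1
      obtain ⟨l, hl⟩ := ih2
      exact ⟨l + k, by rw [zpow_add, Equiv.Perm.mul_apply, hk, hl]⟩
  obtain ⟨k, hk⟩ := hrel z z' (Quot.eqvGen_exact h)
  rcases le_of_zpow_skew D.φ.toEquiv (δ := fun p => D.gap (s p)) (fun p => hp₀ (mem_univ p)) P
    (fun _ => rfl) (gap_pos _) hk with h | h
  · exact Or.inl ⟨congrArg Prod.fst h, congrArg Prod.snd h⟩
  · exact Or.inr h

variable (D F) in
/-- The image of the section in `M`. -/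
def sectionSet : Set M := range fun x : E => F (D.proj (x, D.sec x))

lemma proj_sec_deck (γ : deckGroup D.q) (x : E) :
    D.proj ((γ : E ≃ₜ E) x, D.sec ((γ : E ≃ₜ E) x)) = D.proj (x, D.sec x) := by
  rw [D.sec_equivariant]
  exact (Quot.sound (Step.deck γ x (D.sec x))).symm

/-- All points of the section have height zero, so by the height gap two of them are identified only
over the same point of `N`. This gives a continuous bijection from a compact space to a Hausdorff
one. -/
lemma IsAffineDiffeo.exists_homeomorph_sectionSet [T2Space M] [CompactSpace N]
    (hF : D.IsAffineDiffeo A F) :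
    IsClosed (sectionSet D F) ∧ ∃ e : sectionSet D F ≃ₜ N, ∀ x : E,
      ((e.symm (D.q x) : sectionSet D F) : M) = F (D.proj (x, D.sec x)) := by
  have := D.locallyPathConnectedSpace
  let s : N → E := Function.surjInv D.surjective
  have hs : ∀ p, D.q (s p) = p := Function.surjInv_eq D.surjective
  let f : N → sectionSet D F := fun p => ⟨F (D.proj (s p, D.sec (s p))), s p, rfl⟩
  have hf : ∀ x, (f (D.q x) : M) = F (D.proj (x, D.sec x)) := by
    intro x
    obtain ⟨γ, hγ⟩ := exists_deckGroup_apply_eq D.isCoveringMap (hs (D.q x)).symm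
    change F (D.proj (s (D.q x), D.sec (s (D.q x)))) = _
    rw [← hγ, proj_sec_deck]
  have hsec : Continuous fun x : E => F (D.proj (x, D.sec x)) :=
    F.continuous.comp (D.isOpenQuotientMap_proj.continuous.comp
      (continuous_id.prodMk continuous_sec))
  have hcont : Continuous f := by
    rw [(D.isCoveringMap.isQuotientMap D.surjective).continuous_iff, continuous_induced_rng]
    exact hsec.congr fun x => (hf x).symm
  have hinj : Function.Injective f := by
    intro p p' hpp
    obtain ⟨δ₀, hδ₀, h⟩ := hF.exists_height_gap
    rcases h _ _ (F.injective (congrArg Subtype.val hpp)) with h | h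
    · rw [← hs p, ← hs p']
      exact h.1
    · simp only [height, sub_self, abs_zero] at h
      exact absurd h (not_le.2 hδ₀)
  have hsurj : Function.Surjective f := by
    rintro ⟨_, x, rfl⟩
    exact ⟨D.q x, Subtype.ext (hf x)⟩
  refine ⟨?_, ((Equiv.ofBijective f ⟨hinj, hsurj⟩ :
    N ≃ sectionSet D F).toHomeomorphOfContinuousClosed hcont ?_).symm, hf⟩
  · have : sectionSet D F = range (Subtype.val ∘ f) := by
      rw [range_comp, hsurj.range_eq, image_univ, Subtype.range_coe]
    rw [this]
    exact (isCompact_range (continuous_subtype_val.comp hcont)).isClosed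
  · exact hcont.isClosedMap

/-- When `g` inverts the germ of the diffeomorphism, this function is the height over the section as
seen in a chart of `M`. By the next lemma it grows at unit speed along the radial flow. -/
lemma contDiffAt_radialDefect {σ : Vec n → ℝ} (hσ : ContDiff ℝ ∞ σ) (g : GLn n) {v : Vec n}
    (hv : v ≠ 0) : ContDiffAt ℝ ∞ (fun v => Real.log ‖g v‖ - σ (‖g v‖⁻¹ • g v)) v := by
  have hg : ContDiffAt ℝ ∞ (fun v => g v) v := g.toContinuousLinearEquiv.contDiff.contDiffAt
  have hgv : g v ≠ 0 := (map_ne_zero_iff g g.injective).2 hv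
  have hnorm : ContDiffAt ℝ ∞ (fun v => ‖g v‖) v := hg.norm ℝ hgv
  have hne : ‖g v‖ ≠ 0 := norm_ne_zero_iff.2 hgv
  exact (hnorm.log hne).sub (hσ.contDiffAt.comp v ((hnorm.inv hne).smul hg))

lemma radialDefect_exp_smul (σ : Vec n → ℝ) (g : GLn n) {v : Vec n} (hv : v ≠ 0) (t : ℝ) :
    Real.log ‖g (Real.exp t • v)‖ - σ (‖g (Real.exp t • v)‖⁻¹ • g (Real.exp t • v)) =
      t + (Real.log ‖g v‖ - σ (‖g v‖⁻¹ • g v)) := by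
  have hgv : ‖g v‖ ≠ 0 := norm_ne_zero_iff.2 ((map_ne_zero_iff g g.injective).2 hv)
  have hexp := (Real.exp_pos t).ne'
  rw [map_smul, norm_smul, Real.norm_of_nonneg (Real.exp_pos t).le, Real.log_mul hexp hgv,
    Real.log_exp, smul_smul, mul_inv, mul_assoc, mul_comm ‖g v‖⁻¹, ← mul_assoc,
    inv_mul_cancel₀ hexp, one_mul]
  ring

lemma fderiv_radial_eq_one {G : Vec n → ℝ} (hG : Differentiable ℝ G) {v : Vec n} {k : ℝ}
    (h : ∀ᶠ t : ℝ in 𝓝 0, G (Real.exp t • v) = t + k) : fderiv ℝ G v v = 1 := by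
  have h1 : HasDerivAt (fun t : ℝ => Real.exp t • v) v 0 := by
    simpa using (Real.hasDerivAt_exp 0).smul_const v
  have hG' : HasFDerivAt G (fderiv ℝ G v) (Real.exp 0 • v) := by
    simpa using (hG v).hasFDerivAt
  have h2 := hG'.comp_hasDerivAt 0 h1
  have h3 : HasDerivAt (fun t : ℝ => G (Real.exp t • v)) 1 0 :=
    ((hasDerivAt_id (0 : ℝ)).add_const k).congr_of_eventuallyEq h
  exact h2.unique h3

/-- The height serves as local defining function, with radial derivative one. Every flow line is the
image of a vertical line `{x} × ℝ`, which crosses the section at height `sec x`. -/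
lemma IsLinearDiffeo.isTotalCrossSection [T2Space M] [CompactSpace N]
    (hF : D.IsLinearDiffeo A F) : IsTotalCrossSection A (sectionSet D F) := by
  refine ⟨hF.isAffineDiffeo.exists_homeomorph_sectionSet.1, ?_, ?_⟩
  · rintro _ ⟨x, rfl⟩
    set z : E × ℝ := (x, D.sec x) with hz
    obtain ⟨c, hc, hzc⟩ := A.covers (F (D.proj z))
    obtain ⟨g, hg⟩ := hF z c hc hzc
    obtain ⟨σ, hσ, hσx⟩ := D.sec_smooth x
    have hcz : c.2 (F (D.proj z)) ≠ 0 := by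
      rw [hg.self_of_nhds]
      exact (map_ne_zero_iff g g.injective).2 (D.affineDev_ne_zero z)
    set G₀ : Vec n → ℝ := fun v => Real.log ‖g.symm v‖ - σ (‖g.symm v‖⁻¹ • g.symm v) with hG₀
    obtain ⟨G, hG, hGG⟩ := exists_contDiff_eventuallyEq (f := G₀)
      (d := c.2 (F (D.proj z))) (by
        filter_upwards [isOpen_ne.mem_nhds hcz] with v hv
        exact contDiffAt_radialDefect hσ g.symm hv)
    refine ⟨c, hc, hzc, G, hG, ?_, ?_⟩
    · rw [fderiv_radial_eq_one (hG.differentiable (by simp)) (k := G₀ (c.2 (F (D.proj z))))]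
      · exact one_ne_zero
      · have hlim : Tendsto (fun t : ℝ => Real.exp t • c.2 (F (D.proj z))) (𝓝 0)
            (𝓝 (c.2 (F (D.proj z)))) := by
          have : Continuous fun t : ℝ => Real.exp t • c.2 (F (D.proj z)) := by fun_prop
          simpa using this.tendsto 0
        filter_upwards [hlim.eventually hGG] with t ht
        rw [ht]
        exact radialDefect_exp_smul σ g.symm hcz t
    · change ∀ᶠ m in 𝓝 (F (D.proj z)), _
      have hgz := hg
      obtain ⟨δ₀, hδ₀, hgap⟩ := hF.isAffineDiffeo.exists_height_gap
      have hFc : Continuous fun w => F (D.proj w) :=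
        F.continuous.comp D.isOpenQuotientMap_proj.continuous
      have hcF : Tendsto (fun w => c.2 (F (D.proj w))) (𝓝 z) (𝓝 (c.2 (F (D.proj z)))) :=
        (A.continuousAt hc hzc).tendsto.comp (hFc.tendsto z)
      -- At heights below `δ₀` no other sheet of the section can appear, so membership in its image
      -- amounts to height zero.
      have hh : ∀ᶠ w in 𝓝 z, |D.height w| < δ₀ := by
        have : Tendsto (fun w => |D.height w|) (𝓝 z) (𝓝 |D.height z|) :=
          continuous_height.abs.tendsto z
        refine this.eventually_lt_const ?_
        simpa [height, hz] using hδ₀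
      rw [← D.map_nhds_proj F z, eventually_map]
      filter_upwards [hg, hcF.eventually hGG, hh,
        (continuous_fst.tendsto z).eventually hσx] with w h1 h2 h3 h4
      have hGw : G (c.2 (F (D.proj w))) = D.height w := by
        rw [h2, hG₀]
        dsimp only
        rw [h1, LinearEquiv.symm_apply_apply, D.norm_affineDev, Real.log_exp, affineDev, smul_smul,
          inv_mul_cancel₀ (Real.exp_pos _).ne', one_smul, ← h4, height]
      rw [hGw]
      constructor
      · rintro ⟨y, hy⟩
        rcases hgap _ _ (F.injective hy) with ⟨-, h⟩ | h
        · rw [← h]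
          simp [height]
        · simp only [height, sub_self, zero_sub, abs_neg] at h h3
          exact absurd h (not_le.2 h3)
      · intro h
        refine ⟨w.1, ?_⟩
        have : D.sec w.1 = w.2 := by
          rw [height] at h
          linarith
        simp only [this]
  · intro γ hγ
    obtain ⟨⟨x, t⟩, hz⟩ := (F.surjective.comp D.isOpenQuotientMap_proj.surjective) (γ 0)
    replace hz : F (D.proj (x, t)) = γ 0 := hz
    have hflow : FlowOn A (fun s => F (D.proj (x, t + s))) univ := by
      intro s _
      obtain ⟨c, hc, hsc⟩ := A.covers (F (D.proj (x, t + s)))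
      obtain ⟨g, hg⟩ := hF (x, t + s) c hc hsc
      refine ⟨c, hc, hsc, ?_⟩
      have hcont : Continuous fun r : ℝ => (x, t + r) := by fun_prop
      have hFc : Continuous fun w => F (D.proj w) :=
        F.continuous.comp D.isOpenQuotientMap_proj.continuous
      rw [nhdsWithin_univ]
      filter_upwards [(hcont.tendsto s).eventually hg,
        ((hFc.comp hcont).tendsto s).eventually (A.source_mem_nhds hc hsc)] with r hr hrc
      refine ⟨hrc, ?_⟩
      rw [hr, hg.self_of_nhds, ← map_smul]
      congr 1
      simp only [affineDev, smul_smul, ← Real.exp_add]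
      congr 2
      ring
    have := hγ.flowOn.eqOn isPreconnected_univ hflow (mem_univ 0) (by simpa using hz.symm)
      (mem_univ (D.sec x - t))
    exact ⟨D.sec x - t, x, by rw [this]; simp⟩

/-- An affine chart at the section is a linear image of a positive multiple of `dev y`, and a chart
of `N` is a projective image of the class of `dev y`. -/
lemma IsLinearDiffeo.crossSectionEquiv [T2Space M] [CompactSpace N]
    (hF : D.IsLinearDiffeo A F) : CrossSectionEquiv A (sectionSet D F) B := by
  obtain ⟨-, e, he⟩ := hF.isAffineDiffeo.exists_homeomorph_sectionSet
  refine ⟨e, fun p c hc hp c' hc' hp' => ?_⟩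
  obtain ⟨x, hx⟩ := D.surjective (e p)
  have hpx : (p : M) = F (D.proj (x, D.sec x)) := by
    rw [← he x, hx, e.symm_apply_apply]
  obtain ⟨g, hg⟩ := hF (x, D.sec x) c hc (hpx ▸ hp)
  obtain ⟨g', hg'⟩ := D.dev_chart x c' hc' (hx ▸ hp')
  have hsec : Continuous fun y : E => (y, D.sec y) := continuous_id.prodMk continuous_sec
  have hnh : D.q '' {y | c.2 (F (D.proj (y, D.sec y))) = g (D.affineDev (y, D.sec y)) ∧
      ∃ h : (D.dev y : Vec n) ≠ 0,
        c'.2 (D.q y) = g' • Projectivization.mk ℝ (D.dev y : Vec n) h} ∈ 𝓝 (e p) := by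
    rw [← hx]
    exact D.isCoveringMap.isOpenMap.image_mem_nhds (((hsec.tendsto x).eventually hg).and hg')
  refine ⟨g' * g⁻¹, ?_⟩
  filter_upwards [e.continuous.continuousAt.eventually hnh] with m hm
  obtain ⟨y, ⟨h1, h2, h3⟩, hy⟩ := hm
  have hmy : (m : M) = F (D.proj (y, D.sec y)) := by
    rw [← he y, hy, e.symm_apply_apply]
  have hne : c.2 (m : M) ≠ 0 := by
    rw [hmy, h1]
    exact (map_ne_zero_iff g g.injective).2 (D.affineDev_ne_zero _)
  refine ⟨hne, ?_⟩
  rw [← hy, h3, mul_smul]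
  congr 1
  rw [Projectivization.smul_mk, Projectivization.mk_eq_mk_iff']
  refine ⟨Real.exp (-D.sec y), ?_⟩
  change Real.exp (-D.sec y) • g.symm (c.2 (m : M)) = _
  rw [hmy, h1, LinearEquiv.symm_apply_apply, affineDev, smul_smul, ← Real.exp_add]
  simp

end SuspensionData

/-- The base of a suspension which is affinely diffeomorphic to `M` is a total cross-section. -/
theorem IsSuspensionOver.exists_isTotalCrossSection {n : ℕ} {M N : Type u} [TopologicalSpace M]
    [TopologicalSpace N] [T2Space M] [CompactSpace M] [CompactSpace N] {A : RadiantAtlas n M}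
    {B : ProjectiveAtlas n N} (h : IsSuspensionOver A B) :
    ∃ S : Set M, IsTotalCrossSection A S ∧ CrossSectionEquiv A S B := by
  obtain ⟨E, _, _, D, F, hF⟩ := h
  obtain ⟨F', hF'⟩ := hF.exists_isLinearDiffeo
  exact ⟨_, hF'.isTotalCrossSection, hF'.crossSectionEquiv⟩

end RadiantAffine

namespace RadiantAffine

/-! ### Topological cross-sections of flows and their return maps -/

section Flow

variable {X : Type*} [TopologicalSpace X]

/-- A closed set with local flow boxes that meets every orbit. -/
structure IsFlowSection (Ψ : Flow ℝ X) (S : Set X) : Prop where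
  isClosed : IsClosed S
  box : ∀ p ∈ S, ∃ τ : X → ℝ, ContinuousAt τ p ∧ τ p = 0 ∧
    ∀ᶠ z : ℝ × X in 𝓝 (0, p), Ψ z.1 z.2 ∈ S ↔ z.1 = τ z.2
  meets : ∀ x, ∃ t, Ψ t x ∈ S

/-- `t` is the time of the first return of `p` to `S`. -/
def IsFirstReturn (Ψ : Flow ℝ X) (S : Set X) (p : X) (t : ℝ) : Prop :=
  0 < t ∧ Ψ t p ∈ S ∧ ∀ s, 0 < s → s < t → Ψ s p ∉ S

lemma IsFirstReturn.eq {Ψ : Flow ℝ X} {S : Set X} {p : X} {s t : ℝ} (hs : IsFirstReturn Ψ S p s)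
    (ht : IsFirstReturn Ψ S p t) : s = t := by
  rcases lt_trichotomy s t with h | h | h
  · exact absurd hs.2.1 (ht.2.2 s hs.1 h)
  · exact h
  · exact absurd ht.2.1 (hs.2.2 t ht.1 h)

lemma IsFirstReturn.reverse {Ψ : Flow ℝ X} {S : Set X} {p : X} {t : ℝ} (hp : p ∈ S)
    (h : IsFirstReturn Ψ S p t) : IsFirstReturn Ψ.reverse S (Ψ t p) t := by
  have key : ∀ s, Ψ.reverse s (Ψ t p) = Ψ (t - s) p := by
    intro s
    change Ψ (-s) (Ψ t p) = _
    rw [← Ψ.map_add]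
    congr 1
    ring
  refine ⟨h.1, ?_, fun s hs hst => ?_⟩
  · rw [key]
    simpa using hp
  · rw [key]
    exact h.2.2 _ (by linarith) (by linarith)

namespace IsFlowSection

variable {Ψ : Flow ℝ X} {S : Set X} (hS : IsFlowSection Ψ S)

include hS

lemma reverse : IsFlowSection Ψ.reverse S := by
  refine ⟨hS.isClosed, fun p hp => ?_, fun x => ?_⟩
  · obtain ⟨τ, hτ, h0, h⟩ := hS.box p hp
    refine ⟨fun x => -τ x, hτ.neg, by simp [h0], ?_⟩
    have hlim : Tendsto (fun z : ℝ × X => (-z.1, z.2)) (𝓝 (0, p)) (𝓝 (0, p)) := by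
      have : Continuous fun z : ℝ × X => (-z.1, z.2) := by fun_prop
      simpa using this.tendsto (0, p)
    filter_upwards [hlim.eventually h] with z hz
    rw [eq_neg_iff_add_eq_zero, ← neg_eq_iff_add_eq_zero]
    exact hz
  · obtain ⟨t, ht⟩ := hS.meets x
    refine ⟨-t, ?_⟩
    change Ψ (- -t) x ∈ S
    rwa [neg_neg]

omit hS in
lemma eventually_hit {T : Set X} {p : X} {τ : X → ℝ} (hτ : ContinuousAt τ p) (h0 : τ p = 0)
    (h : ∀ᶠ z : ℝ × X in 𝓝 (0, p), Ψ z.1 z.2 ∈ T ↔ z.1 = τ z.2) :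
    ∀ᶠ y in 𝓝 p, Ψ (τ y) y ∈ T := by
  have hlim : Tendsto (fun y => (τ y, y)) (𝓝 p) (𝓝 (0, p)) := by
    have := hτ.prodMk (continuousAt_id (x := p))
    rw [ContinuousAt, h0] at this
    exact this
  filter_upwards [hlim.eventually h] with y hy
  exact hy.2 rfl

/-- Follow a nearby orbit for time `t`, then correct by the small time `τ` of the flow box at `Ψ t
x`. -/
lemma eventually_near_hit {x : X} {t : ℝ} (ht : Ψ t x ∈ S) {W : Set X} (hW : W ∈ 𝓝 (Ψ t x))
    {ε : ℝ} (hε : 0 < ε) : ∀ᶠ y in 𝓝 x, ∃ s, |s - t| < ε ∧ Ψ s y ∈ S ∩ W := by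
  obtain ⟨τ, hτ, h0, h⟩ := hS.box _ ht
  have h1 : ∀ᶠ y in 𝓝 (Ψ t x), |τ y| < ε := by
    have : Tendsto (fun y => |τ y|) (𝓝 (Ψ t x)) (𝓝 0) := by
      have := hτ.abs
      rw [ContinuousAt, h0, abs_zero] at this
      exact this
    exact this.eventually_lt_const hε
  have h2 : ∀ᶠ y in 𝓝 (Ψ t x), Ψ (τ y) y ∈ W := by
    have hc : Continuous fun z : ℝ × X => Ψ z.1 z.2 :=
      Ψ.continuous continuous_fst continuous_snd
    have hlim : Tendsto (fun y => Ψ (τ y) y) (𝓝 (Ψ t x)) (𝓝 (Ψ t x)) := by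
      have h3 := hτ.prodMk (continuousAt_id (x := Ψ t x))
      rw [ContinuousAt, h0] at h3
      have := (hc.tendsto (0, Ψ t x)).comp h3
      simpa [Function.comp_def] using this
    exact hlim hW
  filter_upwards [(Ψ.continuous_toFun t).continuousAt.eventually
    ((eventually_hit hτ h0 h).and (h1.and h2))] with y hy
  refine ⟨τ (Ψ t y) + t, by simpa using hy.2.1, ?_, ?_⟩
  · rw [Ψ.map_add]
    exact hy.1
  · rw [Ψ.map_add]
    exact hy.2.2

/-- Every orbit returns to a cross-section infinitely often. -/
lemma exists_pos_mem [CompactSpace X] (x : X) : ∃ t > 0, Ψ t x ∈ S := by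
  -- These sets are open and increase to the whole space, so one `k` bounds the hitting time from
  -- everywhere. Starting from `Ψ k x`, a hit at a time above `-k` is a hit of the orbit of `x` at a
  -- positive time.
  let U : ℕ → Set X := fun k => {x | ∃ t : ℝ, |t| < k ∧ Ψ t x ∈ S}
  have hU : ∀ k, IsOpen (U k) := by
    intro k
    rw [isOpen_iff_mem_nhds]
    rintro y ⟨t, ht, hty⟩
    filter_upwards [hS.eventually_near_hit hty univ_mem (sub_pos.2 ht)] with z hz
    obtain ⟨s, hs, hsz⟩ := hz
    refine ⟨s, ?_, hsz.1⟩
    have := abs_sub_abs_le_abs_sub s t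
    linarith
  obtain ⟨k, hk⟩ := isCompact_univ.elim_directed_cover U hU (fun y _ => by
    obtain ⟨t, ht⟩ := hS.meets y
    obtain ⟨k, hk⟩ := exists_nat_gt |t|
    exact mem_iUnion.2 ⟨k, t, hk, ht⟩) (directed_of_isDirected_le fun i j hij y hy => by
    obtain ⟨t, ht, hty⟩ := hy
    exact ⟨t, ht.trans_le (by exact_mod_cast hij), hty⟩)
  obtain ⟨t, ht, hty⟩ := hk (mem_univ (Ψ k x))
  refine ⟨t + k, by linarith [neg_abs_le t], ?_⟩
  rwa [Ψ.map_add]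

/-- In a flow box the hitting time is unique: for `x ∈ S` both `0` and `s` equal `τ x`. -/
lemma exists_isolated {p : X} (hp : p ∈ S) :
    ∃ δ > 0, ∀ᶠ x in 𝓝 p, x ∈ S → ∀ s, |s| < δ → Ψ s x ∈ S → s = 0 := by
  obtain ⟨τ, -, -, h⟩ := hS.box p hp
  rw [nhds_prod_eq, eventually_prod_iff] at h
  obtain ⟨P, hP, Q, hQ, h⟩ := h
  obtain ⟨δ, hδ, hball⟩ := Metric.eventually_nhds_iff.1 hP
  refine ⟨δ, hδ, ?_⟩
  filter_upwards [hQ] with x hx hxS s hs hsS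
  have h1 := (h (hball (y := s) (by simpa using hs)) hx).1 hsS
  have h2 := (h (hball (y := 0) (by simpa using hδ)) hx).1 (by simpa using hxS)
  dsimp only at h1 h2
  rw [h1, ← h2]

/-- Returns cannot happen before time `δ`, so the positive return times form a closed set, which
contains its infimum. -/
lemma exists_isFirstReturn [CompactSpace X] {p : X} (hp : p ∈ S) :
    ∃ t, IsFirstReturn Ψ S p t := by
  obtain ⟨δ, hδ, hiso⟩ := hS.exists_isolated hp
  have hiso' := hiso.self_of_nhds hp
  obtain ⟨t₀, ht₀, hS₀⟩ := hS.exists_pos_mem p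
  have hδt : ∀ t, 0 < t → Ψ t p ∈ S → δ ≤ t := by
    intro t ht htS
    by_contra! h
    exact ht.ne' (hiso' t (by rwa [abs_of_pos ht]) htS)
  let T : Set ℝ := {t | δ ≤ t ∧ Ψ t p ∈ S}
  have hT : IsClosed T :=
    isClosed_Ici.inter (hS.isClosed.preimage (Ψ.continuous continuous_id continuous_const))
  have hne : T.Nonempty := ⟨t₀, hδt t₀ ht₀ hS₀, hS₀⟩
  have hbdd : BddBelow T := ⟨δ, fun t ht => ht.1⟩
  have hmem := hT.csInf_mem hne hbdd
  refine ⟨sInf T, hδ.trans_le hmem.1, hmem.2, fun s hs hst hsS => ?_⟩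
  exact absurd (csInf_le hbdd ⟨hδt s hs hsS, hsS⟩) (not_le.2 hst)

/-- The time before the return splits into three pieces. Early hits are excluded by isolation at
`p`, hits on a compact middle interval by closedness of `S`, and late hits other than the expected
one by uniqueness in the flow box at `Ψ t p`. -/
lemma eventually_isFirstReturn {p : X} (hp : p ∈ S) {t : ℝ} (ht : IsFirstReturn Ψ S p t) :
    ∃ f : X → ℝ, ContinuousAt f p ∧ f p = t ∧
      ∀ᶠ x in 𝓝 p, x ∈ S → IsFirstReturn Ψ S x (f x) := by
  obtain ⟨δ, hδ, hiso⟩ := hS.exists_isolated hp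
  obtain ⟨τ, hτ, h0, h⟩ := hS.box _ ht.2.1
  have hΨt : ContinuousAt (fun x => Ψ t x) p := (Ψ.continuous_toFun t).continuousAt
  have hτt : ContinuousAt (fun x => τ (Ψ t x)) p := hτ.comp (f := fun x => Ψ t x) hΨt
  have hhit := eventually_hit hτ h0 h
  rw [nhds_prod_eq, eventually_prod_iff] at h
  obtain ⟨P, hP, Q, hQ, h⟩ := h
  obtain ⟨δ', hδ', hball⟩ := Metric.eventually_nhds_iff.1 hP
  have hmid : ∀ᶠ x in 𝓝 p, ∀ s ∈ Icc (δ / 2) (t - δ' / 2), Ψ s x ∉ S := by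
    refine (isCompact_Icc).eventually_forall_of_forall_eventually fun s hs => ?_
    have hc : Continuous fun z : X × ℝ => Ψ z.2 z.1 :=
      Ψ.continuous continuous_snd continuous_fst
    have hsS : (p, s) ∈ (fun z : X × ℝ => Ψ z.2 z.1) ⁻¹' Sᶜ :=
      ht.2.2 s (by linarith [hs.1]) (by linarith [hs.2])
    exact (hS.isClosed.isOpen_compl.preimage hc).mem_nhds hsS
  have hsmall : ∀ᶠ x in 𝓝 p, |τ (Ψ t x)| < min t δ' := by
    have := hτt.abs
    rw [ContinuousAt, h0, abs_zero] at this
    exact this.eventually_lt_const (lt_min ht.1 hδ')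
  refine ⟨fun x => t + τ (Ψ t x), continuousAt_const.add hτt, by simp [h0], ?_⟩
  filter_upwards [hiso, hmid, hsmall, hΨt.eventually hhit, hΨt.eventually hQ]
    with x h1 h2 h3 h4 h5 hxS
  have h3a := abs_lt.1 (h3.trans_le (min_le_left _ _))
  have h3b := abs_lt.1 (h3.trans_le (min_le_right _ _))
  refine ⟨by linarith [h3a.1], ?_, fun s hs hst hsS => ?_⟩
  · rw [add_comm, Ψ.map_add]
    exact h4
  · by_cases hs1 : s < δ
    · exact hs.ne' (h1 hxS s (by rwa [abs_of_pos hs]) hsS)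
    · by_cases hs2 : s ≤ t - δ' / 2
      · exact h2 s ⟨by linarith, hs2⟩ hsS
      · have hd : dist (s - t) 0 < δ' := by
          rw [Real.dist_eq, sub_zero, abs_lt]
          constructor <;> linarith [h3b.2]
        have := (h (hball hd) h5).1 (by
          change Ψ (s - t) (Ψ t x) ∈ S
          rw [← Ψ.map_add, sub_add_cancel]
          exact hsS)
        dsimp only at this
        linarith

/-- The first return map of a cross-section is a homeomorphism, with continuous return time. -/
theorem exists_return [CompactSpace X] : ∃ (R : S ≃ₜ S) (r : S → ℝ), Continuous r ∧
    (∀ p : S, IsFirstReturn Ψ S p (r p)) ∧ ∀ p : S, (R p : X) = Ψ (r p) p := by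
  have hcont : ∀ {Φ : Flow ℝ X}, IsFlowSection Φ S → ∀ r : S → ℝ,
      (∀ p : S, IsFirstReturn Φ S p (r p)) → Continuous r := by
    intro Φ hΦ r hr
    rw [continuous_iff_continuousAt]
    intro p
    obtain ⟨f, hf, hfp, hev⟩ := hΦ.eventually_isFirstReturn p.2 (hr p)
    refine (hf.comp continuousAt_subtype_val).congr ?_
    filter_upwards [continuousAt_subtype_val.eventually hev] with x hx
    exact (hx x.2).eq (hr x)
  choose r hr using fun p : S => hS.exists_isFirstReturn p.2
  -- The first return of the reversed flow is the inverse map: a first return path run backwards is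
  -- again a first return path.
  choose r' hr' using fun p : S => hS.reverse.exists_isFirstReturn p.2
  have hrc := hcont hS r hr
  have hrc' := hcont hS.reverse r' hr'
  refine ⟨⟨⟨fun p => ⟨Ψ (r p) p, (hr p).2.1⟩, fun p => ⟨Ψ.reverse (r' p) p, (hr' p).2.1⟩,
    fun p => ?_, fun p => ?_⟩, ?_, ?_⟩, r, hrc, hr, fun _ => rfl⟩
  · apply Subtype.ext
    have e : r' ⟨Ψ (r p) p, (hr p).2.1⟩ = r p := (hr' _).eq ((hr p).reverse p.2)
    change Ψ (-(r' ⟨Ψ (r p) p, (hr p).2.1⟩)) (Ψ (r p) p) = p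
    rw [e, ← Ψ.map_add]
    simp
  · apply Subtype.ext
    have e : r ⟨Ψ.reverse (r' p) p, (hr' p).2.1⟩ = r' p := by
      refine (hr _).eq ?_
      have := (hr' p).reverse p.2
      have e2 : Ψ.reverse.reverse = Ψ := Flow.ext fun t x => by
        change Ψ (- -t) x = Ψ t x
        rw [neg_neg]
      rw [e2] at this
      exact this
    change Ψ (r ⟨Ψ.reverse (r' p) p, (hr' p).2.1⟩) (Ψ (-(r' p)) p) = p
    rw [e, ← Ψ.map_add]
    simp
  · exact continuous_induced_rng.2 (Ψ.continuous hrc continuous_subtype_val)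
  · exact continuous_induced_rng.2 (Ψ.reverse.continuous hrc' continuous_subtype_val)

/-- Points of a cross-section on the same orbit are related by the return map. -/
lemma eqvGen_of_eq [CompactSpace X] {R : S ≃ₜ S} {r : S → ℝ} (hrc : Continuous r)
    (hr : ∀ p : S, IsFirstReturn Ψ S p (r p)) (hR : ∀ p : S, (R p : X) = Ψ (r p) p)
    {p p' : S} {t t' : ℝ} (h : Ψ t p = Ψ t' p') :
    Relation.EqvGen (fun a b : S × ℝ => b = (R a.1, a.2 - r a.1)) (p, t) (p', t') := by
  have : CompactSpace S := isCompact_iff_compactSpace.1 hS.isClosed.isCompact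
  obtain ⟨p₀, -, hp₀⟩ := isCompact_univ.exists_isMinOn ⟨p, mem_univ _⟩ hrc.continuousOn
  have hδ := (hr p₀).1
  -- Each return uses up at least the minimal return time `r p₀`, so a time difference of at most `k
  -- * r p₀` is exhausted after at most `k` returns.
  have key : ∀ (k : ℕ) (p p' : S) (t t' : ℝ), Ψ t p = Ψ t' p' → 0 ≤ t - t' →
      t - t' ≤ k * r p₀ →
      Relation.EqvGen (fun a b : S × ℝ => b = (R a.1, a.2 - r a.1)) (p, t) (p', t') := by
    have heq : ∀ (p p' : S) (t : ℝ), Ψ t p = Ψ t p' → p = p' := fun p p' t h =>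
      Subtype.ext ((flowHomeomorph Ψ t).injective h)
    intro k
    induction k with
    | zero =>
      intro p p' t t' h h0 h1
      have : t = t' := by
        rw [Nat.cast_zero, zero_mul] at h1
        linarith
      subst this
      rw [heq p p' t h]
      exact .refl _
    | succ k ih =>
      intro p p' t t' h h0 h1
      rcases h0.eq_or_lt with h0 | h0
      · have : t = t' := by linarith
        subst this
        rw [heq p p' t h]
        exact .refl _
      · have hp' : Ψ (t - t') p = p' := by
          apply (flowHomeomorph Ψ t').injective
          change Ψ t' (Ψ (t - t') p) = Ψ t' p'
          rw [← Ψ.map_add, ← h]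
          congr 1
          ring
        have hle : r p ≤ t - t' := by
          by_contra! hlt
          exact (hr p).2.2 _ h0 hlt (hp' ▸ p'.2)
        refine .trans _ (R p, t - r p) _ (.rel _ _ rfl) (ih _ _ _ _ ?_ (by linarith) ?_)
        · rw [hR, ← Ψ.map_add, ← h]
          congr 1
          ring
        · have h2 : r p₀ ≤ r p := hp₀ (mem_univ p)
          rw [Nat.cast_succ] at h1
          linarith
  rcases le_total t' t with htt | htt
  · obtain ⟨k, hk⟩ := exists_nat_ge ((t - t') / r p₀)
    exact key k p p' t t' h (by linarith) ((div_le_iff₀ hδ).1 hk)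
  · obtain ⟨k, hk⟩ := exists_nat_ge ((t' - t) / r p₀)
    exact .symm _ _ (key k p' p t' t h.symm (by linarith) ((div_le_iff₀ hδ).1 hk))

/-- In a connected space each component of a cross-section meets every orbit. -/
theorem component_meets [CompactSpace X] [ConnectedSpace X] [LocallyConnectedSpace S] (p₀ : S)
    (x : X) : ∃ t, Ψ t x ∈ Subtype.val '' connectedComponent p₀ := by
  obtain ⟨R, r, hrc, hr, hR⟩ := hS.exists_return
  have hopen : ∀ p : S, ∃ W ∈ 𝓝 (p : X), S ∩ W ⊆ Subtype.val '' connectedComponent p := by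
    intro p
    obtain ⟨W, hW, hWo⟩ := isOpen_induced_iff.1
      (isOpen_connectedComponent (α := S) (x := p))
    refine ⟨W, hW.mem_nhds ?_, fun y hy => ⟨⟨y, hy.1⟩, ?_, rfl⟩⟩
    · change p ∈ Subtype.val ⁻¹' W
      rw [hWo]
      exact mem_connectedComponent
    · rw [← hWo]
      exact hy.2
  -- The set of points whose orbits meet the component is shown to be open and closed.
  let Sat : Set X := {x | ∃ t, Ψ t x ∈ Subtype.val '' connectedComponent p₀}
  have horbit : ∀ (k : ℤ) (q : S), ∃ s, ((R ^ k) q : X) = Ψ s q := by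
    let G : Subgroup (S ≃ₜ S) :=
      { carrier := {h | ∀ q : S, ∃ s, (h q : X) = Ψ s q}
        mul_mem' := fun {a b} ha hb q => by
          obtain ⟨s, hs⟩ := hb q
          obtain ⟨s', hs'⟩ := ha (b q)
          exact ⟨s' + s, by rw [Ψ.map_add, ← hs, ← hs']; rfl⟩
        one_mem' := fun q => ⟨0, by simp⟩
        inv_mem' := fun {a} ha q => by
          obtain ⟨s, hs⟩ := ha (a⁻¹ q)
          have e : a (a⁻¹ q) = q := a.apply_symm_apply q
          refine ⟨-s, ?_⟩
          rw [e] at hs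
          rw [hs, ← Ψ.map_add]
          simp }
    intro k
    have hRG : R ∈ G := fun q => ⟨r q, hR q⟩
    exact G.zpow_mem hRG k
  have hzpow : ∀ a b : S × ℝ, Relation.EqvGen (fun a b : S × ℝ => b = (R a.1, a.2 - r a.1)) a b →
      ∃ k : ℤ, b.1 = (R ^ k) a.1 := by
    intro a b h
    induction h with
    | rel a b h => exact ⟨1, by rw [h, zpow_one]⟩
    | refl a => exact ⟨0, rfl⟩
    | symm a b _ ih =>
      obtain ⟨k, hk⟩ := ih
      refine ⟨-k, ?_⟩
      rw [hk, zpow_neg]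
      exact ((R ^ k).symm_apply_apply a.1).symm
    | trans a b c _ _ ih1 ih2 =>
      obtain ⟨k, hk⟩ := ih1
      obtain ⟨l, hl⟩ := ih2
      refine ⟨l + k, ?_⟩
      rw [hl, hk, zpow_add]
      rfl
  -- A power of the return map sends `q` into the component of `p₀`. Being continuous, it sends the
  -- whole component of `q`, and with it `p`, into that component.
  have hcomp : ∀ p q : S, q ∈ connectedComponent p → (q : X) ∈ Sat → (p : X) ∈ Sat := by
    rintro p q hq ⟨t, c, hc, hct⟩
    obtain ⟨k, hk⟩ := hzpow (q, t) (c, 0) (hS.eqvGen_of_eq hrc hr hR (by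
      rw [← hct]
      simp))
    dsimp only at hk
    have hconn : IsPreconnected ((R ^ k) '' connectedComponent p) :=
      isPreconnected_connectedComponent.image _ (R ^ k).continuous.continuousOn
    have hsub := hconn.subset_connectedComponent (x := c) ⟨q, hq, hk.symm⟩
    have hp : (R ^ k) p ∈ connectedComponent p₀ := by
      rw [connectedComponent_eq hc]
      exact hsub ⟨p, mem_connectedComponent, rfl⟩
    obtain ⟨s, hs⟩ := horbit k p
    exact ⟨s, _, hp, hs⟩
  have hSatΨ : ∀ (s : ℝ) (y : X), Ψ s y ∈ Sat ↔ y ∈ Sat := by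
    intro s y
    constructor
    · rintro ⟨t, ht⟩
      exact ⟨t + s, by rwa [Ψ.map_add]⟩
    · rintro ⟨t, ht⟩
      refine ⟨t - s, ?_⟩
      rwa [← Ψ.map_add, sub_add_cancel]
  have hloc : ∀ y : X, ∀ᶠ y' in 𝓝 y, y' ∈ Sat ↔ y ∈ Sat := by
    intro y
    obtain ⟨t, ht⟩ := hS.meets y
    obtain ⟨W, hW, hWS⟩ := hopen ⟨Ψ t y, ht⟩
    filter_upwards [hS.eventually_near_hit ht hW one_pos] with y' hy'
    obtain ⟨s, -, hs⟩ := hy'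
    obtain ⟨q, hq, hqs⟩ := hWS hs
    rw [← hSatΨ s y', ← hSatΨ t y, ← hqs]
    constructor
    · exact hcomp _ _ hq
    · refine hcomp q ⟨Ψ t y, ht⟩ ?_
      rw [← connectedComponent_eq hq]
      exact mem_connectedComponent
  have hclopen : IsClopen Sat := by
    refine ⟨⟨isOpen_iff_mem_nhds.2 fun y hy => ?_⟩, isOpen_iff_mem_nhds.2 fun y hy => ?_⟩
    · filter_upwards [hloc y] with y' hy' using fun h => hy (hy'.1 h)
    · filter_upwards [hloc y] with y' hy' using hy'.2 hy
  have huniv : Sat = univ := hclopen.eq_univ ⟨p₀, 0, p₀, mem_connectedComponent, by simp⟩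
  exact (show x ∈ Sat from huniv ▸ mem_univ x)

end IsFlowSection

end Flow

end RadiantAffine

namespace RadiantAffine

/-! ### Covering spaces from locally constant cocycles -/

universe v w

/-- A locally constant cocycle of maps of `F` determines a covering space with fibre `F`. -/
theorem exists_isCoveringMap_of_cocycle {X : Type u} {F : Type v} {ι : Type w} [TopologicalSpace X]
    (U : ι → Set X) (hU : ∀ i, IsOpen (U i)) (ind : X → ι) (hind : ∀ x, x ∈ U (ind x))
    (cc : ι → ι → X → F → F) (hself : ∀ i, ∀ x ∈ U i, ∀ v, cc i i x v = v)
    (hcomp : ∀ i j k, ∀ x ∈ U i ∩ U j ∩ U k, ∀ v, cc j k x (cc i j x v) = cc i k x v)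
    (hloc : ∀ i j, ∀ x ∈ U i ∩ U j, ∀ v, ∀ᶠ y in 𝓝 x, cc i j y v = cc i j x v) :
    ∃ (E : Type (max u v)) (_ : TopologicalSpace E) (q : E → X) (coord : ι → E → F)
      (pt : ι → X → F → E), IsCoveringMap q ∧ (∀ i x v, q (pt i x v) = x) ∧
      (∀ i, ∀ x ∈ U i, ∀ v, coord i (pt i x v) = v) ∧
      (∀ i e, q e ∈ U i → pt i (q e) (coord i e) = e) ∧
      (∀ i j e, q e ∈ U i → q e ∈ U j → coord j e = cc i j (q e) (coord i e)) ∧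
      ∀ i e, q e ∈ U i → 𝓝 e = comap q (𝓝 (q e)) ⊓ 𝓟 {e' | coord i e' = coord i e} := by
  -- With the fibre discrete, local constancy of the cocycle gives continuity of the coordinate
  -- changes of a fibre bundle.
  let _ : TopologicalSpace F := ⊥
  have : DiscreteTopology F := ⟨rfl⟩
  let Z : FiberBundleCore ι X F :=
    { baseSet := U
      isOpen_baseSet := hU
      indexAt := ind
      mem_baseSet_at := hind
      coordChange := cc
      coordChange_self := hself
      continuousOn_coordChange := by
        rintro i j ⟨x, v⟩ ⟨hx, -⟩
        apply ContinuousAt.continuousWithinAt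
        have hx' : U i ∩ U j ∈ 𝓝 x := ((hU i).inter (hU j)).mem_nhds hx
        have : ∀ᶠ p in 𝓝 (x, v), cc i j p.1 p.2 = cc i j x v := by
          rw [nhds_prod_eq, nhds_discrete F, prod_pure]
          exact eventually_map.2 (hloc i j x hx v)
        exact (continuousAt_const).congr (this.mono fun p hp => hp.symm)
      coordChange_comp := hcomp }
  have hq : IsCoveringMap (Bundle.TotalSpace.proj : Bundle.TotalSpace F Z.Fiber → X) :=
    FiberBundle.isCoveringMap
  refine ⟨Bundle.TotalSpace F Z.Fiber, inferInstance, Bundle.TotalSpace.proj,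
    fun i e => cc (ind e.1) i e.1 e.2, fun i x v => ⟨x, cc i (ind x) x v⟩, hq, fun _ _ _ => rfl,
    ?_, ?_, ?_, ?_⟩
  · intro i x hx v
    change cc (ind x) i x (cc i (ind x) x v) = v
    rw [hcomp _ _ _ _ ⟨⟨hx, hind x⟩, hx⟩, hself _ _ hx]
  · rintro i ⟨x, v⟩ hx
    refine congrArg (Bundle.TotalSpace.mk x) ?_
    exact (hcomp _ _ _ _ ⟨⟨hind x, hx⟩, hind x⟩ _).trans (hself _ _ (hind x) _)
  · rintro i j ⟨x, v⟩ hi hj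
    exact (hcomp _ _ _ _ ⟨⟨hind x, hi⟩, hj⟩ v).symm
  · intro i e he
    have h : 𝓝 e = comap (fun e' : Bundle.TotalSpace F Z.Fiber =>
          (e'.proj, (cc (ind e'.proj) i e'.proj e'.snd : F)))
        (𝓝 (e.proj, (cc (ind e.proj) i e.proj e.snd : F))) ⊓ 𝓟 (Bundle.TotalSpace.proj ⁻¹' U i) :=
      (Z.localTriv i).nhds_eq_comap_inf_principal (x := e) he
    have h3 : Bundle.TotalSpace.proj ⁻¹' U i ∈
        comap (Bundle.TotalSpace.proj : Bundle.TotalSpace F Z.Fiber → X) (𝓝 e.proj) :=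
      preimage_mem_comap ((hU i).mem_nhds he)
    generalize hv : (cc (ind e.proj) i e.proj e.snd : F) = v at h
    refine h.trans ?_
    have h5 : 𝓝 (e.proj, v) = comap Prod.fst (𝓝 e.proj) ⊓ 𝓟 (Prod.snd ⁻¹' {v}) := by
      rw [nhds_prod_eq, nhds_discrete F, ← principal_singleton, ← comap_principal]
      rfl
    rw [h5, comap_inf, comap_comap, comap_principal, inf_right_comm]
    refine (congrArg (· ⊓ _) (inf_eq_left.2 (le_principal_iff.2 h3))).trans ?_
    subst hv
    rfl

/-- A path connected, locally path connected space, covered by path connected open sets in which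
paths with the same end points are homotopic in the whole space, has a universal covering. -/
theorem exists_universal_isCoveringMap {X : Type u} [TopologicalSpace X] [PathConnectedSpace X]
    [LocallyPathConnectedSpace X]
    (h : ∀ x : X, ∃ U : Set X, IsOpen U ∧ x ∈ U ∧ IsPathConnected U ∧
      ∀ a b : X, ∀ p p' : Path a b, (∀ t, p t ∈ U) → (∀ t, p' t ∈ U) → p.Homotopic p') :
    ∃ (E : Type u) (_ : TopologicalSpace E) (_ : SimplyConnectedSpace E) (q : E → X),
      IsCoveringMap q ∧ Function.Surjective q := by
  choose U hUo hxU hUc hUh using h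
  obtain ⟨x₀⟩ := (inferInstance : Nonempty X)
  -- `W y` is the class of a path from `x₀` through `i` to `y` whose second part stays in `U i`. It
  -- is compatible with every path inside `U i`, as such paths are determined up to homotopy by
  -- their ends.
  have hW : ∀ i : X, ∃ W : ∀ y, Path.Homotopic.Quotient x₀ y, ∀ (y z : X) (δ : Path y z),
      (∀ t, δ t ∈ U i) → W z = (W y).trans (Path.Homotopic.Quotient.mk δ) := by
    intro i
    let β := PathConnectedSpace.somePath x₀ i
    classical
    refine ⟨fun y => if hy : y ∈ U i then
      (Path.Homotopic.Quotient.mk β).trans (Path.Homotopic.Quotient.mk ((hUc i).joinedIn i (hxU i) y hy).somePath)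
      else Path.Homotopic.Quotient.mk (PathConnectedSpace.somePath x₀ y), ?_⟩
    intro y z δ hδ
    have hy : y ∈ U i := by simpa using hδ 0
    have hz : z ∈ U i := by simpa using hδ 1
    simp only [hy, hz, dif_pos]
    rw [Path.Homotopic.Quotient.trans_assoc]
    congr 1
    rw [← Path.Homotopic.Quotient.mk_trans, Path.Homotopic.Quotient.eq]
    refine hUh i _ _ _ _ (fun t => ((hUc i).joinedIn i (hxU i) z hz).somePath_mem t) fun t => ?_
    have : ((hUc i).joinedIn i (hxU i) y hy).somePath.trans δ t ∈
        range (((hUc i).joinedIn i (hxU i) y hy).somePath.trans δ) := mem_range_self t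
    rw [Path.trans_range] at this
    rcases this with ⟨s, hs⟩ | ⟨s, hs⟩
    · rw [← hs]; exact ((hUc i).joinedIn i (hxU i) y hy).somePath_mem s
    · rw [← hs]; exact hδ s
  choose W hW using hW
  -- The fibre is the set of classes of loops at `x₀`. Over `y ∈ U i` the coordinate `f` stands for
  -- the path class `f · W i y`, which dictates the cocycle.
  obtain ⟨E, _, q, coord, pt, hq, hqpt, hcp, hpc, hcc, hnhds⟩ := exists_isCoveringMap_of_cocycle U hUo
    id hxU (fun i j y (f : Path.Homotopic.Quotient x₀ x₀) => f.trans ((W i y).trans (W j y).symm))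
    (by intro i x _ v; simp)
    (by
      intro i j k x _ v
      simp only [Path.Homotopic.Quotient.trans_assoc]
      congr 2
      rw [← Path.Homotopic.Quotient.trans_assoc (W j x).symm]
      simp)
    (by
      intro i j x hx v
      obtain ⟨V, ⟨hV, hVc⟩, hVU⟩ := (path_connected_basis x).mem_iff.1
        (((hUo i).inter (hUo j)).mem_nhds hx)
      filter_upwards [hV] with y hy
      obtain ⟨δ, hδ⟩ := hVc.joinedIn x (mem_of_mem_nhds hV) y hy
      rw [hW i x y δ fun t => (hVU (hδ t)).1, hW j x y δ fun t => (hVU (hδ t)).2]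
      congr 1
      generalize Path.Homotopic.Quotient.mk δ = d
      generalize W i x = a
      generalize W j x = b
      induction d using Path.Homotopic.Quotient.ind with | mk d =>
      induction b using Path.Homotopic.Quotient.ind with | mk b =>
      rw [← Path.Homotopic.Quotient.mk_trans, ← Path.Homotopic.Quotient.mk_symm, Path.trans_symm, Path.Homotopic.Quotient.mk_trans]
      simp only [Path.Homotopic.Quotient.mk_symm, Path.Homotopic.Quotient.trans_assoc]
      congr 1
      rw [← Path.Homotopic.Quotient.trans_assoc]
      simp)
  -- the homotopy class of paths in the base represented by a point
  let cls : ∀ e : E, Path.Homotopic.Quotient x₀ (q e) := fun e => (coord (q e) e).trans (W (q e) (q e))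
  let P : ∀ y, Path.Homotopic.Quotient x₀ y → E := fun y κ => pt y y (κ.trans (W y y).symm)
  have hqP : ∀ y κ, q (P y κ) = y := fun y κ => hqpt _ _ _
  have hPc : ∀ e, P (q e) (cls e) = e := by
    intro e
    simp only [P, cls, Path.Homotopic.Quotient.trans_assoc, Path.Homotopic.Quotient.trans_symm, Path.Homotopic.Quotient.trans_refl]
    exact hpc _ _ (hxU _)
  have hPinj : ∀ y κ κ', P y κ = P y κ' → κ = κ' := by
    intro y κ κ' h
    have := congrArg (coord y) h
    simp only [P, hcp y y (hxU y)] at this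
    have h2 := congrArg (fun z => Path.Homotopic.Quotient.trans z (W y y)) this
    simpa [Path.Homotopic.Quotient.trans_assoc] using h2
  have hcP : ∀ i y κ, y ∈ U i → coord i (P y κ) = κ.trans (W i y).symm := by
    intro i y κ hy
    rw [hcc y i (P y κ) (by rw [hqP]; exact hxU y) (by rw [hqP]; exact hy), hqP]
    simp only [P, hcp y y (hxU y)]
    rw [Path.Homotopic.Quotient.trans_assoc, ← Path.Homotopic.Quotient.trans_assoc (W y y).symm]
    simp
  -- A path `γ` is lifted by appending its initial segments to a class. Continuity holds because the
  -- coordinate in a fixed `U` stays constant along a segment contained in that `U`.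
  have hcont : ∀ (x y : X) (γ : Path x y) (C : Path.Homotopic.Quotient x₀ (γ 0)),
      Continuous fun t => P (γ t) (C.trans (Path.Homotopic.Quotient.mk (γ.subpath 0 t))) := by
    intro x y γ C
    rw [continuous_iff_continuousAt]
    intro s
    have hi : q (P (γ s) (C.trans (Path.Homotopic.Quotient.mk (γ.subpath 0 s)))) ∈ U (γ s) := by
      rw [hqP]; exact hxU _
    rw [ContinuousAt, hnhds (γ s) _ hi, tendsto_inf, tendsto_comap_iff, tendsto_principal]
    constructor
    · rw [hqP]
      refine Tendsto.congr (fun t => (hqP _ _).symm) ?_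
      exact γ.continuous.continuousAt
    · have h1 : ∀ᶠ t in 𝓝 s, ∀ r ∈ uIcc s t, γ r ∈ U (γ s) := by
        have h2 : γ ⁻¹' U (γ s) ∈ 𝓝 s := γ.continuous.continuousAt ((hUo _).mem_nhds (hxU _))
        have h3 : Tendsto (fun t => uIcc s t) (𝓝 s) (𝓝 s).smallSets :=
          tendsto_const_nhds.uIcc tendsto_id
        have h4 : ∀ᶠ A in (𝓝 s).smallSets, ∀ r ∈ A, γ r ∈ U (γ s) :=
          eventually_smallSets.2 ⟨_, h2, fun A hA r hr => hA hr⟩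
        exact h3.eventually h4
      filter_upwards [h1] with t ht
      have hmem : ∀ r, γ.subpath s t r ∈ U (γ s) := by
        intro r
        have : γ.subpath s t r ∈ range (γ.subpath s t) := mem_range_self r
        rw [Path.range_subpath] at this
        obtain ⟨r', hr', h⟩ := this
        rw [← h]; exact ht r' hr'
      change coord _ _ = coord _ _
      rw [hcP _ _ _ (hxU _), hcP _ _ _ (by simpa using hmem 1)]
      rw [hW (γ s) (γ s) (γ t) (γ.subpath s t) hmem]
      have h0 : (Path.Homotopic.Quotient.mk (γ.subpath 0 t)) =
          (Path.Homotopic.Quotient.mk (γ.subpath 0 s)).trans (Path.Homotopic.Quotient.mk (γ.subpath s t)) := by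
        rw [← Path.Homotopic.Quotient.mk_trans, Path.Homotopic.Quotient.eq]
        exact ⟨(Path.Homotopy.subpathTransSubpath γ 0 s t).symm⟩
      rw [h0]
      generalize Path.Homotopic.Quotient.mk (γ.subpath s t) = d
      generalize Path.Homotopic.Quotient.mk (γ.subpath 0 s) = g
      generalize W (γ s) (γ s) = a
      induction d using Path.Homotopic.Quotient.ind with | mk d =>
      induction a using Path.Homotopic.Quotient.ind with | mk b =>
      rw [← Path.Homotopic.Quotient.mk_trans, ← Path.Homotopic.Quotient.mk_symm, Path.trans_symm, Path.Homotopic.Quotient.mk_trans]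
      simp only [Path.Homotopic.Quotient.mk_symm, Path.Homotopic.Quotient.trans_assoc]
      congr 2
      rw [← Path.Homotopic.Quotient.trans_assoc]
      simp
  have hlift : ∀ (x y : X) (γ : Path x y) (κ : Path.Homotopic.Quotient x₀ x),
      ∃ Γ : Path (P x κ) (P y (κ.trans (Path.Homotopic.Quotient.mk γ))), ∀ t, q (Γ t) = γ t := by
    intro x y γ κ
    refine ⟨⟨⟨_, hcont x y γ (κ.cast rfl γ.source)⟩, ?_, ?_⟩, fun t => hqP _ _⟩
    · have h0 : ∀ (x' : X) (hx : x' = x), P x' ((κ.cast rfl hx).trans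
          (Path.Homotopic.Quotient.mk (Path.refl x'))) = P x κ := by
        rintro _ rfl; simp
      simp only [Path.subpath_self]
      exact h0 _ γ.source
    · have h1 : ∀ (x' y' : X) (hx : x' = x) (hy : y' = y), P y' ((κ.cast rfl hx).trans
          (Path.Homotopic.Quotient.mk (γ.cast hx hy))) =
          P y (κ.trans (Path.Homotopic.Quotient.mk γ)) := by
        rintro _ _ rfl rfl; simp
      simp only [Path.subpath_zero_one]
      exact h1 _ _ γ.source γ.target
  have hpc' : PathConnectedSpace E := by
    refine ⟨⟨P x₀ (Path.Homotopic.Quotient.refl x₀)⟩, fun e e' => ?_⟩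
    obtain ⟨δ, hδ⟩ := Path.Homotopic.Quotient.mk_surjective ((cls e).symm.trans (cls e'))
    obtain ⟨Γ, -⟩ := hlift _ _ δ (cls e)
    rw [hδ, ← Path.Homotopic.Quotient.trans_assoc] at Γ
    simp only [Path.Homotopic.Quotient.trans_symm, Path.Homotopic.Quotient.refl_trans, hPc] at Γ
    exact ⟨Γ⟩
  refine ⟨E, inferInstance, ?_, q, hq, fun y => ?_⟩
  · rw [simply_connected_iff_loops_nullhomotopic]
    refine ⟨hpc', fun e Γ => ?_⟩
    let qc : C(E, X) := ⟨q, hq.continuous⟩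
    let γ : Path (q e) (q e) := Γ.map hq.continuous
    obtain ⟨Γ', hΓ'⟩ := hlift _ _ γ (cls e)
    have h1 : (Γ : unitInterval → E) = Γ' := by
      refine hq.eq_of_comp_eq Γ.continuous Γ'.continuous ?_ 0 ?_
      · funext t; exact (hΓ' t).symm
      · rw [Γ.source, Γ'.source, hPc]
    -- The explicit lift of `γ` coincides with the loop `Γ`, so its end point equals its starting
    -- point. This forces the class of `γ` to be trivial, and `q` is injective on homotopy classes
    -- of paths.
    have h2 : P (q e) ((cls e).trans (Path.Homotopic.Quotient.mk γ)) = P (q e) (cls e) := by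
      rw [hPc, ← Γ'.target, ← h1, Γ.target]
    have h3 : Path.Homotopic.Quotient.mk γ = Path.Homotopic.Quotient.refl (q e) := by
      have := congrArg (fun z => Path.Homotopic.Quotient.trans (cls e).symm z) (hPinj _ _ _ h2)
      simpa [← Path.Homotopic.Quotient.trans_assoc] using this
    rw [← Path.Homotopic.Quotient.eq]
    apply hq.injective_path_homotopic_map e e
    exact h3
  · exact ⟨P y (Path.Homotopic.Quotient.mk (PathConnectedSpace.somePath x₀ y)), hqP _ _⟩

/-- A continuous map from a simply connected space to a radiant affine manifold can be developed
into `ℝⁿ`. -/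
theorem exists_developing_map {n : ℕ} {M : Type u} {E : Type v} [TopologicalSpace M]
    [TopologicalSpace E] [SimplyConnectedSpace E] [LocallyPathConnectedSpace E]
    (A : RadiantAtlas n M) {f : E → M} (hf : Continuous f) :
    ∃ D : E → Vec n, ∀ x, ∀ c ∈ A.charts, f x ∈ c.1 →
      ∃ g : GLn n, ∀ᶠ y in 𝓝 x, D y = g (c.2 (f y)) := by
  choose c hc hpc using A.covers
  have hT : ∀ i j p, ∃ T : GLn n, p ∈ (c i).1 ∩ (c j).1 → ∀ᶠ x in 𝓝 p,
      (c j).2 x = T ((c i).2 x) := by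
    intro i j p
    by_cases hp : p ∈ (c i).1 ∩ (c j).1
    · obtain ⟨T, hT⟩ := exists_transition A (hc i) (hc j) hp.1 hp.2
      exact ⟨T, fun _ => hT⟩
    · exact ⟨LinearEquiv.refl ℝ _, fun h => absurd h hp⟩
  choose T hT using hT
  -- This is the covering of `M` by germs of linear developing maps: the coordinate `g` over the
  -- chart `c i` stands for the germ `g ∘ c i`. A lift of `f` to it chooses such germs consistently
  -- over the simply connected `E`.
  obtain ⟨C, _, q, coord, pt, hq, hqpt, hcp, hpc', hcc, hnhds⟩ := exists_isCoveringMap_of_cocycle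
    (fun i => (c i).1) (fun i => A.isOpen_source _ (hc i)) id hpc
    (fun i j p (g : GLn n) => (T i j p).symm.trans g)
    (by
      intro i p hp v
      have h : T i i p = LinearEquiv.refl ℝ _ := linearEquiv_eq_of_eventually A (hc i) hp
        ((hT i i p ⟨hp, hp⟩).mono fun x hx => hx.symm)
      rw [h]
      rfl)
    (by
      intro i j k p hp v
      have h : (T i j p).trans (T j k p) = T i k p := by
        refine linearEquiv_eq_of_eventually A (hc i) hp.1.1 ?_
        filter_upwards [hT i j p hp.1, hT j k p ⟨hp.1.2, hp.2⟩, hT i k p ⟨hp.1.1, hp.2⟩]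
          with x h1 h2 h3
        rw [← h3, LinearEquiv.trans_apply, ← h1, ← h2]
      rw [← h]
      rfl)
    (by
      intro i j p hp v
      filter_upwards [(hT i j p hp).eventually_nhds, ((A.isOpen_source _ (hc i)).inter
        (A.isOpen_source _ (hc j))).mem_nhds hp] with x hx hxm
      have h : T i j x = T i j p := by
        refine linearEquiv_eq_of_eventually A (hc i) hxm.1 ?_
        filter_upwards [hT i j x hxm, hx] with y h1 h2
        rw [← h1, h2]
      rw [h])
  obtain ⟨x₀⟩ := (inferInstance : Nonempty E)
  obtain ⟨F, ⟨-, hF⟩, -⟩ := hq.existsUnique_continuousMap_lifts ⟨f, hf⟩ x₀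
    (pt (f x₀) (f x₀) (LinearEquiv.refl ℝ _)) (hqpt _ _ _)
  have hqF : ∀ x, q (F x) = f x := fun x => congrFun hF x
  refine ⟨fun x => coord (f x) (F x) ((c (f x)).2 (f x)), fun x c' hc' hx => ?_⟩
  obtain ⟨h, hh⟩ := exists_transition A hc' (hc (f x)) hx (hpc _)
  refine ⟨h.trans (coord (f x) (F x)), ?_⟩
  have h1 : ∀ᶠ y in 𝓝 x, coord (f x) (F y) = coord (f x) (F x) := by
    have := F.continuous.continuousAt (x := x)
    rw [ContinuousAt, hnhds (f x) _ (by rw [hqF]; exact hpc _), tendsto_inf,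
      tendsto_principal] at this
    exact this.2
  filter_upwards [h1, hf.continuousAt.eventually hh,
    hf.continuousAt ((A.isOpen_source _ (hc (f x))).mem_nhds (hpc _))] with y hy1 hy2 hy3
  rw [LinearEquiv.trans_apply, ← hy2, ← hy1, hcc (f x) (f y) (F y) (by rw [hqF]; exact hy3)
    (by rw [hqF]; exact hpc _), LinearEquiv.trans_apply, hqF]
  congr 1
  rw [LinearEquiv.symm_apply_eq]
  exact (hT (f x) (f y) (f y) ⟨hy3, hpc _⟩).self_of_nhds

end RadiantAffine

namespace RadiantAffine

/-! ### The local structure of a total cross-section -/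

section CrossSectionLocal

variable {n : ℕ} {M : Type*} [TopologicalSpace M] {A : RadiantAtlas n M} {S : Set M}
  {c : Set M × (M → Vec n)} {p : M} {Ψ : Flow ℝ M}

/-- The radiant vector field of a manifold with a total cross-section has no zeros. -/
lemma IsTotalCrossSection.chart_ne_zero (hS : IsTotalCrossSection A S) (hc : c ∈ A.charts)
    (hp : p ∈ c.1) : c.2 p ≠ 0 := by
  intro h0
  have h : ∀ c' ∈ A.charts, p ∈ c'.1 → c'.2 p = 0 := by
    intro c' hc' hp'
    obtain ⟨g, hg⟩ := exists_transition A hc hc' hp hp'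
    rw [hg.self_of_nhds, h0, map_zero]
  -- At a zero of the radiant field the constant curve is a flow line, so the point lies on `S`.
  -- There transversality fails, the radial direction being zero.
  obtain ⟨-, hpS⟩ := hS.meets (fun _ => p) ⟨continuous_const, fun t c' hc' hp' => by
    rw [h c' hc' hp']; exact hasDerivAt_const t _⟩
  obtain ⟨c', hc', hp', g, -, hg, -⟩ := hS.transverse p hpS
  rw [h c' hc' hp', map_zero] at hg
  exact hg rfl

lemma IsTotalCrossSection.transverse_chart (hS : IsTotalCrossSection A S) (hpS : p ∈ S)
    (hc : c ∈ A.charts) (hp : p ∈ c.1) : ∃ K : Vec n → ℝ, ContDiff ℝ ∞ K ∧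
      fderiv ℝ K (c.2 p) (c.2 p) ≠ 0 ∧ ∀ᶠ x in 𝓝 p, (x ∈ S ↔ K (c.2 x) = 0) := by
  obtain ⟨c', hc', hp', K, hK, hK1, hK2⟩ := hS.transverse p hpS
  obtain ⟨g, hg⟩ := exists_transition A hc hc' hp hp'
  let g' : Vec n →L[ℝ] Vec n := LinearMap.toContinuousLinearMap (g : Vec n →ₗ[ℝ] Vec n)
  have hg' : ∀ v, g' v = g v := fun _ => rfl
  refine ⟨K ∘ g', hK.comp g'.contDiff, ?_, ?_⟩
  · rw [fderiv_comp _ (hK.differentiable (by simp)).differentiableAt g'.differentiableAt,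
      ContinuousLinearMap.fderiv, ContinuousLinearMap.comp_apply, hg', ← hg.self_of_nhds]
    exact hK1
  · filter_upwards [hK2, hg] with x h1 h2
    rw [h1, h2]
    rfl

/-- In a chart the orbit of `x` is `s ↦ exp s • c x`, so the hitting time is a smooth function of
the chart vector, found by solving `K (exp s • v) = 0` for `s`. -/
lemma IsTotalCrossSection.exists_box (hS : IsTotalCrossSection A S) (hΨ : IsRadialFlow A Ψ)
    (hpS : p ∈ S) (hc : c ∈ A.charts) (hp : p ∈ c.1) : ∃ σ : Vec n → ℝ, ContDiff ℝ ∞ σ ∧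
      σ (c.2 p) = 0 ∧ ∀ᶠ z : ℝ × M in 𝓝 (0, p), Ψ z.1 z.2 ∈ S ↔ z.1 = σ (c.2 z.2) := by
  obtain ⟨K, hK, hK1, hK2⟩ := hS.transverse_chart hpS hc hp
  obtain ⟨σ, hσ, hσ0, hσ1⟩ := exists_contDiff_radial_time hK (c.2 p) 0
    (by simpa using hK2.self_of_nhds.1 hpS) (by simpa using hK1)
  refine ⟨σ, hσ, hσ0, ?_⟩
  have h1 : Tendsto (fun z : ℝ × M => Ψ z.1 z.2) (𝓝 (0, p)) (𝓝 p) := by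
    have : Continuous fun z : ℝ × M => Ψ z.1 z.2 := Ψ.continuous continuous_fst continuous_snd
    simpa [Flow.map_zero_apply] using this.tendsto (0, p)
  have h2 : Tendsto (fun z : ℝ × M => (c.2 z.2, z.1)) (𝓝 (0, p)) (𝓝 (c.2 p, 0)) :=
    ((A.continuousAt hc hp).tendsto.comp (continuous_snd.tendsto ((0 : ℝ), p))).prodMk_nhds
      continuous_fst.continuousAt
  filter_upwards [h1.eventually hK2, h2.eventually hσ1, hΨ.eventually_chart_eq hc hp]
    with z hz1 hz2 hz3
  rw [hz1, hz3.2.2, hz2]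

lemma IsTotalCrossSection.isFlowSection [T2Space M] (hS : IsTotalCrossSection A S)
    (hΨ : IsRadialFlow A Ψ) : IsFlowSection Ψ S where
  isClosed := hS.isClosed
  box p hpS := by
    obtain ⟨c, hc, hp⟩ := A.covers p
    obtain ⟨σ, hσ, hσ0, hσ1⟩ := hS.exists_box hΨ hpS hc hp
    exact ⟨fun x => σ (c.2 x), hσ.continuous.continuousAt.comp (A.continuousAt hc hp), hσ0, hσ1⟩
  meets x := hS.meets _ (hΨ x).isRadialFlowLine

/-- Near one of its points, a total cross-section is the homeomorphic image, under a map that is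
radial in a chart, of a convex set in an affine hyperplane. -/
theorem IsTotalCrossSection.exists_patch (hS : IsTotalCrossSection A S) (hΨ : IsRadialFlow A Ψ)
    (hpS : p ∈ S) (hc : c ∈ A.charts) (hp : p ∈ c.1) {W : Set M} (hW : W ∈ 𝓝 p)
    {α : Vec n →ₗ[ℝ] ℝ} (hα : 0 < α (c.2 p)) :
    ∃ (H O : Set (Vec n)) (X : Vec n → M),
      (H = univ ∨ ∃ l : Vec n →ₗ[ℝ] ℝ, l ≠ 0 ∧ l (c.2 p) = 0 ∧ H = {v | 0 ≤ l v}) ∧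
      IsOpen O ∧ Convex ℝ O ∧ c.2 p ∈ O ∩ H ∧ X (c.2 p) = p ∧
      ContinuousOn X ({w | α w = α (c.2 p)} ∩ (O ∩ H)) ∧
      (∀ w ∈ {w | α w = α (c.2 p)} ∩ (O ∩ H), X w ∈ S ∧ X w ∈ W ∧ X w ∈ c.1 ∧
        ∃ r : ℝ, 0 < r ∧ c.2 (X w) = r • w) ∧
      ∀ w ∈ {w | α w = α (c.2 p)} ∩ (O ∩ H), ∀ᶠ x in 𝓝 (X w), x ∈ S →
        ∃ w' ∈ {w | α w = α (c.2 p)} ∩ (O ∩ H), X w' = x := by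
  have hne : Nonempty M := ⟨p⟩
  obtain ⟨j, hj1, hj2, hj3⟩ := A.chart_inverse hc
  obtain ⟨H₁, hH₁, O₁, hO₁, him⟩ := A.image_eq c hc
  have hd : c.2 p ∈ O₁ ∩ H₁ := him ▸ mem_image_of_mem _ hp
  -- If `c.2 p` lies strictly inside the half-space, the half-space is absorbed into the open set.
  -- In the other case `l` vanishes at `c.2 p`, a fact used later for the independence of `α` and
  -- `l`.
  obtain ⟨H, O₂, hH, hO₂, hdO, hsub, hsup⟩ : ∃ H O₂ : Set (Vec n),
      (H = univ ∨ ∃ l : Vec n →ₗ[ℝ] ℝ, l ≠ 0 ∧ l (c.2 p) = 0 ∧ H = {v | 0 ≤ l v}) ∧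
      IsOpen O₂ ∧ c.2 p ∈ O₂ ∩ H ∧ O₂ ∩ H ⊆ O₁ ∩ H₁ ∧ O₂ ∩ H₁ ⊆ H := by
    rcases hH₁ with rfl | ⟨l, hl, rfl⟩
    · exact ⟨univ, O₁, Or.inl rfl, hO₁, hd, Subset.rfl, inter_subset_right⟩
    · rcases (show (0 : ℝ) ≤ l (c.2 p) from hd.2).eq_or_lt with h | h
      · exact ⟨_, O₁, Or.inr ⟨l, hl, h.symm, rfl⟩, hO₁, hd, Subset.rfl, inter_subset_right⟩
      · refine ⟨univ, O₁ ∩ {v | 0 < l v}, Or.inl rfl, hO₁.inter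
          (isOpen_lt continuous_const (LinearMap.continuous_of_finiteDimensional l)),
          ⟨⟨hd.1, h⟩, mem_univ _⟩, fun v hv => ⟨hv.1.1, ?_⟩, subset_univ _⟩
        exact le_of_lt (show 0 < l v from hv.1.2)
  obtain ⟨σ, hσ, hσ0, hσ1⟩ := hS.exists_box hΨ hpS hc hp
  have hjc : ContinuousOn j (O₂ ∩ H) := (him ▸ hj3).mono hsub
  have hjd : j (c.2 p) = p := hj1 p hp
  have hXc : ContinuousOn (fun w => Ψ (σ w) (j w)) (O₂ ∩ H) := by
    have : Continuous fun z : ℝ × M => Ψ z.1 z.2 := Ψ.continuous continuous_fst continuous_snd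
    exact this.comp_continuousOn (hσ.continuous.continuousOn.prodMk hjc)
  have hev : ∀ᶠ w in 𝓝[O₂ ∩ H] (c.2 p), Ψ (σ w) (j w) ∈ S ∧ Ψ (σ w) (j w) ∈ W ∧
      Ψ (σ w) (j w) ∈ c.1 ∧ c.2 (Ψ (σ w) (j w)) = Real.exp (σ w) • w := by
    have h1 : Tendsto (fun w => (σ w, j w)) (𝓝[O₂ ∩ H] (c.2 p)) (𝓝 (0, p)) := by
      have := (hσ.continuous.continuousOn.prodMk hjc) (c.2 p) hdO
      rw [ContinuousWithinAt, hjd, hσ0] at this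
      exact this
    have h2 : Tendsto (fun w => Ψ (σ w) (j w)) (𝓝[O₂ ∩ H] (c.2 p)) (𝓝 p) := by
      have := hXc (c.2 p) hdO
      rw [ContinuousWithinAt, hjd, hσ0, Flow.map_zero_apply] at this
      exact this
    filter_upwards [h1.eventually hσ1, h1.eventually (hΨ.eventually_chart_eq hc hp),
      h2.eventually hW, self_mem_nhdsWithin] with w hw1 hw2 hw3 hw4
    have hcj : c.2 (j w) = w := (hj2 w (him ▸ hsub hw4)).2
    rw [hcj] at hw1 hw2
    exact ⟨hw1.2 rfl, hw3, hw2.1, hw2.2.2⟩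
  rw [eventually_nhdsWithin_iff, Metric.eventually_nhds_iff_ball] at hev
  obtain ⟨ε₁, hε₁, hev⟩ := hev
  obtain ⟨ε₂, hε₂, hball⟩ := Metric.mem_nhds_iff.1 (hO₂.mem_nhds hdO.1)
  have hm : ∀ w ∈ Metric.ball (c.2 p) (min ε₁ ε₂) ∩ H,
      w ∈ O₂ ∩ H ∧ w ∈ Metric.ball (c.2 p) ε₁ := fun w hw =>
    ⟨⟨hball (Metric.ball_subset_ball (min_le_right _ _) hw.1), hw.2⟩,
      Metric.ball_subset_ball (min_le_left _ _) hw.1⟩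
  refine ⟨H, Metric.ball (c.2 p) (min ε₁ ε₂), fun w => Ψ (σ w) (j w), hH, Metric.isOpen_ball,
    convex_ball _ _, ⟨Metric.mem_ball_self (lt_min hε₁ hε₂), hdO.2⟩, ?_, ?_, ?_, ?_⟩
  · simp only [hσ0, hjd, Flow.map_zero_apply]
  · exact hXc.mono fun w hw => (hm w hw.2).1
  · intro w hw
    obtain ⟨h1, h2, h3, h4⟩ := hev w (hm w hw.2).2 (hm w hw.2).1
    exact ⟨h1, h2, h3, _, Real.exp_pos _, h4⟩
  · intro w hw
    obtain ⟨h1, h2, h3, h4⟩ := hev w (hm w hw.2).2 (hm w hw.2).1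
    have hwα : α w = α (c.2 p) := hw.1
    have hαc : Continuous α := LinearMap.continuous_of_finiteDimensional α
    set x₀ := Ψ (σ w) (j w) with hx₀
    have hcx : ContinuousAt c.2 x₀ := A.continuousAt hc h3
    have hαx : α (c.2 x₀) = Real.exp (σ w) * α (c.2 p) := by
      rw [h4, map_smul, smul_eq_mul, hwα]
    have hαx0 : 0 < α (c.2 x₀) := by rw [hαx]; positivity
    have hαcx : ContinuousAt (fun x => α (c.2 x)) x₀ := hαc.continuousAt.comp hcx
    -- `κ` projects radially to the hyperplane, and `δ x` below is the time that takes `x` to the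
    -- patch point over `κ x`. For `x ∈ S` near `x₀` the times `0` and `δ x` both hit `S`, so they
    -- agree and `x` lies in the patch.
    let κ : M → Vec n := fun x => (α (c.2 p) / α (c.2 x)) • c.2 x
    have hκ : ContinuousAt κ x₀ := (continuousAt_const.div hαcx hαx0.ne').smul hcx
    have hκ0 : κ x₀ = w := by
      simp only [κ]
      rw [hαx, h4, smul_smul]
      convert one_smul ℝ w using 2
      field_simp
    let δ : M → ℝ := fun x => σ (κ x) - Real.log (α (c.2 x) / α (c.2 p))
    have hδ : ContinuousAt δ x₀ :=
      (hσ.continuous.continuousAt.comp hκ).sub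
        (ContinuousAt.log (hαcx.div_const _) (div_pos hαx0 hα).ne')
    have hδ0 : δ x₀ = 0 := by
      simp only [δ, hκ0]
      rw [hαx, mul_div_assoc, div_self hα.ne', mul_one, Real.log_exp, sub_self]
    obtain ⟨τ, hτ, hτ0, hτ1⟩ := hS.exists_box hΨ h1 hc h3
    have hz : Tendsto (fun x => (δ x, x)) (𝓝 x₀) (𝓝 (0, x₀)) := by
      have := hδ.prodMk continuousAt_id
      rw [ContinuousAt, hδ0] at this
      exact this
    have hz' : Tendsto (fun x => ((0 : ℝ), x)) (𝓝 x₀) (𝓝 (0, x₀)) :=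
      tendsto_const_nhds.prodMk_nhds tendsto_id
    have hκball : ∀ᶠ x in 𝓝 x₀, κ x ∈ Metric.ball (c.2 p) (min ε₁ ε₂) := by
      refine hκ.eventually (Metric.isOpen_ball.mem_nhds ?_)
      rw [hκ0]; exact hw.2.1
    filter_upwards [hκball, hαcx.eventually (lt_mem_nhds hαx0), A.source_mem_nhds hc h3,
      hz.eventually hτ1, hz'.eventually hτ1, hz.eventually (hΨ.eventually_chart_eq hc h3)]
      with x hx1 hx2 hx3 hx4 hx5 hx6 hxS
    have hκα : α (κ x) = α (c.2 p) := by
      simp only [κ]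
      rw [map_smul, smul_eq_mul, div_mul_cancel₀ _ hx2.ne']
    have hκH : κ x ∈ H := by
      refine hsup ⟨hball (Metric.ball_subset_ball (min_le_right _ _) hx1), ?_⟩
      refine smul_mem_linearModel hH₁ ?_ (div_pos hα hx2).le
      have : c.2 x ∈ O₁ ∩ H₁ := him ▸ mem_image_of_mem _ hx3
      exact this.2
    have hκB : κ x ∈ Metric.ball (c.2 p) (min ε₁ ε₂) ∩ H := ⟨hx1, hκH⟩
    obtain ⟨g1, -, g3, g4⟩ := hev _ (hm _ hκB).2 (hm _ hκB).1
    have he : Ψ (δ x) x = Ψ (σ (κ x)) (j (κ x)) := by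
      refine A.injOn hc hx6.1 g3 ?_
      rw [hx6.2.2, g4]
      simp only [δ]
      rw [Real.exp_sub, Real.exp_log (div_pos hx2 hα)]
      simp only [κ]
      rw [smul_smul]
      congr 1
      field_simp
    have h0 : (0 : ℝ) = τ (c.2 x) := hx5.1 (by simpa [Flow.map_zero_apply] using hxS)
    have h0' : δ x = τ (c.2 x) := hx4.1 (by rw [he]; exact g1)
    refine ⟨κ x, ⟨hκα, hκB⟩, ?_⟩
    rw [← he, h0', ← h0, Flow.map_zero_apply]

end CrossSectionLocal

end RadiantAffine

/-! ### The universal covering and the projective structure of a total cross-section. -/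

namespace RadiantAffine

lemma isEmbedding_of_leftInverse {X Y : Type*} [TopologicalSpace X] [TopologicalSpace Y]
    {f : X → Y} {g : Y → X} (hf : Continuous f) (hgf : ∀ x, g (f x) = x)
    (hg : ∀ x, Tendsto g (𝓝[range f] (f x)) (𝓝 x)) : IsEmbedding f := by
  refine ⟨isInducing_iff_nhds.2 fun x => le_antisymm hf.continuousAt.le_comap ?_,
    Function.LeftInverse.injective hgf⟩
  have h1 : Tendsto f (comap f (𝓝 (f x))) (𝓝[range f] (f x)) :=
    tendsto_nhdsWithin_iff.2 ⟨tendsto_comap, Eventually.of_forall mem_range_self⟩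
  have h2 := (hg x).comp h1
  rwa [show g ∘ f = id from funext hgf, tendsto_id'] at h2

section CrossSectionStructure

variable {n : ℕ} {M : Type*} [TopologicalSpace M] {A : RadiantAtlas n M} {S : Set M}
  {Ψ : Flow ℝ M}

/-- Each neighbourhood of a point of a total cross-section contains an open neighbourhood in the
cross-section that is homeomorphic to a convex subset of `ℝⁿ`. -/
lemma IsTotalCrossSection.exists_convex_nhds (hS : IsTotalCrossSection A S)
    (hΨ : IsRadialFlow A Ψ) (p : S) {W : Set S} (hW : W ∈ 𝓝 p) :
    ∃ U ⊆ W, IsOpen U ∧ p ∈ U ∧ ∃ B : Set (Vec n), Convex ℝ B ∧ B.Nonempty ∧ Nonempty (B ≃ₜ U) := by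
  obtain ⟨c, hc, hp⟩ := A.covers p
  obtain ⟨W', hW', hWW'⟩ := mem_nhds_subtype S p W |>.1 hW
  have hd := hS.chart_ne_zero hc hp
  let α : Vec n →ₗ[ℝ] ℝ := (innerSL ℝ (c.2 p) : Vec n →L[ℝ] ℝ)
  have hα : 0 < α (c.2 p) := by
    change 0 < inner ℝ (c.2 p) (c.2 p)
    exact real_inner_self_pos.2 hd
  obtain ⟨H, O, X, hH, hO, hOc, hdO, hXd, hXc, hX1, hX2⟩ := hS.exists_patch hΨ p.2 hc hp hW' hα
  set B := {w | α w = α (c.2 p)} ∩ (O ∩ H) with hB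
  have hHc : Convex ℝ H := by
    rcases hH with rfl | ⟨l, -, -, rfl⟩
    · exact convex_univ
    · exact convex_halfSpace_ge l.isLinear 0
  have hBc : Convex ℝ B := (convex_hyperplane α.isLinear _).inter (hOc.inter hHc)
  have hdB : c.2 p ∈ B := ⟨rfl, hdO⟩
  let X' : B → S := fun w => ⟨X w, (hX1 w w.2).1⟩
  have hX'c : Continuous X' := (continuousOn_iff_continuous_domRestrict.1 hXc).subtype_mk _
  let κ : M → Vec n := fun x => (α (c.2 p) / α (c.2 x)) • c.2 x
  have hκX : ∀ w ∈ B, κ (X w) = w := by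
    intro w hw
    obtain ⟨-, -, -, r, hr, h⟩ := hX1 w hw
    have hwα : α w = α (c.2 p) := hw.1
    simp only [κ, h, map_smul, smul_eq_mul, hwα, smul_smul]
    convert one_smul ℝ w using 2
    field_simp
  have hκc : ∀ w ∈ B, ContinuousAt κ (X w) := by
    intro w hw
    obtain ⟨-, -, h3, r, hr, h⟩ := hX1 w hw
    have hcx := A.continuousAt hc h3
    have hwα : α w = α (c.2 p) := hw.1
    have h0 : α (c.2 (X w)) ≠ 0 := by
      rw [h, map_smul, smul_eq_mul, hwα]; positivity
    exact (continuousAt_const.div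
      ((LinearMap.continuous_of_finiteDimensional α).continuousAt.comp hcx) h0).smul hcx
  have hemb : IsEmbedding X' := by
    classical
    refine isEmbedding_of_leftInverse
      (g := fun x => if h : κ x ∈ B then ⟨κ x, h⟩ else ⟨_, hdB⟩) hX'c ?_ ?_
    · intro w
      simp only [X', hκX w w.2, w.2, dif_pos, Subtype.coe_eta]
    · intro w
      rw [IsInducing.subtypeVal.tendsto_nhds_iff]
      have h1 : Tendsto (fun x : S => κ x) (𝓝[range X'] (X' w)) (𝓝 (w : Vec n)) := by
        have h2 : ContinuousAt (fun x : S => κ x) (X' w) :=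
          ContinuousAt.comp (g := κ) (hκc w w.2) continuous_subtype_val.continuousAt
        rw [ContinuousAt, show κ (X' w) = w from hκX w w.2] at h2
        exact h2.mono_left nhdsWithin_le_nhds
      refine h1.congr' ?_
      filter_upwards [self_mem_nhdsWithin]
      rintro _ ⟨w', rfl⟩
      simp [X', hκX w' w'.2]
  refine ⟨range X', ?_, ?_, ⟨⟨_, hdB⟩, Subtype.ext hXd⟩, B, hBc, ⟨_, hdB⟩, ⟨hemb.toHomeomorph⟩⟩
  · rintro _ ⟨w, rfl⟩
    exact hWW' (hX1 w w.2).2.1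
  · rw [isOpen_iff_mem_nhds]
    rintro _ ⟨w, rfl⟩
    have := (continuous_subtype_val.tendsto (X' w)).eventually (hX2 w w.2)
    filter_upwards [this] with x hx
    obtain ⟨w', hw', h⟩ := hx x.2
    exact ⟨⟨w', hw'⟩, Subtype.ext h⟩

lemma IsTotalCrossSection.exists_simplyConnected_nhds (hS : IsTotalCrossSection A S)
    (hΨ : IsRadialFlow A Ψ) (p : S) {W : Set S} (hW : W ∈ 𝓝 p) :
    ∃ U ⊆ W, IsOpen U ∧ p ∈ U ∧ IsSimplyConnected U := by
  obtain ⟨U, hUW, hU, hpU, B, hB, hBne, ⟨e⟩⟩ := hS.exists_convex_nhds hΨ p hW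
  have : ContractibleSpace B := hB.contractibleSpace hBne
  exact ⟨U, hUW, hU, hpU, e.toHomotopyEquiv.simplyConnectedSpace_iff.1 inferInstance⟩

lemma IsTotalCrossSection.locallyPathConnectedSpace (hS : IsTotalCrossSection A S)
    (hΨ : IsRadialFlow A Ψ) : LocallyPathConnectedSpace S := by
  refine ⟨fun p => ⟨fun W => ⟨fun hW => ?_, fun ⟨U, hU, hUW⟩ => mem_of_superset hU.1 hUW⟩⟩⟩
  obtain ⟨U, hUW, hU, hpU, hUs⟩ := hS.exists_simplyConnected_nhds hΨ p hW
  exact ⟨U, ⟨hU.mem_nhds hpU, hUs.isPathConnected⟩, hUW⟩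

lemma IsTotalCrossSection.exists_universal_isCoveringMap {M : Type u} [TopologicalSpace M]
    {A : RadiantAtlas n M} {S : Set M} {Ψ : Flow ℝ M} (hS : IsTotalCrossSection A S)
    (hΨ : IsRadialFlow A Ψ) (hSc : IsConnected S) :
    ∃ (E : Type u) (_ : TopologicalSpace E) (_ : SimplyConnectedSpace E) (q : E → S),
      IsCoveringMap q ∧ Function.Surjective q := by
  have := hS.locallyPathConnectedSpace hΨ
  have : ConnectedSpace S := isConnected_iff_connectedSpace.1 hSc
  have : PathConnectedSpace S := pathConnectedSpace_iff_connectedSpace.2 this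
  refine RadiantAffine.exists_universal_isCoveringMap fun p => ?_
  obtain ⟨U, -, hU, hpU, hUs⟩ := hS.exists_simplyConnected_nhds hΨ p univ_mem
  refine ⟨U, hU, hpU, hUs.isPathConnected, fun a b γ γ' hγ hγ' => ?_⟩
  have := hUs.simplyConnectedSpace
  have ha : a ∈ U := by simpa using hγ 0
  have hb : b ∈ U := by simpa using hγ 1
  let δ : Path (⟨a, ha⟩ : U) ⟨b, hb⟩ :=
    { toFun := fun t => ⟨γ t, hγ t⟩, source' := by simp, target' := by simp }
  let δ' : Path (⟨a, ha⟩ : U) ⟨b, hb⟩ :=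
    { toFun := fun t => ⟨γ' t, hγ' t⟩, source' := by simp, target' := by simp }
  exact (SimplyConnectedSpace.paths_homotopic δ δ').map ⟨Subtype.val, continuous_subtype_val⟩

/-- The charts of the real projective structure of `S` induced by the affine charts of `M`. -/
def inducedCharts (A : RadiantAtlas n M) (S : Set M) : Set (Set S × (S → RP n)) :=
  {c | IsOpen c.1 ∧ IsEmbedding (c.1.domRestrict c.2) ∧
    (∃ H ∈ projectiveModels n, ∃ O : Set (RP n), IsOpen O ∧ c.2 '' c.1 = O ∩ H) ∧
    ∃ a ∈ A.charts, ∀ x ∈ c.1, (x : M) ∈ a.1 ∧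
      ∃ h : a.2 (x : M) ≠ 0, c.2 x = Projectivization.mk ℝ (a.2 (x : M)) h}

/-- The patch over the slice `α = const` is identified by radial projection with a part of the
affine patch `α ≠ 0` of projective space. At a boundary point the half-space `l ≥ 0` becomes `l / α
≥ 0`. -/
lemma IsTotalCrossSection.exists_inducedChart (hS : IsTotalCrossSection A S)
    (hΨ : IsRadialFlow A Ψ) (p : S) : ∃ c ∈ inducedCharts A S, p ∈ c.1 := by
  obtain ⟨c, hc, hp⟩ := A.covers p
  have hd := hS.chart_ne_zero hc hp
  let α : Vec n →ₗ[ℝ] ℝ := (innerSL ℝ (c.2 p) : Vec n →L[ℝ] ℝ)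
  have hαcont : Continuous α := LinearMap.continuous_of_finiteDimensional α
  have hα : 0 < α (c.2 p) := by
    change 0 < inner ℝ (c.2 p) (c.2 p)
    exact real_inner_self_pos.2 hd
  obtain ⟨H, O, X, hH, hO, hOc, hdO, hXd, hXc, hX1, hX2⟩ :=
    hS.exists_patch hΨ p.2 hc hp univ_mem hα
  set B := {w | α w = α (c.2 p)} ∩ (O ∩ H) with hB
  have hdB : c.2 p ∈ B := ⟨rfl, hdO⟩
  have hB0 : ∀ w ∈ B, w ≠ 0 := by
    rintro w hw rfl
    have : α 0 = α (c.2 p) := hw.1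
    rw [map_zero] at this
    exact hα.ne this
  -- the inverse of the projection of the hyperplane to projective space
  let κ : RP n → Vec n := fun y => (α (c.2 p) / α y.rep) • y.rep
  have hκmk : ∀ (v : Vec n) (hv : v ≠ 0), κ (Projectivization.mk ℝ v hv) =
      (α (c.2 p) / α v) • v := by
    intro v hv
    obtain ⟨a, ha, h⟩ := exists_rep_mk_eq_smul hv
    simp only [κ]
    rw [h, map_smul, smul_eq_mul, smul_smul]
    congr 1
    rw [div_mul_eq_mul_div, mul_comm a, mul_div_mul_right _ _ ha]
  have hκc : ∀ (v : Vec n) (hv : v ≠ 0), α v ≠ 0 →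
      ContinuousAt κ (Projectivization.mk ℝ v hv) := by
    intro v hv hαv
    have h := isOpenQuotientMap_projectivization_mk (n := n)
    have h1 : ContinuousAt (κ ∘ fun v : {v : Vec n // v ≠ 0} =>
        (Projectivization.mk ℝ v.1 v.2 : RP n)) ⟨v, hv⟩ := by
      have h2 : ContinuousAt (fun v : {v : Vec n // v ≠ 0} => (α (c.2 p) / α v.1) • v.1)
          ⟨v, hv⟩ :=
        (continuousAt_const.div (f := fun _ => α (c.2 p)) (g := fun v : {v : Vec n // v ≠ 0} => α v.1)
          (hαcont.comp continuous_subtype_val).continuousAt hαv).smul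
            continuous_subtype_val.continuousAt
      exact h2.congr (Eventually.of_forall fun w => (hκmk w.1 w.2).symm)
    exact (h.continuousAt_comp_iff).1 h1
  have hκB : ∀ w (hw : w ∈ B), κ (Projectivization.mk ℝ w (hB0 w hw)) = w := by
    intro w hw
    have hwα : α w = α (c.2 p) := hw.1
    rw [hκmk, hwα, div_self hα.ne', one_smul]
  let X' : B → S := fun w => ⟨X w, (hX1 w w.2).1⟩
  classical
  let f : S → RP n := fun x => if h : c.2 (x : M) ≠ 0 then Projectivization.mk ℝ _ h else
    Projectivization.mk ℝ _ hd
  have hfX : ∀ w (hw : w ∈ B), f ⟨X w, (hX1 w hw).1⟩ = Projectivization.mk ℝ w (hB0 w hw) := by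
    intro w hw
    obtain ⟨-, -, h3, r, hr, h⟩ := hX1 w hw
    simp only [f, hS.chart_ne_zero hc h3, ne_eq, not_false_eq_true, dif_pos]
    rw [Projectivization.mk_eq_mk_iff']
    exact ⟨r, h.symm⟩
  have hfc : ∀ x : S, (x : M) ∈ c.1 → ContinuousAt f x := by
    intro x hx
    have hx0 := hS.chart_ne_zero hc hx
    have h1 : ContinuousAt (fun x : S => c.2 (x : M)) x :=
      (A.continuousAt hc hx).comp continuous_subtype_val.continuousAt
    have h2 : ContinuousAt (fun x : S => (if h : c.2 (x : M) ≠ 0 then ⟨c.2 (x : M), h⟩ else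
        ⟨_, hd⟩ : {v : Vec n // v ≠ 0})) x := by
      refine IsInducing.subtypeVal.continuousAt_iff.2 ?_
      refine h1.congr ?_
      filter_upwards [h1.eventually_ne hx0] with y hy
      simp [hy]
    have h3 := (continuous_projectivization_mk (n := n)).continuousAt.comp h2
    refine h3.congr (Eventually.of_forall fun y => ?_)
    by_cases hy : c.2 (y : M) = 0 <;> simp [f, hy]
  have hrange : ∀ x : S, x ∈ range X' → (x : M) ∈ c.1 := by
    rintro _ ⟨w, rfl⟩
    exact (hX1 w w.2).2.2.1
  refine ⟨(range X', f), ⟨?_, ?_, ?_, c, hc, ?_⟩, ⟨_, hdB⟩, Subtype.ext hXd⟩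
  · rw [isOpen_iff_mem_nhds]
    rintro _ ⟨w, rfl⟩
    have := (continuous_subtype_val.tendsto (X' w)).eventually (hX2 w w.2)
    filter_upwards [this] with x hx
    obtain ⟨w', hw', h⟩ := hx x.2
    exact ⟨⟨w', hw'⟩, Subtype.ext h⟩
  · refine isEmbedding_of_leftInverse (g := fun y => if h : κ y ∈ B then
      (⟨X' ⟨κ y, h⟩, mem_range_self _⟩ : range X') else ⟨X' ⟨_, hdB⟩, mem_range_self _⟩) ?_ ?_ ?_
    · rw [continuous_iff_continuousAt]
      intro x
      exact ContinuousAt.comp (g := f) (hfc x (hrange x x.2)) continuous_subtype_val.continuousAt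
    · rintro ⟨_, w, rfl⟩
      have h : κ (f (X' w)) = w := by
        change κ (f ⟨X w, _⟩) = _
        rw [hfX w w.2, hκB w w.2]
      simp [Set.domRestrict, h]
    · rintro ⟨_, w, rfl⟩
      rw [IsInducing.subtypeVal.tendsto_nhds_iff, IsInducing.subtypeVal.tendsto_nhds_iff]
      have hfw : f (X' w) = Projectivization.mk ℝ (w : Vec n) (hB0 w w.2) := hfX w w.2
      have hwα : α w = α (c.2 p) := w.2.1
      have h1 : Tendsto κ (𝓝[range ((range X').domRestrict f)] (f (X' w))) (𝓝[B] (w : Vec n)) := by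
        refine tendsto_nhdsWithin_iff.2 ⟨?_, ?_⟩
        · have := hκc w (hB0 w w.2) (by rw [hwα]; exact hα.ne')
          rw [ContinuousAt, hκB w w.2] at this
          rw [hfw]
          exact this.mono_left nhdsWithin_le_nhds
        · filter_upwards [self_mem_nhdsWithin]
          rintro _ ⟨⟨_, w', rfl⟩, rfl⟩
          change κ (f ⟨X w', _⟩) ∈ B
          rw [hfX w' w'.2, hκB w' w'.2]
          exact w'.2
      have h2 := (hXc w w.2).tendsto.comp h1
      refine h2.congr' ?_
      filter_upwards [h1.eventually self_mem_nhdsWithin] with y hy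
      have hy' : κ y ∈ B := hy
      simp [hy', X']
  · have hO' : IsOpen {v : Vec n | α v ≠ 0 ∧ (α (c.2 p) / α v) • v ∈ O} := by
      have ho : IsOpen {v : Vec n | α v ≠ 0} := isOpen_ne_fun hαcont continuous_const
      have hc' : ContinuousOn (fun v : Vec n => (α (c.2 p) / α v) • v) {v : Vec n | α v ≠ 0} :=
        (continuousOn_const.div hαcont.continuousOn fun v hv => hv).smul continuousOn_id
      exact hc'.isOpen_inter_preimage ho hO
    have himg : ∀ (v : Vec n) (hv : v ≠ 0), α v ≠ 0 → (α (c.2 p) / α v) • v ∈ O →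
        (α (c.2 p) / α v) • v ∈ H → Projectivization.mk ℝ v hv ∈ f '' range X' := by
      intro v hv h1 h2 h3
      have hw : (α (c.2 p) / α v) • v ∈ B := by
        refine ⟨?_, h2, h3⟩
        change α _ = _
        rw [map_smul, smul_eq_mul, div_mul_cancel₀ _ h1]
      refine ⟨_, ⟨⟨_, hw⟩, rfl⟩, ?_⟩
      change f ⟨X _, _⟩ = _
      rw [hfX _ hw, Projectivization.mk_eq_mk_iff']
      exact ⟨_, rfl⟩
    rcases hH with rfl | ⟨l, hl, hl0, rfl⟩
    · refine ⟨univ, Or.inl rfl, _, isOpen_image_projectivization_mk hO', ?_⟩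
      rw [inter_univ]
      apply Subset.antisymm
      · rintro _ ⟨_, ⟨w, rfl⟩, rfl⟩
        have hwα : α w = α (c.2 p) := w.2.1
        refine ⟨w, hB0 w w.2, ⟨by rw [hwα]; exact hα.ne', ?_⟩, (hfX w w.2).symm⟩
        rw [hwα, div_self hα.ne', one_smul]
        exact w.2.2.1
      · rintro _ ⟨v, hv, ⟨h1, h2⟩, rfl⟩
        exact himg v hv h1 h2 (mem_univ _)
    · refine ⟨_, Or.inr ⟨α, l, ?_, rfl⟩, _, isOpen_image_projectivization_mk hO', ?_⟩
      -- Evaluating at `c.2 p`, where `l` vanishes and `α` does not, removes the coefficient of `α`.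
      · rw [LinearIndependent.pair_iff]
        intro s t hst
        have h1 := congrArg (fun φ : Vec n →ₗ[ℝ] ℝ => φ (c.2 p)) hst
        simp only [LinearMap.add_apply, LinearMap.smul_apply, smul_eq_mul, hl0, mul_zero, add_zero,
          LinearMap.zero_apply, mul_eq_zero, hα.ne', or_false] at h1
        subst h1
        rw [zero_smul, zero_add, smul_eq_zero] at hst
        exact ⟨rfl, hst.resolve_right hl⟩
      apply Subset.antisymm
      · rintro _ ⟨_, ⟨w, rfl⟩, rfl⟩
        have hwα : α w = α (c.2 p) := w.2.1
        have hwl : 0 ≤ l w := w.2.2.2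
        refine ⟨⟨w, hB0 w w.2, ⟨by rw [hwα]; exact hα.ne', ?_⟩, (hfX w w.2).symm⟩, ?_⟩
        · rw [hwα, div_self hα.ne', one_smul]
          exact w.2.2.1
        · change f ⟨X w, _⟩ ∈ _
          rw [hfX w w.2, mk_mem_projectiveHalfSpace, hwα]
          exact ⟨hα.ne', div_nonneg hwl hα.le⟩
      · rintro _ ⟨⟨v, hv, ⟨h1, h2⟩, rfl⟩, h3⟩
        rw [mk_mem_projectiveHalfSpace] at h3
        refine himg v hv h1 h2 ?_
        change 0 ≤ l _
        rw [map_smul, smul_eq_mul, div_mul_eq_mul_div, mul_div_assoc]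
        exact mul_nonneg hα.le h3.2
  · intro x hx
    refine ⟨hrange x hx, hS.chart_ne_zero hc (hrange x hx), ?_⟩
    simp [f, hS.chart_ne_zero hc (hrange x hx)]

/-- The real projective structure on a total cross-section. -/
def inducedAtlas (hS : IsTotalCrossSection A S) (hΨ : IsRadialFlow A Ψ) : ProjectiveAtlas n S where
  charts := inducedCharts A S
  covers := hS.exists_inducedChart hΨ
  isOpen_source _ hc := hc.1
  isEmbedding _ hc := hc.2.1
  image_eq _ hc := hc.2.2.1
  compatible := by
    rintro c ⟨hc, -, -, a, ha, hca⟩ c' ⟨hc', -, -, a', ha', hca'⟩ p ⟨hp, hp'⟩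
    obtain ⟨g, hg⟩ := exists_transition A ha ha' (hca p hp).1 (hca' p hp').1
    refine ⟨g, ?_⟩
    filter_upwards [hc.mem_nhds hp, hc'.mem_nhds hp',
      (continuous_subtype_val.tendsto p).eventually hg] with x hx hx' hgx
    obtain ⟨-, h, h1⟩ := hca x hx
    obtain ⟨-, h', h1'⟩ := hca' x hx'
    rw [h1, h1']
    simp only [hgx]
    rfl

lemma crossSectionEquiv_inducedAtlas (hS : IsTotalCrossSection A S) (hΨ : IsRadialFlow A Ψ) :
    CrossSectionEquiv A S (inducedAtlas hS hΨ) := by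
  refine ⟨Homeomorph.refl S, ?_⟩
  rintro p c hc hp c' ⟨hc', -, -, a', ha', hca'⟩ hp'
  obtain ⟨g, hg⟩ := exists_transition A hc ha' hp (hca' p hp').1
  refine ⟨g, ?_⟩
  filter_upwards [hc'.mem_nhds hp', (continuous_subtype_val.tendsto p).eventually hg,
    (continuous_subtype_val.tendsto p).eventually (A.source_mem_nhds hc hp)] with x hx hgx hxc
  refine ⟨hS.chart_ne_zero hc hxc, ?_⟩
  obtain ⟨-, h', h1'⟩ := hca' x hx
  change c'.2 x = _
  rw [h1']
  simp only [hgx]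
  rfl

/-- A connected component of a total cross-section is a total cross-section. -/
lemma IsTotalCrossSection.component [T2Space M] [CompactSpace M] [ConnectedSpace M]
    (hS : IsTotalCrossSection A S) (hΨ : IsRadialFlow A Ψ) (p₀ : S) :
    IsTotalCrossSection A (Subtype.val '' connectedComponent p₀) := by
  have := hS.locallyPathConnectedSpace hΨ
  refine ⟨hS.isClosed.isClosedEmbedding_subtypeVal.isClosedMap _ isClosed_connectedComponent,
    ?_, ?_⟩
  · rintro _ ⟨p, hp, rfl⟩
    obtain ⟨c, hc, hpc, K, hK, hK1, hK2⟩ := hS.transverse p p.2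
    refine ⟨c, hc, hpc, K, hK, hK1, ?_⟩
    -- Components are open in `S` by local connectedness, so near `p` the component and `S` have the
    -- same defining function.
    have h1 : connectedComponent p₀ ∈ 𝓝 p := isOpen_connectedComponent.mem_nhds hp
    obtain ⟨V, hV, hVC⟩ := mem_nhds_subtype S p _ |>.1 h1
    filter_upwards [hK2, hV] with x hx hxV
    rw [← hx]
    constructor
    · rintro ⟨y, -, rfl⟩
      exact y.2
    · intro hxS
      exact ⟨⟨x, hxS⟩, hVC hxV, rfl⟩
  · intro γ hγ
    obtain ⟨t, ht⟩ := (hS.isFlowSection hΨ).component_meets p₀ (γ 0)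
    exact ⟨t, by rwa [hΨ.eq_of_isRadialFlowLine hγ]⟩

end CrossSectionStructure

end RadiantAffine

namespace RadiantAffine

/-! ### The suspension data of a total cross-section -/

/-- `D` develops `f : E → M` into `ℝⁿ`. -/
def IsDeveloping {n : ℕ} {M E : Type*} [TopologicalSpace M] [TopologicalSpace E]
    (A : RadiantAtlas n M) (f : E → M) (D : E → Vec n) : Prop :=
  ∀ x, ∀ c ∈ A.charts, f x ∈ c.1 → ∃ g : GLn n, ∀ᶠ y in 𝓝 x, D y = g (c.2 (f y))

section Developing

variable {n : ℕ} {M : Type u} [TopologicalSpace M] {A : RadiantAtlas n M} {S : Set M}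
  {Ψ : Flow ℝ M} {E : Type u} [TopologicalSpace E] {q : E → S} {D D' : E → Vec n}

lemma GLn.continuous (g : GLn n) : Continuous g :=
  LinearMap.continuous_of_finiteDimensional (g : Vec n →ₗ[ℝ] Vec n)

lemma IsDeveloping.continuous {f : E → M} (hf : Continuous f) (hD : IsDeveloping A f D) :
    Continuous D := by
  rw [continuous_iff_continuousAt]
  intro x
  obtain ⟨c, hc, hx⟩ := A.covers (f x)
  obtain ⟨g, hg⟩ := hD x c hc hx
  have h : ContinuousAt (fun y => g (c.2 (f y))) x :=
    (GLn.continuous g).continuousAt.comp ((A.continuousAt hc hx).comp hf.continuousAt)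
  exact h.congr (hg.mono fun y hy => hy.symm)

lemma IsDeveloping.ne_zero (hS : IsTotalCrossSection A S) {f : E → M} (hD : IsDeveloping A f D)
    (x : E) : D x ≠ 0 := by
  obtain ⟨c, hc, hx⟩ := A.covers (f x)
  obtain ⟨g, hg⟩ := hD x c hc hx
  rw [hg.self_of_nhds, ne_eq, LinearEquiv.map_eq_zero_iff]
  exact hS.chart_ne_zero hc hx

/-- A neighbourhood in `M` is swept out from `S` by the flow, and linear maps commute with the
scalars by which the flow acts. Hence agreement along the hypersurface is enough. -/
lemma IsTotalCrossSection.linearEquiv_eq_of_eventually [T2Space M] (hS : IsTotalCrossSection A S)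
    (hΨ : IsRadialFlow A Ψ) {c : Set M × (M → Vec n)} (hc : c ∈ A.charts) {p : S}
    (hp : (p : M) ∈ c.1) {g g' : GLn n}
    (h : ∀ᶠ x : S in 𝓝 p, g (c.2 (x : M)) = g' (c.2 (x : M))) : g = g' := by
  refine RadiantAffine.linearEquiv_eq_of_eventually A hc hp ?_
  obtain ⟨τ, hτ, hτ0, hτ1⟩ := (hS.isFlowSection hΨ).box p p.2
  have hz : Tendsto (fun x : M => (τ x, x)) (𝓝 (p : M)) (𝓝 ((0 : ℝ), (p : M))) := by
    have := hτ.prodMk continuousAt_id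
    rw [ContinuousAt, hτ0] at this
    exact this
  have hz2 : Tendsto (fun x : M => Ψ (τ x) x) (𝓝 (p : M)) (𝓝 (p : M)) := by
    have h1 : Continuous fun z : ℝ × M => Ψ z.1 z.2 := Ψ.continuous continuous_fst continuous_snd
    have h2 := (h1.tendsto ((0 : ℝ), (p : M))).comp hz
    simpa [Function.comp_def, Flow.map_zero_apply] using h2
  obtain ⟨V, hV, hVh⟩ := mem_nhds_subtype S p _ |>.1 h
  filter_upwards [hz.eventually hτ1, hz.eventually (hΨ.eventually_chart_eq hc hp),
    hz2.eventually hV] with x h1 h2 h3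
  have h4 : g (c.2 (Ψ (τ x) x)) = g' (c.2 (Ψ (τ x) x)) := @hVh ⟨_, h1.2 rfl⟩ h3
  rw [h2.2.2, map_smul, map_smul] at h4
  exact smul_right_injective _ (Real.exp_pos (τ x)).ne' h4

/-- A covering maps neighbourhoods onto neighbourhoods, so agreement on the developed image near `x`
becomes agreement in a chart along `S`. -/
lemma IsDeveloping.unique [T2Space M] (hS : IsTotalCrossSection A S) (hΨ : IsRadialFlow A Ψ)
    (hq : IsCoveringMap q) (hD : IsDeveloping A (fun x => (q x : M)) D) {x : E} {h h' : GLn n}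
    (he : ∀ᶠ y in 𝓝 x, h (D y) = h' (D y)) : h = h' := by
  obtain ⟨c, hc, hx⟩ := A.covers (q x : M)
  obtain ⟨g, hg⟩ := hD x c hc hx
  have h1 : g.trans h = g.trans h' := by
    refine hS.linearEquiv_eq_of_eventually hΨ hc hx ?_
    have h2 : ∀ᶠ y in 𝓝 x, (g.trans h) (c.2 (q y : M)) = (g.trans h') (c.2 (q y : M)) := by
      filter_upwards [he, hg] with y h3 h4
      rw [LinearEquiv.trans_apply, LinearEquiv.trans_apply, ← h4, h3]
    rw [← hq.isLocalHomeomorph.map_nhds_eq x]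
    exact h2
  ext1 v
  obtain ⟨w, rfl⟩ := g.surjective v
  exact LinearEquiv.congr_fun h1 w

/-- Two developing maps differ by a linear map. -/
lemma IsDeveloping.exists_linearEquiv [T2Space M] [PreconnectedSpace E] [Nonempty E]
    (hS : IsTotalCrossSection A S) (hΨ : IsRadialFlow A Ψ) (hq : IsCoveringMap q)
    (hD : IsDeveloping A (fun x => (q x : M)) D) (hD' : IsDeveloping A (fun x => (q x : M)) D') :
    ∃ h : GLn n, ∀ x, D' x = h (D x) := by
  have hloc : ∀ x, ∃ h : GLn n, ∀ᶠ y in 𝓝 x, D' y = h (D y) := by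
    intro x
    obtain ⟨c, hc, hx⟩ := A.covers (q x : M)
    obtain ⟨g, hg⟩ := hD x c hc hx
    obtain ⟨g', hg'⟩ := hD' x c hc hx
    refine ⟨g.symm.trans g', ?_⟩
    filter_upwards [hg, hg'] with y h1 h2
    rw [h1, h2, LinearEquiv.trans_apply, LinearEquiv.symm_apply_apply]
  choose h hh using hloc
  have hlc : IsLocallyConstant h := by
    rw [IsLocallyConstant.iff_eventually_eq]
    intro x
    filter_upwards [(hh x).eventually_nhds] with y hy
    refine hD.unique hS hΨ hq (x := y) ?_
    filter_upwards [hy, hh y] with z h1 h2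
    rw [← h1, ← h2]
  obtain ⟨x₀⟩ := (inferInstance : Nonempty E)
  refine ⟨h x₀, fun x => ?_⟩
  rw [hlc.apply_eq_of_preconnectedSpace x₀ x]
  exact (hh x).self_of_nhds

lemma norm_inv_smul_map (h : GLn n) {a : ℝ} (ha : 0 < a) {v : Vec n} :
    ‖h (a • v)‖⁻¹ • h (a • v) = ‖h v‖⁻¹ • h v := by
  rw [map_smul, norm_smul, Real.norm_of_nonneg ha.le, smul_smul, mul_inv, mul_right_comm,
    inv_mul_cancel₀ ha.ne', one_mul]

lemma log_norm_map_inv_smul (h : GLn n) {v : Vec n} (hv : v ≠ 0) :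
    Real.log ‖h v‖ = Real.log ‖v‖ + Real.log ‖h (‖v‖⁻¹ • v)‖ := by
  have h1 : 0 < ‖v‖ := norm_pos_iff.2 hv
  have h2 : 0 < ‖h v‖ := norm_pos_iff.2 (by simpa using hv)
  rw [map_smul, norm_smul, norm_inv, norm_norm, ← Real.log_mul h1.ne' (by positivity)]
  congr 1
  field_simp

lemma smul_projectivization_mk_eq (g : GLn n) {v w : Vec n} (hv : v ≠ 0) (hw : w ≠ 0) (a : ℝ)
    (h : a • w = g v) : g • (Projectivization.mk ℝ v hv : RP n) = Projectivization.mk ℝ w hw :=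
  (Projectivization.mk_eq_mk_iff' ℝ (g v) w (by simpa using hv) hw).2 ⟨a, h⟩

/-- The developing map `D` of `S` supplies all the data: its direction is `dev`, the logarithm of
its length is `sec`, and its equivariance gives `hol` and `ρ`. Since `R` runs backwards along the
flow, `sec ∘ φLift` falls short of the moved section by exactly the return time, which is positive.
-/
theorem exists_suspensionData [T2Space M] [SimplyConnectedSpace E] [LocallyPathConnectedSpace E]
    (hS : IsTotalCrossSection A S) (hΨ : IsRadialFlow A Ψ) (hq : IsCoveringMap q)
    (hqs : Function.Surjective q) {R : S ≃ₜ S} {r : S → ℝ} (hrc : Continuous r) (hr : ∀ p, 0 < r p)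
    (hR : ∀ p : S, (R p : M) = Ψ (-r p) p) :
    ∃ d : SuspensionData (inducedAtlas hS hΨ) E,
      IsDeveloping A (fun x => (d.q x : M)) (fun x => Real.exp (d.sec x) • (d.dev x : Vec n)) ∧
      (∀ x, d.q (d.φLift x) = R (d.q x)) ∧
      ∀ x, d.sec (d.φLift x) = d.sec x + Real.log ‖d.ρ (d.dev x)‖ - r (d.q x) := by
  have hqc : Continuous fun x => (q x : M) := continuous_subtype_val.comp hq.continuous
  obtain ⟨D, hD⟩ : ∃ D, IsDeveloping A (fun x => (q x : M)) D := exists_developing_map A hqc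
  have hDc : Continuous D := hD.continuous hqc
  have hD0 : ∀ x, D x ≠ 0 := hD.ne_zero hS
  have hDp : ∀ x, 0 < ‖D x‖ := fun x => norm_pos_iff.2 (hD0 x)
  obtain ⟨x₀⟩ := (inferInstance : Nonempty E)
  -- the holonomy
  have hdeck : ∀ γ : deckGroup q, ∃ h : GLn n, ∀ x, D ((γ : E ≃ₜ E) x) = h (D x) := by
    intro γ
    refine hD.exists_linearEquiv hS hΨ hq (D' := fun x => D ((γ : E ≃ₜ E) x)) fun x c hc hx => ?_
    obtain ⟨g, hg⟩ := hD ((γ : E ≃ₜ E) x) c hc (by simpa only [γ.2 x] using hx)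
    refine ⟨g, ?_⟩
    filter_upwards [(γ : E ≃ₜ E).continuous.continuousAt.eventually hg] with y hy
    rw [hy, γ.2 y]
  choose hol hhol using hdeck
  have huniq : ∀ h h' : GLn n, (∀ x, h (D x) = h' (D x)) → h = h' := fun h h' he =>
    hD.unique hS hΨ hq (x := x₀) (Eventually.of_forall he)
  -- the lift of the return map
  obtain ⟨x₁, hx₁⟩ := hqs (R (q x₀))
  obtain ⟨φL, -, hφL⟩ := exists_homeomorph_lift hq R hx₁
  -- Flowing back by `r` divides chart vectors by `exp r`, up to a linear map. The factor `exp r`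
  -- undoes this, so both sides develop the same map and differ linearly.
  obtain ⟨ρ, hρ⟩ : ∃ ρ : GLn n, ∀ x, Real.exp (r (q x)) • D (φL x) = ρ (D x) := by
    refine hD.exists_linearEquiv hS hΨ hq (D' := fun x => Real.exp (r (q x)) • D (φL x))
      fun x c hc hx => ?_
    obtain ⟨c', hc', hx'⟩ := A.covers (q (φL x) : M)
    obtain ⟨g, hg⟩ := hD (φL x) c' hc' hx'
    have hx'' : Ψ (-r (q x)) (q x) ∈ c'.1 := by rw [← hR, ← hφL]; exact hx'
    obtain ⟨g', hg', -⟩ := hΨ.exists_germ (isParallelField_zero A) hc hx _ hc' hx''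
    have ht : Tendsto (fun y => (-r (q y), (q y : M))) (𝓝 x) (𝓝 (-r (q x), (q x : M))) :=
      ((hrc.comp hq.continuous).neg.prodMk hqc).tendsto x
    refine ⟨g'.trans g, ?_⟩
    filter_upwards [φL.continuous.continuousAt.eventually hg, ht.eventually hg'] with y h1 h2
    rw [h1, hφL, hR, h2, map_smul, map_smul, smul_smul, ← Real.exp_add, add_neg_cancel,
      Real.exp_zero, one_smul, LinearEquiv.trans_apply]
  have hsph : ∀ x, ‖D x‖⁻¹ • D x ∈ Metric.sphere (0 : Vec n) 1 := fun x => by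
    rw [mem_sphere_zero_iff_norm, norm_smul, norm_inv, norm_norm, inv_mul_cancel₀ (hDp x).ne']
  have hnc : Continuous fun x => ‖D x‖⁻¹ • D x := (hDc.norm.inv₀ fun x => (hDp x).ne').smul hDc
  let dev : C(E, Metric.sphere (0 : Vec n) 1) := ⟨fun x => ⟨‖D x‖⁻¹ • D x, hsph x⟩,
    hnc.subtype_mk hsph⟩
  have hdev : ∀ x, (dev x : Vec n) = ‖D x‖⁻¹ • D x := fun _ => rfl
  have hexp : ∀ x, Real.exp (Real.log ‖D x‖) • (dev x : Vec n) = D x := by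
    intro x
    rw [Real.exp_log (hDp x), hdev, smul_smul, mul_inv_cancel₀ (hDp x).ne', one_smul]
  have hρn : ∀ x, Real.log ‖D (φL x)‖ =
      Real.log ‖D x‖ + Real.log ‖ρ (dev x)‖ - r (q x) := by
    intro x
    rw [hdev, ← log_norm_map_inv_smul ρ (hD0 x), ← hρ, norm_smul, Real.norm_of_nonneg
      (Real.exp_pos _).le, Real.log_mul (Real.exp_pos _).ne' (hDp _).ne', Real.log_exp]
    ring
  let holHom : deckGroup q →* GLn n :=
    { toFun := hol
      map_one' := huniq _ _ fun x => by rw [← hhol]; rfl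
      map_mul' := fun γ γ' => huniq _ _ fun x => by
        rw [← hhol, LinearEquiv.mul_apply, ← hhol, ← hhol]; rfl }
  refine ⟨{ q := q
            isCoveringMap := hq
            surjective := hqs
            dev := dev
            dev_chart := ?_
            hol := holHom
            dev_hol := ?_
            φ := R
            φ_projective := ?_
            φLift := φL
            q_φLift := hφL
            ρ := ρ
            dev_φLift := ?_
            det_invariant := ?_
            sec := fun x => Real.log ‖D x‖
            sec_smooth := ?_
            sec_equivariant := ?_
            sec_outward := ?_ }, ?_, hφL, hρn⟩
  · rintro x c ⟨hco, -, -, a, ha, hca⟩ hx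
    obtain ⟨g, hg⟩ := hD x a ha (hca _ hx).1
    refine ⟨g.symm, ?_⟩
    filter_upwards [hg, hq.continuous.continuousAt.eventually (hco.mem_nhds hx)] with y h1 h2
    have hdy : (dev y : Vec n) ≠ 0 := smul_ne_zero (inv_ne_zero (hDp y).ne') (hD0 y)
    refine ⟨hdy, ?_⟩
    obtain ⟨-, h3, h4⟩ := hca _ h2
    rw [h4]
    refine (smul_projectivization_mk_eq _ _ _ ‖D y‖⁻¹ ?_).symm
    rw [hdev, map_smul, h1, LinearEquiv.symm_apply_apply]
  · intro γ x
    rw [hdev, hdev, hhol]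
    exact (norm_inv_smul_map (hol γ) (inv_pos.2 (hDp x))).symm
  · rintro p c ⟨hco, -, -, a, ha, hca⟩ hp c' ⟨hco', -, -, a', ha', hca'⟩ hp'
    have hp'' : Ψ (-r p) p ∈ a'.1 := by rw [← hR]; exact (hca' _ hp').1
    obtain ⟨g, hg, -⟩ := hΨ.exists_germ (isParallelField_zero A) ha (hca _ hp).1 _ ha' hp''
    refine ⟨g, ?_⟩
    have ht : Tendsto (fun y : S => (-r y, (y : M))) (𝓝 p) (𝓝 (-r p, (p : M))) :=
      (hrc.neg.prodMk continuous_subtype_val).tendsto p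
    filter_upwards [hco.mem_nhds hp, R.continuous.continuousAt.eventually (hco'.mem_nhds hp'),
      ht.eventually hg] with x h1 h2 h3
    obtain ⟨-, h4, h5⟩ := hca _ h1
    obtain ⟨-, h6, h7⟩ := hca' _ h2
    rw [h5, h7]
    refine (smul_projectivization_mk_eq _ _ _ (Real.exp (r x)) ?_).symm
    rw [hR, h3, map_smul, smul_smul, ← Real.exp_add, add_neg_cancel, Real.exp_zero, one_smul]
  · intro x
    rw [hdev, hdev]
    have h1 : D (φL x) = Real.exp (-r (q x)) • ρ (D x) := by
      rw [← hρ, smul_smul, ← Real.exp_add, neg_add_cancel, Real.exp_zero, one_smul]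
    have h2 := norm_inv_smul_map ρ (inv_pos.2 (hDp x)) (v := D x)
    have h3 := norm_inv_smul_map ρ (Real.exp_pos (-r (q x))) (v := D x)
    rw [map_smul] at h3
    rw [h2, h1, h3]
  · intro γ γ' hγ
    -- The return time depends only on the point of `S`, so its factor is the same on both sides.
    -- Thus `hol γ'` is an honest conjugate of `hol γ`.
    have h1 : (ρ.trans (hol γ')) = (hol γ).trans ρ := by
      refine huniq _ _ fun x => ?_
      rw [LinearEquiv.trans_apply, LinearEquiv.trans_apply, ← hρ, map_smul, ← hhol, ← hhol, ← hρ,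
        hγ, γ.2 x]
    have h2 : (hol γ' : Vec n →ₗ[ℝ] Vec n) =
        (ρ : Vec n →ₗ[ℝ] Vec n) ∘ₗ (hol γ : Vec n →ₗ[ℝ] Vec n) ∘ₗ (ρ.symm : Vec n →ₗ[ℝ] Vec n) := by
      ext1 v
      have := LinearEquiv.congr_fun h1 (ρ.symm v)
      simpa using this
    change |LinearMap.det (hol γ' : Vec n →ₗ[ℝ] Vec n)| =
      |LinearMap.det (hol γ : Vec n →ₗ[ℝ] Vec n)|
    rw [h2, LinearMap.det_conj]
  · intro x
    obtain ⟨c, hc, hx⟩ := A.covers (q x : M)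
    obtain ⟨g, hg⟩ := hD x c hc hx
    obtain ⟨K, hK, hK1, hK2⟩ := hS.transverse_chart (q x).2 hc hx
    let g' : Vec n →L[ℝ] Vec n := LinearMap.toContinuousLinearMap (g.symm : Vec n →ₗ[ℝ] Vec n)
    have hg' : ∀ y, D y = g (c.2 (q y : M)) → g' (D y) = c.2 (q y : M) := by
      intro y hy
      rw [hy]
      exact g.symm_apply_apply _
    -- Since `q y ∈ S`, the number `s = log ‖D y‖` solves `K (g' (exp s • dev y)) = 0`; the implicit
    -- solution shows that it is a smooth function of `dev y`.
    obtain ⟨σ, hσ, -, hσ1⟩ := exists_contDiff_radial_time (hK.comp g'.contDiff) (dev x : Vec n)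
      (Real.log ‖D x‖)
      (by
        rw [hexp, Function.comp_apply, hg' x hg.self_of_nhds]
        exact hK2.self_of_nhds.1 (q x).2)
      (by
        rw [hexp, fderiv_comp _ (hK.differentiable (by simp)).differentiableAt
          g'.differentiableAt, ContinuousLinearMap.fderiv, ContinuousLinearMap.comp_apply,
          hg' x hg.self_of_nhds]
        exact hK1)
    refine ⟨σ, hσ, ?_⟩
    have ht : Tendsto (fun y => ((dev y : Vec n), Real.log ‖D y‖)) (𝓝 x)
        (𝓝 ((dev x : Vec n), Real.log ‖D x‖)) :=
      ((continuous_subtype_val.comp dev.continuous).prodMk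
        (hDc.norm.log fun y => (hDp y).ne')).tendsto x
    filter_upwards [hg, ht.eventually hσ1, hqc.continuousAt.eventually hK2] with y h1 h2 h3
    refine h2.1 ?_
    rw [hexp, Function.comp_apply, hg' y h1]
    exact h3.1 (q y).2
  · intro γ x
    rw [hhol, log_norm_map_inv_smul (hol γ) (hD0 x)]
    rfl
  · intro x
    rw [hρn]
    linarith [hr (q x)]
  · simp only [hexp]
    exact hD

end Developing

end RadiantAffine

namespace RadiantAffine

/-! ### A manifold with a total cross-section is a suspension -/

/-- The flow box gives a local right inverse that is continuous at the point in question: flow back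
by `s`, then move along the orbit to the section. -/
lemma IsFlowSection.isOpenMap {X : Type*} [TopologicalSpace X] {Ψ : Flow ℝ X} {S : Set X}
    (hS : IsFlowSection Ψ S) : IsOpenMap fun z : S × ℝ => Ψ z.2 z.1 := by
  have hc : Continuous fun z : ℝ × X => Ψ z.1 z.2 := Ψ.continuous continuous_fst continuous_snd
  refine IsOpenMap.of_nhds_le ?_
  rintro ⟨p, s⟩
  -- near `p`, the points of the section on nearby flow lines
  obtain ⟨τ, hτ, hτ0, hτ1⟩ := hS.box p p.2
  have hhit := IsFlowSection.eventually_hit hτ hτ0 hτ1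
  classical
  let π : X → S := fun x => if h : Ψ (τ x) x ∈ S then ⟨_, h⟩ else p
  have hπ0 : π p = p := by
    ext
    simp [π, hτ0, Flow.map_zero_apply]
  have hπ : ContinuousAt π p := by
    refine IsInducing.subtypeVal.continuousAt_iff.2 ?_
    have h1 : ContinuousAt (fun x => Ψ (τ x) x) (p : X) :=
      ContinuousAt.comp (g := fun z : ℝ × X => Ψ z.1 z.2) hc.continuousAt (hτ.prodMk continuousAt_id)
    refine h1.congr ?_
    filter_upwards [hhit] with x hx
    simp [π, hx]
  have hk : Tendsto (fun y => (π (Ψ (-s) y), s - τ (Ψ (-s) y))) (𝓝 (Ψ s p)) (𝓝 (p, s)) := by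
    have h1 : Tendsto (fun y => Ψ (-s) y) (𝓝 (Ψ s p)) (𝓝 (p : X)) := by
      have h2 : Continuous fun y => Ψ (-s) y := hc.comp (continuous_const.prodMk continuous_id)
      have h3 := h2.tendsto (Ψ s p)
      rwa [← Ψ.map_add, neg_add_cancel, Flow.map_zero_apply] at h3
    have h4 : Tendsto π (𝓝 (p : X)) (𝓝 p) := by
      have := hπ.tendsto
      rwa [hπ0] at this
    have h5 : Tendsto (fun x => s - τ x) (𝓝 (p : X)) (𝓝 s) := by
      have := (tendsto_const_nhds (x := s)).sub hτ.tendsto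
      rwa [hτ0, sub_zero] at this
    exact (h4.comp h1).prodMk_nhds (h5.comp h1)
  have hright : ∀ᶠ y in 𝓝 (Ψ s p), Ψ (s - τ (Ψ (-s) y)) (π (Ψ (-s) y)) = y := by
    have h1 : Tendsto (fun y => Ψ (-s) y) (𝓝 (Ψ s p)) (𝓝 (p : X)) := by
      have h2 : Continuous fun y => Ψ (-s) y := hc.comp (continuous_const.prodMk continuous_id)
      have h3 := h2.tendsto (Ψ s p)
      rwa [← Ψ.map_add, neg_add_cancel, Flow.map_zero_apply] at h3
    filter_upwards [h1.eventually hhit] with y hy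
    have h2 : (π (Ψ (-s) y) : X) = Ψ (τ (Ψ (-s) y)) (Ψ (-s) y) := by simp [π, hy]
    rw [h2, ← Ψ.map_add, ← Ψ.map_add]
    simp [Flow.map_zero_apply]
  intro U hU
  have h2 := hk.eventually (mem_map.1 hU)
  filter_upwards [h2, hright] with y h3 h4
  rw [← h4]
  exact h3

section Suspension

variable {n : ℕ} {M : Type u} [TopologicalSpace M] {A : RadiantAtlas n M} {S : Set M}
  {Ψ : Flow ℝ M}

/-- A compact manifold with a connected total cross-section `S` is a generalized affine suspension
over `S`. -/
theorem IsTotalCrossSection.isSuspensionOver [T2Space M] [CompactSpace M]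
    (hS : IsTotalCrossSection A S) (hΨ : IsRadialFlow A Ψ) (hSc : IsConnected S) :
    IsSuspensionOver A (inducedAtlas hS hΨ) := by
  have hF := hS.isFlowSection hΨ
  -- The reversed flow is used so that the automorphism of the suspension moves the section
  -- outwards.
  obtain ⟨R, r, hrc, hr, hR⟩ := hF.reverse.exists_return
  obtain ⟨E, _, _, q, hq, hqs⟩ := hS.exists_universal_isCoveringMap hΨ hSc
  have := hS.locallyPathConnectedSpace hΨ
  have hE : LocallyPathConnectedSpace E :=
    IsLocalHomeomorph.locallyPathConnectedSpace hq.isLocalHomeomorph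
  obtain ⟨d, hD, hφ, hsec⟩ := exists_suspensionData hS hΨ hq hqs hrc (fun p => (hr p).1) hR
  have hc : Continuous fun z : ℝ × M => Ψ z.1 z.2 := Ψ.continuous continuous_fst continuous_snd
  have hRΨ : ∀ p : S, (R p : M) = Ψ (-r p) p := hR
  have hDc := hD.continuous (continuous_subtype_val.comp d.isCoveringMap.continuous)
  have hsc : Continuous d.sec := by
    rw [continuous_iff_continuousAt]
    intro x
    obtain ⟨g, hg, hgx⟩ := d.sec_smooth x
    have h1 : Continuous fun y => g (d.dev y) :=
      hg.continuous.comp (continuous_subtype_val.comp d.dev.continuous)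
    exact h1.continuousAt.congr (hgx.mono fun y hy => hy.symm)
  -- The graph of `sec` goes to `S`, and vertical translation goes to the radial flow.
  let f : E × ℝ → M := fun z => Ψ (z.2 - d.sec z.1) (d.q z.1)
  have hfc : Continuous f := hc.comp ((continuous_snd.sub (hsc.comp continuous_fst)).prodMk
    (continuous_subtype_val.comp (d.isCoveringMap.continuous.comp continuous_fst)))
  have hstep : ∀ z z', d.Step z z' → f z = f z' := by
    intro z z' h
    cases h with
    | deck γ x t =>
      simp only [f, d.sec_equivariant]
      rw [γ.2 x]
      congr 1
      ring
    | auto x t =>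
      simp only [f, hsec, hφ, hRΨ]
      rw [← Ψ.map_add]
      congr 1
      ring
  let F : d.Space → M := Quot.lift f hstep
  have hFp : ∀ z, F (d.proj z) = f z := fun _ => rfl
  have hproj : Function.Surjective d.proj := Quot.mk_surjective
  have hprojc : Continuous d.proj := continuous_quot_mk
  have hFc : Continuous F := continuous_quot_lift hstep hfc
  have hfo : IsOpenMap f := by
    have h1 : f = (fun z : S × ℝ => Ψ z.2 z.1) ∘ (Prod.map d.q id) ∘
        skewHomeomorph (Homeomorph.refl E) (fun x => -d.sec x) hsc.neg := by
      funext z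
      simp [f, skewHomeomorph, sub_eq_add_neg]
    rw [h1]
    exact hF.isOpenMap.comp ((d.isCoveringMap.isOpenMap.prodMap IsOpenMap.id).comp
      (Homeomorph.isOpenMap _))
  have hFo : IsOpenMap F := by
    intro U hU
    have h1 : F '' U = f '' (d.proj ⁻¹' U) := by
      rw [← image_preimage_eq U hproj, ← image_comp]
      simp only [preimage_image_preimage]
      rfl
    rw [h1]
    exact hfo _ (hU.preimage hprojc)
  have hFs : Function.Surjective F := by
    intro x
    obtain ⟨t, ht⟩ := hF.meets x
    obtain ⟨e, he⟩ := d.surjective ⟨_, ht⟩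
    refine ⟨d.proj (e, -t + d.sec e), ?_⟩
    rw [hFp]
    simp only [f, he, add_sub_cancel_right]
    rw [← Ψ.map_add, neg_add_cancel, Flow.map_zero_apply]
  have hFi : Function.Injective F := by
    -- the point of the suspension obtained by flowing from a point of `S`
    have hdeck : ∀ e e' t, d.q e = d.q e' → d.proj (e, t + d.sec e) = d.proj (e', t + d.sec e') := by
      intro e e' t h
      obtain ⟨γ, rfl⟩ := exists_deckGroup_apply_eq d.isCoveringMap h
      refine (Quot.sound (SuspensionData.Step.deck γ e (t + d.sec e))).trans ?_
      rw [d.sec_equivariant, ← add_assoc]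
      rfl
    choose lift hlift using d.surjective
    -- The second coordinate is time of the reversed flow, whence the sign. With it the relation of
    -- `eqvGen_of_eq` corresponds to the automorphism of the suspension.
    let G : S × ℝ → d.Space := fun z => d.proj (lift z.1, -z.2 + d.sec (lift z.1))
    have hG : ∀ a b : S × ℝ,
        Relation.EqvGen (fun a b : S × ℝ => b = (R a.1, a.2 - r a.1)) a b → G a = G b := by
      intro a b h
      induction h with
      | rel a b h =>
        subst h
        simp only [G]
        refine (Quot.sound (SuspensionData.Step.auto (lift a.1) _)).trans ?_
        rw [← hdeck (d.φLift (lift a.1)) (lift (R a.1)) _ (by rw [hφ, hlift, hlift]), hsec, hlift]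
        change d.proj _ = d.proj _
        congr 2
        ring
      | refl a => rfl
      | symm a b _ ih => exact ih.symm
      | trans a b c _ _ ih1 ih2 => exact ih1.trans ih2
    have hGp : ∀ e t, d.proj (e, t) = G (d.q e, d.sec e - t) := by
      intro e t
      simp only [G]
      rw [← hdeck e (lift (d.q e)) _ (hlift _).symm]
      congr 2
      ring
    intro a b hab
    obtain ⟨⟨e, t⟩, rfl⟩ := hproj a
    obtain ⟨⟨e', t'⟩, rfl⟩ := hproj b
    rw [hGp, hGp]
    apply hG
    apply hF.reverse.eqvGen_of_eq hrc hr hR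
    change Ψ (-(d.sec e - t)) (d.q e) = Ψ (-(d.sec e' - t')) (d.q e')
    rw [neg_sub, neg_sub]
    exact hab
  let F' : d.Space ≃ₜ M := (Equiv.ofBijective F ⟨hFi, hFs⟩).toHomeomorphOfContinuousOpen hFc hFo
  have hlin : d.IsLinearDiffeo A F' := by
    rintro ⟨x, t⟩ c hc' hz
    obtain ⟨a, ha, hx⟩ := A.covers (d.q x : M)
    obtain ⟨g, hg⟩ := hD x a ha hx
    obtain ⟨g', hg', -⟩ := hΨ.exists_germ (isParallelField_zero A) ha hx (t - d.sec x) hc' hz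
    have ht : Tendsto (fun w : E × ℝ => (w.2 - d.sec w.1, (d.q w.1 : M))) (𝓝 (x, t))
        (𝓝 (t - d.sec x, (d.q x : M))) :=
      ((continuous_snd.sub (hsc.comp continuous_fst)).prodMk (continuous_subtype_val.comp
        (d.isCoveringMap.continuous.comp continuous_fst))).tendsto (x, t)
    refine ⟨g.symm.trans g', ?_⟩
    filter_upwards [ht.eventually hg', (continuous_fst.tendsto (x, t)).eventually hg] with w h1 h2
    change c.2 (Ψ (w.2 - d.sec w.1) (d.q w.1)) = _
    rw [h1, LinearEquiv.trans_apply]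
    congr 1
    rw [LinearEquiv.eq_symm_apply, map_smul, ← h2, smul_smul, ← Real.exp_add, sub_add_cancel]
    rfl
  exact ⟨E, inferInstance, inferInstance, d, F', hlin.isAffineDiffeo⟩

end Suspension

end RadiantAffine

theorem mainTheorem11 {n : ℕ} {M : Type u} [TopologicalSpace M] [T2Space M] [CompactSpace M]
    [ConnectedSpace M] (A : RadiantAffine.RadiantAtlas n M) :
    -- a total cross-section exists iff `M` is a generalized affine suspension
    ((∃ S : Set M, RadiantAffine.IsTotalCrossSection A S) ↔
      ∃ (N : Type u) (_ : TopologicalSpace N) (_ : T2Space N) (_ : CompactSpace N)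
        (_ : ConnectedSpace N) (B : RadiantAffine.ProjectiveAtlas n N),
        RadiantAffine.IsSuspensionOver A B) ∧
    -- every connected total cross-section is projectively diffeomorphic to the base of
    -- a generalized affine suspension that is affinely diffeomorphic to `M`
    (∀ S : Set M, RadiantAffine.IsTotalCrossSection A S → IsConnected S →
      ∃ (N : Type u) (_ : TopologicalSpace N) (_ : T2Space N) (_ : CompactSpace N)
        (_ : ConnectedSpace N) (B : RadiantAffine.ProjectiveAtlas n N),
        RadiantAffine.IsSuspensionOver A B ∧ RadiantAffine.CrossSectionEquiv A S B) ∧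
    -- the base of every such suspension is projectively diffeomorphic to a total cross-section
    (∀ (N : Type u) [TopologicalSpace N] [T2Space N] [CompactSpace N] [ConnectedSpace N]
      (B : RadiantAffine.ProjectiveAtlas n N), RadiantAffine.IsSuspensionOver A B →
      ∃ S : Set M, RadiantAffine.IsTotalCrossSection A S ∧
        RadiantAffine.CrossSectionEquiv A S B) := by
  have h2 : ∀ S : Set M, RadiantAffine.IsTotalCrossSection A S → IsConnected S →
      ∃ (N : Type u) (_ : TopologicalSpace N) (_ : T2Space N) (_ : CompactSpace N)
        (_ : ConnectedSpace N) (B : RadiantAffine.ProjectiveAtlas n N),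
        RadiantAffine.IsSuspensionOver A B ∧ RadiantAffine.CrossSectionEquiv A S B := by
    intro S hS hSc
    obtain ⟨Ψ, hΨ⟩ := RadiantAffine.exists_isRadialFlow A
    exact ⟨S, inferInstance, inferInstance, isCompact_iff_compactSpace.1 hS.isClosed.isCompact,
      isConnected_iff_connectedSpace.1 hSc, RadiantAffine.inducedAtlas hS hΨ,
      hS.isSuspensionOver hΨ hSc, RadiantAffine.crossSectionEquiv_inducedAtlas hS hΨ⟩
  have h3 : ∀ (N : Type u) [TopologicalSpace N] [T2Space N] [CompactSpace N] [ConnectedSpace N]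
      (B : RadiantAffine.ProjectiveAtlas n N), RadiantAffine.IsSuspensionOver A B →
      ∃ S : Set M, RadiantAffine.IsTotalCrossSection A S ∧
        RadiantAffine.CrossSectionEquiv A S B :=
    fun N _ _ _ _ B h => h.exists_isTotalCrossSection
  refine ⟨⟨?_, ?_⟩, h2, h3⟩
  · rintro ⟨S, hS⟩
    obtain ⟨Ψ, hΨ⟩ := RadiantAffine.exists_isRadialFlow A
    obtain ⟨x⟩ := (inferInstance : Nonempty M)
    obtain ⟨t, ht⟩ := (hS.isFlowSection hΨ).meets x
    -- The given cross-section may be disconnected, whereas the base of a suspension is connected;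
    -- one component suffices.
    have hcon : IsConnected (Subtype.val '' connectedComponent (⟨_, ht⟩ : S)) :=
      isConnected_connectedComponent.image _ continuous_subtype_val.continuousOn
    obtain ⟨N, i1, i2, i3, i4, B, hB, -⟩ := h2 _ (hS.component hΨ ⟨_, ht⟩) hcon
    exact ⟨N, i1, i2, i3, i4, B, hB⟩
  · rintro ⟨N, i1, i2, i3, i4, B, hB⟩
    obtain ⟨S, hS, -⟩ := h3 N B hB
    exact ⟨S, hS⟩
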